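/- **Setting.** Write $\hat f(\xi)=(2\pi)^{-d/2}\int_{\mathbb R^d} f(x)e^{-ix\cdot\xi}\,dx$, extended to $\mathcal S'(\mathbb R^d)$ by duality. Let $\vec a=(a_1,\dots,a_d)$ with $a_i>0$, $\sum_i a_i=d$, and $D_{\vec a}(t)=\mathrm{diag}(t^{a_1},\dots,t^{a_d})$. Let $|0|_{\vec a}=0$ and, for $\xi\ne0$, let $|\xi|_{\vec a}$ be the unique $t>0$ with $|D_{\vec a}(1/t)\xi|=1$; put $B(\xi,r)=\{\zeta:|\zeta-\xi|_{\vec a}<r\}$. Call a positive function $h$ on $S\subset\mathbb R^d\setminus\{0\}$ moderate on $S$ if there are $R,\delta_0>0$ such that $|\xi-\zeta|_{\vec a}\le\delta_0h(\xi)$ implies $R^{-1}\le h(\xi)/h(\zeta)\le R$ for $\xi,\zeta\in S$. A *hybrid regulation function* is a function $\tilde h=\rho h_1+(1-\rho)h_2$ on $\mathbb R^d\setminus\{0\}$, where $\rho$ is $C^1$ with $0\le\rho\le1$, $\rho=1$ for $0<|\xi|_{\vec a}\le\frac23$ and $\rho=0$ for $|\xi|_{\vec a}\ge\frac43$; $h_1$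 is moderate on $\{0<|\xi|_{\vec a}\le\frac43\}$ with $c_0|\xi|_{\vec a}^r\le h_1(\xi)\le c_1|\xi|_{\vec a}$ there, for some $c_0,c_1>0$, $r\ge1$; and $h_2$ is moderate on $\{|\xi|_{\vec a}\ge\frac23\}$ with $c_2\le h_2(\xi)\le c_3|\xi|_{\vec a}$ there, for some $c_2,c_3>0$. A family $\{Q_j\}$ of measurable sets is an *admissible covering* if $\bigcup_jQ_j=\mathbb R^d\setminus\{0\}$ and the number of $i$ with $Q_i\cap Q_j\ne\emptyset$ is bounded uniformly in $j$. For invertible affine maps $T_j=A_j\cdot+b_j$ (countably many), $\{T_jQ\}$ is a *structured admissible covering* if there are bounded open sets $P,Q$ with $\overline P\subset Q\subset\mathbb R^d\setminus\{0\}$ such that $\{T_jP\}$ and $\{T_jQ\}$ are admissible coverings and the entries of $A_k^{-1}A_j$ are bounded by one constant for all $j,k$ with $T_jQ\cap T_kQ\ne\emptyset$. Fix $\vec a$, a hybrid regulation function $\tilde h$, $\delta,\kappa>0$, points $\xi_j\ne0$ and a structured admissible covering $Q_j=T_jQ$, $j\in\mathbb Z$, with $A_j=D_{\vec a}(\delta\tilde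 h(\xi_j))$ and $Q_j=B(\xi_j,\kappa\delta\tilde h(\xi_j))$, indexed so that for some $C>0$: $j\ge0$ if and only if $B(\xi_j,\delta\tilde h(\xi_j))\cap B(0,C)=\emptyset$. Put $|T_j|=|\det A_j|$. Let $K_a\supseteq Q$ be a closed cube, aligned with the coordinate axes, of side-length $2a>0$. **Proposition.** (i) Let $j\in\mathbb Z$, $g\in\mathcal S'(\mathbb R^d)$, $h\in\mathcal S(\mathbb R^d)$ with $\mathrm{supp}(\hat g),\mathrm{supp}(\hat h)\subset T_j(K_a)$. Then $g$ is given by a smooth function, all of whose derivatives have at most polynomial growth, $(g*h)(x):=\langle g,h(x-\cdot)\rangle$ is also such a function, and for every $v\in\mathbb R^d$, with $y_n=A_j^{-1}\tfrac{\pi}{a}n+v$, $$(g*h)(x)=\sum_{n\in\mathbb Z^d}(2\pi)^d(2a)^{-d}|T_j|^{-1}\,g(-y_n)\,h(x+y_n),$$ where the series converges unconditionally both at every $x$ and in $\mathcal S'$. (For $v=-A_j^{-1}b_j$ one has $y_n=T_j^{-1}(\tfrac{\pi}{a}n)$; for $v=0$ it is the linear part of $T_j^{-1}$ that is applied to $\tfrac{\pi}{a}n$.)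 (ii) Let $\{\phi_j\}_{j\in\mathbb Z}\subset\mathcal S(\mathbb R^d)$ be real-valued with $\mathrm{supp}(\phi_j)\subset Q_j$, $\sum_j\phi_j^2(\xi)=1$ for all $\xi\neq0$, and $\sup_{j}\|\partial^\beta(\phi_j\circ T_j)\|_\infty<\infty$ for every multi-index $\beta$. Define $\eta_{n,j}$ by $\hat\eta_{n,j}=\phi_je_{n,j}$, where $$e_{n,j}(\xi)=(2a)^{-d/2}|T_j|^{-1/2}\chi_{K_a}(T_j^{-1}\xi)\,e^{i\frac{\pi}{a}n\cdot T_j^{-1}\xi},$$ and let $\langle f,\eta\rangle:=f(\overline\eta)$. Then for every $f\in\mathcal S'(\mathbb R^d)$, regarded modulo the polynomials $\mathcal P$, $$f=\sum_{j}\sum_{n\in\mathbb Z^d}\langle f,\eta_{n,j}\rangle\,\eta_{n,j}$$ in the following two senses. - Convergence in $\mathcal S'/\mathcal P$, the dual of the space $\mathcal S_0$ of Schwartz functions $\theta$ for which $\hat\theta$ vanishes to infinite order at $0$: for every $\theta\in\mathcal S_0$, $\sum_{j=-k}^{K}\sum_{n\in\{-N,\dots,N\}^d}\langle f,\eta_{n,j}\rangle\int\eta_{n,j}\theta\,dx\to\langle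 f,\theta\rangle$ as $k,K,N\to\infty$ jointly. - Convergence in $\mathcal S'$ with polynomial corrections: for each $j$ the series $u_j=\sum_{n\in\mathbb Z^d}\langle f,\eta_{n,j}\rangle\eta_{n,j}$ converges unconditionally in $\mathcal S'$, and there are polynomials $P_k$ $(k\in\mathbb N)$ and $P_\infty$ such that in $\mathcal S'$ $$f=\lim_{k,K\to\infty}\Big(\sum_{j=-k}^{K}u_j+P_k\Big)+P_\infty .$$ (iii) For every non-negative $\Phi\in C^\infty(\mathbb R^d)$ with $\Phi=1$ on $P$ and $\mathrm{supp}(\Phi)\subset Q$, the functions $\phi_j=\Phi(T_j^{-1}\cdot)\big/\sqrt{\sum_k\Phi(T_k^{-1}\cdot)^2}$ (with value $0$ at the origin) satisfy all the hypotheses on $\{\phi_j\}$ in (ii). -/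

import Mathlib

open MeasureTheory Filter Topology SchwartzMap
open scoped FourierTransform ContDiff

noncomputable section

namespace HomogDecomp

/-- The Euclidean space `ℝ^d`. -/
abbrev E (d : ℕ) : Type := EuclideanSpace ℝ (Fin d)

/-! ### Anisotropic norm and hybrid regulation functions -/

/-- An anisotropy on `ℝ^d`: positive exponents summing to `d`. -/
def IsAnisotropy {d : ℕ} (α : Fin d → ℝ) : Prop :=
  (∀ i, 0 < α i) ∧ ∑ i, α i = d

/-- The anisotropic dilation matrix `diag(t^{α_1}, …, t^{α_d})`. -/
def aniDilation {d : ℕ} (α : Fin d → ℝ) (t : ℝ) : Matrix (Fin d) (Fin d) ℝ :=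
  Matrix.diagonal fun i => t ^ α i

/-- The anisotropic norm: `0` at the origin, and for `ξ ≠ 0` the unique `t > 0` at which the
dilate `D(1/t) ξ` has Euclidean norm `1`. The set below is a singleton for `ξ ≠ 0` and empty for
`ξ = 0`, where `sInf ∅ = 0`. -/
def aniNorm {d : ℕ} (α : Fin d → ℝ) (ξ : E d) : ℝ :=
  sInf {t : ℝ | 0 < t ∧ ‖Matrix.toEuclideanLin (aniDilation α (1 / t)) ξ‖ = 1}

/-- The ball of the quasi-distance `d(ξ, ζ) = |ξ - ζ|_α`. -/
def aniBall {d : ℕ} (α : Fin d → ℝ) (ξ : E d) (r : ℝ) : Set (E d) :=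
  {ζ | aniNorm α (ζ - ξ) < r}

/-- Moderateness, on a set `S`, of a positive function with respect to the quasi-distance. -/
def IsModerateOn {d : ℕ} (α : Fin d → ℝ) (S : Set (E d)) (h : E d → ℝ) : Prop :=
  (∀ ξ ∈ S, 0 < h ξ) ∧
  ∃ R > 0, ∃ δ₀ > 0, ∀ ξ ∈ S, ∀ ζ ∈ S, aniNorm α (ξ - ζ) ≤ δ₀ * h ξ →
    R⁻¹ ≤ h ξ / h ζ ∧ h ξ / h ζ ≤ R

/-- Hybrid regulation functions `ρ h₁ + (1 - ρ) h₂` on `ℝ^d ∖ {0}`. The conditions on `h₁` and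
`h₂` are required where the corresponding function enters the formula. -/
def IsHybridRegulation {d : ℕ} (α : Fin d → ℝ) (ht : E d → ℝ) : Prop :=
  ∃ (ρ h₁ h₂ : E d → ℝ),
    ContDiffOn ℝ 1 ρ {0}ᶜ ∧
    (∀ ξ, ξ ≠ 0 → 0 ≤ ρ ξ ∧ ρ ξ ≤ 1) ∧
    (∀ ξ, ξ ≠ 0 → aniNorm α ξ ≤ 2 / 3 → ρ ξ = 1) ∧
    (∀ ξ, 4 / 3 ≤ aniNorm α ξ → ρ ξ = 0) ∧
    IsModerateOn α {ξ | ξ ≠ 0 ∧ aniNorm α ξ ≤ 4 / 3} h₁ ∧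
    IsModerateOn α {ξ | 2 / 3 ≤ aniNorm α ξ} h₂ ∧
    (∃ c₀ > 0, ∃ c₁ > 0, ∃ r : ℝ, 1 ≤ r ∧ ∀ ξ, ξ ≠ 0 → aniNorm α ξ ≤ 4 / 3 →
      c₀ * aniNorm α ξ ^ r ≤ h₁ ξ ∧ h₁ ξ ≤ c₁ * aniNorm α ξ) ∧
    (∃ c₂ > 0, ∃ c₃ > 0, ∀ ξ, 2 / 3 ≤ aniNorm α ξ →
      c₂ ≤ h₂ ξ ∧ h₂ ξ ≤ c₃ * aniNorm α ξ) ∧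
    ∀ ξ, ξ ≠ 0 → ht ξ = ρ ξ * h₁ ξ + (1 - ρ ξ) * h₂ ξ

/-! ### Structured admissible coverings -/

/-- The affine map `ξ ↦ A ξ + b`. -/
def affMap {d : ℕ} (A : Matrix (Fin d) (Fin d) ℝ) (b ξ : E d) : E d :=
  Matrix.toEuclideanLin A ξ + b

/-- The inverse `ξ ↦ A⁻¹ (ξ - b)` of the affine map `ξ ↦ A ξ + b`, for invertible `A`. -/
def affInv {d : ℕ} (A : Matrix (Fin d) (Fin d) ℝ) (b ξ : E d) : E d :=
  Matrix.toEuclideanLin A⁻¹ (ξ - b)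

/-- Admissible coverings of `ℝ^d ∖ {0}`: measurable sets with union `ℝ^d ∖ {0}`, each of which
meets at most `N` of them, with `N` independent of the set. -/
def IsAdmissibleCovering {d : ℕ} {J : Type*} (Q : J → Set (E d)) : Prop :=
  (∀ j, MeasurableSet (Q j)) ∧ (⋃ j, Q j) = {0}ᶜ ∧
  ∃ N : ℕ, ∀ j, {i | (Q i ∩ Q j).Nonempty}.encard ≤ N

/-- The sets `T_j(Q)`, with `T_j = A_j · + b_j`, form a structured admissible covering of
`ℝ^d ∖ {0}`; `P` is the smaller generating set. -/
structure IsStructuredCovering {d : ℕ} {J : Type*} (A : J → Matrix (Fin d) (Fin d) ℝ)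
    (b : J → E d) (P Q : Set (E d)) : Prop where
  countable : Countable J
  nonempty : Nonempty J
  invertible : ∀ j, IsUnit (A j).det
  isOpen_P : IsOpen P
  isOpen_Q : IsOpen Q
  bounded_Q : Bornology.IsBounded Q
  zero_notMem : (0 : E d) ∉ Q
  closure_subset : closure P ⊆ Q
  covering_P : IsAdmissibleCovering fun j => affMap (A j) (b j) '' P
  covering_Q : IsAdmissibleCovering fun j => affMap (A j) (b j) '' Q
  compat : ∃ K : ℝ, ∀ j k,
    (affMap (A j) (b j) '' Q ∩ affMap (A k) (b k) '' Q).Nonempty →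
      ∀ r s, |((A k)⁻¹ * A j) r s| ≤ K

/-- The cube with centre `c` and side-length `2a`, aligned with the coordinate axes. -/
def cube {d : ℕ} (c : E d) (a : ℝ) : Set (E d) := {ξ | ∀ i, |ξ i - c i| ≤ a}

/-- Square roots of a partition of unity subordinate to the covering `T_j(Q)`: Schwartz functions
`φ_j` supported in `T_j(Q)` whose squares sum to `1` off the origin, such that the functions
`φ_j ∘ T_j` are bounded together with all derivatives, uniformly in `j`. -/
structure IsRootPartition {d : ℕ} {J : Type*} (A : J → Matrix (Fin d) (Fin d) ℝ)
    (b : J → E d) (Q : Set (E d)) (φ : J → 𝓢(E d, ℝ)) : Prop where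
  support : ∀ j, tsupport (φ j) ⊆ affMap (A j) (b j) '' Q
  sum_sq : ∀ ξ, ξ ≠ 0 → HasSum (fun j => φ j ξ ^ 2) 1
  uniform : ∀ m : ℕ, ∃ C : ℝ, ∀ j ξ,
    ‖iteratedFDeriv ℝ m (fun ζ => φ j (affMap (A j) (b j) ζ)) ξ‖ ≤ C

/-! ### The Fourier transform with the normalization `(2π)^{-d/2} ∫ f(x) e^{-i x·ξ} dx` -/

/-- Dilation `ξ ↦ (2π)⁻¹ ξ` as a linear equivalence. -/
def dilEquiv (d : ℕ) : E d ≃L[ℝ] E d :=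
  ContinuousLinearEquiv.smulLeft (Units.mk0 ((2 * Real.pi)⁻¹ : ℝ) (by positivity))

/-- `f ↦ (2π)^{-d/2} ∫ f(x) e^{-i x·ξ} dx` on the Schwartz space; see `fourierS_apply`. -/
def fourierS (d : ℕ) : 𝓢(E d, ℂ) →L[ℂ] 𝓢(E d, ℂ) :=
  (((2 * Real.pi) ^ (-(d : ℝ) / 2) : ℝ) : ℂ) •
    (compCLMOfContinuousLinearEquiv ℂ (dilEquiv d) ∘L FourierTransform.fourierCLM ℂ 𝓢(E d, ℂ))

/-- `f ↦ (2π)^{-d/2} ∫ f(ξ) e^{i x·ξ} dξ` on the Schwartz space; see `fourierInvS_apply`. -/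
def fourierInvS (d : ℕ) : 𝓢(E d, ℂ) →L[ℂ] 𝓢(E d, ℂ) :=
  (((2 * Real.pi) ^ (-(d : ℝ) / 2) : ℝ) : ℂ) •
    (compCLMOfContinuousLinearEquiv ℂ (dilEquiv d) ∘L
      FourierTransform.fourierInvCLM ℂ 𝓢(E d, ℂ))

theorem fourierS_apply {d : ℕ} (f : 𝓢(E d, ℂ)) (ξ : E d) :
    fourierS d f ξ = (((2 * Real.pi) ^ (-(d : ℝ) / 2) : ℝ) : ℂ) *
      ∫ x, Complex.exp (-Complex.I * ((inner ℝ x ξ : ℝ) : ℂ)) * f x := by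
  have h : fourierS d f ξ = (((2 * Real.pi) ^ (-(d : ℝ) / 2) : ℝ) : ℂ) *
      𝓕 (f : E d → ℂ) ((2 * Real.pi)⁻¹ • ξ) := rfl
  rw [h, Real.fourier_eq']
  congr 2
  ext x
  rw [smul_eq_mul, inner_smul_right]
  congr 2
  have : (Real.pi : ℂ) ≠ 0 := by exact_mod_cast Real.pi_ne_zero
  push_cast
  field_simp

theorem fourierInvS_apply {d : ℕ} (f : 𝓢(E d, ℂ)) (x : E d) :
    fourierInvS d f x = (((2 * Real.pi) ^ (-(d : ℝ) / 2) : ℝ) : ℂ) *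
      ∫ ξ, Complex.exp (Complex.I * ((inner ℝ ξ x : ℝ) : ℂ)) * f ξ := by
  have h : fourierInvS d f x = (((2 * Real.pi) ^ (-(d : ℝ) / 2) : ℝ) : ℂ) *
      𝓕⁻ f ((2 * Real.pi)⁻¹ • x) := rfl
  rw [h, SchwartzMap.fourierInv_coe, Real.fourierInv_eq']
  congr 2
  ext ξ
  rw [smul_eq_mul, inner_smul_right]
  congr 2
  have : (Real.pi : ℂ) ≠ 0 := by exact_mod_cast Real.pi_ne_zero
  push_cast
  field_simp

/-- The Fourier transform of a tempered distribution, `⟨ĝ, ψ⟩ = ⟨g, ψ̂⟩`. -/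
def fourierT {d : ℕ} (g : 𝓢'(E d, ℂ)) : 𝓢'(E d, ℂ) :=
  PointwiseConvergenceCLM.precomp ℂ (fourierS d) g

/-! ### Convolution, complex conjugation, the spaces `S₀` and `𝒫` -/

/-- The Schwartz function `y ↦ h (x - y)`. -/
def reflTrans {d : ℕ} (h : 𝓢(E d, ℂ)) (x : E d) : 𝓢(E d, ℂ) :=
  compSubConstCLM ℂ x (compCLMOfContinuousLinearEquiv ℂ (ContinuousLinearEquiv.neg ℝ) h)

theorem reflTrans_apply {d : ℕ} (h : 𝓢(E d, ℂ)) (x y : E d) :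
    reflTrans h x y = h (x - y) := by
  change h (-(y - x)) = h (x - y)
  rw [neg_sub]

/-- The convolution `(g * h)(x) = ⟨g, h (x - ·)⟩ = ∫ g(y) h(x - y) dy` of a tempered distribution
with a Schwartz function. -/
def conv {d : ℕ} (g : 𝓢'(E d, ℂ)) (h : 𝓢(E d, ℂ)) (x : E d) : ℂ := g (reflTrans h x)

/-- Complex conjugation of Schwartz functions. -/
def conjS {d : ℕ} (f : 𝓢(E d, ℂ)) : 𝓢(E d, ℂ) :=
  f.postcompCLM (𝕜 := ℝ) (Complex.conjCLE : ℂ →L[ℝ] ℂ)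

/-- The bracket `⟨f, η⟩`, conjugate linear in the Schwartz function `η`; it extends the
`L²` inner product. -/
def bracket {d : ℕ} (f : 𝓢'(E d, ℂ)) (η : 𝓢(E d, ℂ)) : ℂ := f (conjS η)

/-- A Schwartz function regarded as a tempered distribution. -/
def toT {d : ℕ} (η : 𝓢(E d, ℂ)) : 𝓢'(E d, ℂ) := toTemperedDistributionCLM (E d) ℂ volume η

/-- The Schwartz functions whose Fourier transform vanishes to infinite order at the origin. -/
def IsSZero {d : ℕ} (θ : 𝓢(E d, ℂ)) : Prop :=
  ∀ M : ℕ, ∃ C : ℝ, ∀ k ≤ M, ∀ ξ : E d, ξ ≠ 0 →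
    ‖iteratedFDeriv ℝ k (fourierS d θ) ξ‖ * (‖ξ‖ ^ M + (‖ξ‖ ^ M)⁻¹) ≤ C

/-- The function on `ℝ^d` given by a polynomial in `d` variables. -/
def polyFun {d : ℕ} (p : MvPolynomial (Fin d) ℂ) (x : E d) : ℂ :=
  MvPolynomial.eval (fun i => ((x i : ℝ) : ℂ)) p

theorem polyFun_hasTemperateGrowth {d : ℕ} (p : MvPolynomial (Fin d) ℂ) :
    (polyFun p).HasTemperateGrowth := by
  induction p using MvPolynomial.induction_on with
  | C c =>
    have : polyFun (d := d) (MvPolynomial.C c) = fun _ => c := by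
      ext x; simp [polyFun]
    rw [this]
    exact Function.HasTemperateGrowth.const c
  | add p q hp hq =>
    have : polyFun (p + q) = polyFun p + polyFun q := by
      ext x; simp [polyFun]
    rw [this]
    exact hp.add hq
  | mul_X p i hp =>
    have : polyFun (p * MvPolynomial.X i) = polyFun p * fun x : E d => ((x i : ℝ) : ℂ) := by
      ext x; simp [polyFun]
    rw [this]
    exact hp.mul (Complex.ofRealCLM ∘L
      (EuclideanSpace.proj i : E d →L[ℝ] ℝ)).hasTemperateGrowth

/-- A polynomial regarded as a tempered distribution. -/
def polyT {d : ℕ} (p : MvPolynomial (Fin d) ℂ) : 𝓢'(E d, ℂ) :=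
  Function.HasTemperateGrowth.toTemperedDistribution volume (polyFun_hasTemperateGrowth p)

/-! ### The frame -/

/-- The integer vector `n` as a vector of `ℝ^d`. -/
def intVec {d : ℕ} (n : Fin d → ℤ) : E d := WithLp.toLp 2 fun i => (n i : ℝ)

/-- The exponential `(2a)^{-d/2} |T|^{-1/2} e^{i (π/a) n · T⁻¹ξ}`, where `T = A · + b`. -/
def expFun {d : ℕ} (A : Matrix (Fin d) (Fin d) ℝ) (b : E d) (a : ℝ) (n : Fin d → ℤ)
    (ξ : E d) : ℂ :=
  (((2 * a) ^ (-(d : ℝ) / 2) * |A.det| ^ (-(1 : ℝ) / 2) : ℝ) : ℂ) *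
    Complex.exp (Complex.I * ((Real.pi / a * inner ℝ (intVec n) (affInv A b ξ) : ℝ) : ℂ))

/-- The functions `e_n(ξ) = (2a)^{-d/2} |T|^{-1/2} χ_K(T⁻¹ξ) e^{i (π/a) n · T⁻¹ξ}`. -/
def basisFun {d : ℕ} (A : Matrix (Fin d) (Fin d) ℝ) (b c : E d) (a : ℝ) (n : Fin d → ℤ)
    (ξ : E d) : ℂ :=
  (cube c a).indicator (fun _ => (1 : ℂ)) (affInv A b ξ) * expFun A b a n ξ

theorem hasTemperateGrowth_exp :
    (fun t : ℝ => Complex.exp (Complex.I * (t : ℂ))).HasTemperateGrowth := by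
  have hd : ∀ n : ℕ, iteratedDeriv n (fun t : ℝ => Complex.exp (Complex.I * (t : ℂ))) =
      fun t : ℝ => Complex.I ^ n * Complex.exp (Complex.I * (t : ℂ)) := by
    intro n
    induction n with
    | zero => simp
    | succ n ih =>
      rw [iteratedDeriv_succ, ih]
      ext t
      have h1 : HasDerivAt (fun t : ℝ => Complex.I * (t : ℂ)) (Complex.I * 1) t :=
        (Complex.ofRealCLM.hasDerivAt (x := t)).const_mul Complex.I
      rw [(h1.cexp.const_mul (Complex.I ^ n)).deriv]
      ring
  refine ⟨?_, fun n => ⟨0, 1, fun t => ?_⟩⟩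
  · exact (contDiff_const.mul Complex.ofRealCLM.contDiff).cexp
  · rw [norm_iteratedFDeriv_eq_norm_iteratedDeriv, hd]
    simp [Complex.norm_exp]

theorem expFun_hasTemperateGrowth {d : ℕ} (A : Matrix (Fin d) (Fin d) ℝ) (b : E d) (a : ℝ)
    (n : Fin d → ℤ) : (expFun A b a n).HasTemperateGrowth := by
  have h1 : (fun ξ : E d => Real.pi / a * inner ℝ (intVec n) (affInv A b ξ)).HasTemperateGrowth :=
      by
    have : (fun ξ : E d => Real.pi / a * inner ℝ (intVec n) (affInv A b ξ)) = fun ξ =>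
        ((Real.pi / a) • (innerSL ℝ (intVec n) ∘L
          (Matrix.toEuclideanLin A⁻¹).toContinuousLinearMap)) ξ -
        ((Real.pi / a) • (innerSL ℝ (intVec n) ∘L
          (Matrix.toEuclideanLin A⁻¹).toContinuousLinearMap)) b := by
      ext ξ
      simp [affInv, inner_sub_right, mul_sub]
    rw [this]
    exact (ContinuousLinearMap.hasTemperateGrowth _).sub (.const _)
  exact (Function.HasTemperateGrowth.const _).mul (hasTemperateGrowth_exp.comp h1)

/-- The Schwartz function `η̂ = φ e_n`; see `frameHat_apply`. The cut-off to the cube in `e_n` is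
immaterial, since it equals `1` on the support of `φ`. -/
def frameHat {d : ℕ} (A : Matrix (Fin d) (Fin d) ℝ) (b : E d) (a : ℝ) (φ : 𝓢(E d, ℝ))
    (n : Fin d → ℤ) : 𝓢(E d, ℂ) :=
  smulLeftCLM ℂ (expFun A b a n) (φ.postcompCLM (𝕜 := ℝ) Complex.ofRealCLM)

theorem frameHat_apply {d : ℕ} {A : Matrix (Fin d) (Fin d) ℝ} (hA : IsUnit A.det) (b : E d)
    {c : E d} {a : ℝ} {Q : Set (E d)} (hQ : Q ⊆ cube c a) {φ : 𝓢(E d, ℝ)}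
    (hφ : tsupport φ ⊆ affMap A b '' Q) (n : Fin d → ℤ) (ξ : E d) :
    frameHat A b a φ n ξ = (φ ξ : ℂ) * basisFun A b c a n ξ := by
  have h : frameHat A b a φ n ξ = expFun A b a n ξ * (φ ξ : ℂ) := by
    rw [frameHat, smulLeftCLM_apply_apply (expFun_hasTemperateGrowth A b a n)]
    rfl
  rw [h, basisFun]
  by_cases hξ : ξ ∈ tsupport φ
  · obtain ⟨ζ, hζ, rfl⟩ := hφ hξ
    have hinv : affInv A b (affMap A b ζ) = ζ := by
      ext i
      simp [affInv, affMap, Matrix.toLpLin_apply, Matrix.mulVec_mulVec, Matrix.nonsing_inv_mul _ hA]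
    rw [hinv, Set.indicator_of_mem (hQ hζ)]
    ring
  · rw [image_eq_zero_of_notMem_tsupport hξ]
    simp

/-- The frame element `η_{n,j}`, given by `η̂_{n,j} = φ_j e_{n,j}`. -/
def frameElem {d : ℕ} (A : Matrix (Fin d) (Fin d) ℝ) (b : E d) (a : ℝ) (φ : 𝓢(E d, ℝ))
    (n : Fin d → ℤ) : 𝓢(E d, ℂ) :=
  fourierInvS d (frameHat A b a φ n)

/-- The box `{-N, …, N}^d` of multi-integers. -/
def box (d N : ℕ) : Finset (Fin d → ℤ) := Fintype.piFinset fun _ => Finset.Icc (-(N : ℤ)) N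

end HomogDecomp

end

open HomogDecomp

/-!
The proof works on the Fourier side. A tempered distribution is handled through a bound
`‖Λ W‖ ≤ C * sNorm m W` by a Schwartz norm, and a test function `θ` through `W = fourierInvS d θ`.

*Sampling.* A Schwartz function supported in a parallelepiped is the sum of its Fourier series
there; multiplied by a cut-off, the series converges in the Schwartz space, because the
coefficients decay rapidly. Pairing with `fourierT g` gives the sampling series. A distribution
with compact spectrum is the function `x ↦ ĝ (χ e^{i x·})` for a cut-off `χ`, and the values of
this function are the pairings that occur in the series. If the spectrum of `h` touches the
boundary of the cell, no cut-off equal to one on it is supported in the cell; then the spectrum of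
`h` is first contracted into the interior, and dominated convergence gives the formula for `h`
itself. See `exists_sampling_series`.

*Frame expansion.* On `T_j(Q)` the expansion of `φ_j² W` is again a Fourier series. The radii
`δ h̃(ξ_j)` are at most a multiple of `|ξ_j|_α` and at least a multiple of a power of
`min 1 |ξ_j|_α`, and the sets `T_j(Q)` have bounded overlap, so that `μ_j = |ξ_j|_α + 1 / |ξ_j|_α`
controls `A_j`, `A_j⁻¹` and the points of `T_j(Q)` polynomially and has a summable negative power
(`isPolyWeight`). For `W` vanishing to high finite order at the origin this makes the whole double
series absolutely convergent in a Schwartz norm (`exists_summable_sNorm_expansion`); its sum is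
`W`, since `∑ φ_j² = 1` (`exists_hasSum_expansion`). Infinite order of vanishing gives the
convergence modulo polynomials.

*Corrections.* For arbitrary `W`, a cut-off Taylor polynomial `∑ i, c_i v_i` at the origin is
subtracted, where `c_i` is the pairing of `θ` with a polynomial (`exists_taylor_correction`). The
expansion of the difference converges, the terms `c_i Λ(φ_j² v_i)` vanish for `j ≥ 0` because the
corresponding `T_j(Q)` avoid a neighbourhood of the origin outside which the `v_i` vanish, and
the remaining ones are pairings of `θ` with a polynomial, for each `k`
(`exists_tendsto_sum_localize_add`).

*Root partitions.* The pullback of `φ_j` along `T_j` is `Φ / √H_j` with `H_j ≥ 1` on `Q` a sum of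
boundedly many functions `Φ² ∘ (T_k⁻¹ T_j)`, whose linear parts are bounded
(`exists_isRootPartition`).
-/

/-! ### Norms on the Schwartz space -/

/-- The norm `max_{k, l ≤ m} sup_x ‖x‖ ^ k ‖D^l w(x)‖` on the Schwartz space. These norms increase
with `m` and define the topology. -/
noncomputable def sNorm {d : ℕ} (m : ℕ) (w : 𝓢(E d, ℂ)) : ℝ :=
  (Finset.Iic (m, m)).sup (schwartzSeminormFamily ℂ (E d) ℂ) w

section sNorm

variable {d : ℕ}

theorem sNorm_nonneg (m : ℕ) (w : 𝓢(E d, ℂ)) : 0 ≤ sNorm m w := apply_nonneg _ _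

theorem sNorm_le {m : ℕ} {w : 𝓢(E d, ℂ)} {B : ℝ} (hB : 0 ≤ B)
    (h : ∀ k ≤ m, ∀ l ≤ m, ∀ x, ‖x‖ ^ k * ‖iteratedFDeriv ℝ l w x‖ ≤ B) : sNorm m w ≤ B := by
  refine Seminorm.finset_sup_apply_le hB fun i hi => ?_
  obtain ⟨h1, h2⟩ := Prod.mk_le_mk.1 (Finset.mem_Iic.1 hi)
  exact SchwartzMap.seminorm_le_bound ℂ _ _ w hB (h _ h1 _ h2)

theorem le_sNorm {m k l : ℕ} (hk : k ≤ m) (hl : l ≤ m) (w : 𝓢(E d, ℂ)) (x : E d) :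
    ‖x‖ ^ k * ‖iteratedFDeriv ℝ l w x‖ ≤ sNorm m w := by
  refine (SchwartzMap.le_seminorm ℂ k l w x).trans ?_
  exact Seminorm.le_finset_sup_apply (p := schwartzSeminormFamily ℂ (E d) ℂ) (i := (k, l))
    (Finset.mem_Iic.2 (Prod.mk_le_mk.2 ⟨hk, hl⟩))

theorem one_add_pow_le_sNorm {m k l : ℕ} (hk : k ≤ m) (hl : l ≤ m) (w : 𝓢(E d, ℂ)) (x : E d) :
    (1 + ‖x‖) ^ k * ‖iteratedFDeriv ℝ l w x‖ ≤ 2 ^ m * sNorm m w :=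
  SchwartzMap.one_add_le_sup_seminorm_apply (𝕜 := ℂ) (m := (m, m)) hk hl w x

theorem norm_le_sNorm (m : ℕ) (w : 𝓢(E d, ℂ)) (x : E d) :
    ‖w x‖ ≤ 2 ^ m * sNorm m w * ((1 + ‖x‖) ^ m)⁻¹ := by
  have h := one_add_pow_le_sNorm le_rfl (Nat.zero_le m) w x
  rw [norm_iteratedFDeriv_zero] at h
  rw [← div_eq_mul_inv, le_div_iff₀ (by positivity), mul_comm]
  exact h

theorem exists_sNorm_of_finset (s : Finset (ℕ × ℕ)) :
    ∃ m, ∀ w : 𝓢(E d, ℂ), s.sup (schwartzSeminormFamily ℂ (E d) ℂ) w ≤ sNorm m w := by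
  refine ⟨s.sup Prod.fst + s.sup Prod.snd, fun w => ?_⟩
  refine Seminorm.finset_sup_apply_le (sNorm_nonneg _ _) fun i hi => ?_
  refine Seminorm.le_finset_sup_apply (p := schwartzSeminormFamily ℂ (E d) ℂ) (i := i) ?_
  have h1 : i.1 ≤ s.sup Prod.fst := Finset.le_sup (f := Prod.fst) hi
  have h2 : i.2 ≤ s.sup Prod.snd := Finset.le_sup (f := Prod.snd) hi
  exact Finset.mem_Iic.2 (Prod.mk_le_mk.2 ⟨by omega, by omega⟩)

/-- A tempered distribution has finite order. -/
theorem TemperedDistribution.exists_sNorm_bound (Λ : 𝓢'(E d, ℂ)) :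
    ∃ (m : ℕ) (C : ℝ), 0 ≤ C ∧ ∀ w, ‖Λ w‖ ≤ C * sNorm m w := by
  have hc : Continuous ((normSeminorm ℂ ℂ).comp
      (Λ : 𝓢(E d, ℂ) →ₗ[ℂ] ℂ)) := by
    change Continuous fun w => ‖Λ w‖
    exact (map_continuous Λ).norm
  obtain ⟨s, C, -, h⟩ :=
    Seminorm.bound_of_continuous (schwartz_withSeminorms ℂ (E d) ℂ) _ hc
  obtain ⟨m, hm⟩ := exists_sNorm_of_finset (d := d) s
  exact ⟨m, C, C.2, fun w => (h w).trans (mul_le_mul_of_nonneg_left (hm w) C.2)⟩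

theorem ContinuousLinearMap.exists_sNorm_bound (T : 𝓢(E d, ℂ) →L[ℂ] 𝓢(E d, ℂ)) (n : ℕ) :
    ∃ (m : ℕ) (C : ℝ), 0 ≤ C ∧ ∀ w, sNorm n (T w) ≤ C * sNorm m w := by
  have hc : Continuous (((Finset.Iic (n, n)).sup (schwartzSeminormFamily ℂ (E d) ℂ)).comp
      (T : 𝓢(E d, ℂ) →ₗ[ℂ] 𝓢(E d, ℂ))) := by
    have h : Continuous ((Finset.Iic (n, n)).sup (schwartzSeminormFamily ℂ (E d) ℂ) :
        Seminorm ℂ 𝓢(E d, ℂ)) := by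
      exact Seminorm.continuous_finsetSup fun i _ =>
        (schwartz_withSeminorms ℂ (E d) ℂ).continuous_seminorm i
    exact h.comp (map_continuous T)
  obtain ⟨s, C, -, h⟩ :=
    Seminorm.bound_of_continuous (schwartz_withSeminorms ℂ (E d) ℂ) _ hc
  obtain ⟨m, hm⟩ := exists_sNorm_of_finset (d := d) s
  exact ⟨m, C, C.2, fun w => (h w).trans (mul_le_mul_of_nonneg_left (hm w) C.2)⟩

/-- A series of Schwartz functions that converges pointwise, and absolutely in `sNorm m`, may be
summed inside a functional which is bounded with respect to `sNorm m`. -/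
theorem hasSum_apply_of_summable_sNorm {ι : Type*} (Λ : 𝓢'(E d, ℂ)) {m : ℕ} {C : ℝ}
    (hΛ : ∀ w, ‖Λ w‖ ≤ C * sNorm m w) {w : ι → 𝓢(E d, ℂ)} {w₀ : 𝓢(E d, ℂ)}
    (hs : Summable fun i => sNorm m (w i)) (hw : ∀ x, HasSum (fun i => w i x) (w₀ x)) :
    HasSum (fun i => Λ (w i)) (Λ w₀) := by
  have hb : ∀ (l : ℕ) (i : ι) (x : E d), l ≤ m → ‖iteratedFDeriv ℝ l (w i) x‖ ≤ sNorm m (w i) := by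
    intro l i x hl
    simpa using le_sNorm (Nat.zero_le m) hl (w i) x
  have hD : ∀ l ≤ m, ∀ x, HasSum (fun i => iteratedFDeriv ℝ l (w i) x)
      (iteratedFDeriv ℝ l w₀ x) := by
    intro l hl x
    have h1 : (fun y => ∑' i, w i y) = w₀ := funext fun y => (hw y).tsum_eq
    have h2 := congrFun (iteratedFDeriv_tsum (𝕜 := ℝ) (N := (m : ℕ∞)) (f := fun i => w i)
      (v := fun _ i => sNorm m (w i)) (fun i => (w i).smooth _) (fun _ _ => hs)
      (fun l i x hl => hb l i x (by exact_mod_cast hl)) (k := l) (by exact_mod_cast hl)) x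
    rw [h1] at h2
    rw [h2]
    exact (Summable.of_norm_bounded hs fun i => hb l i x hl).hasSum
  have htail : ∀ F : Finset ι, sNorm m (w₀ - ∑ i ∈ F, w i) ≤ ∑' i : {i // i ∉ F}, sNorm m (w i) := by
    intro F
    refine sNorm_le (tsum_nonneg fun _ => sNorm_nonneg _ _) fun k hk l hl x => ?_
    have hsub : iteratedFDeriv ℝ l (⇑(w₀ - ∑ i ∈ F, w i)) x =
        ∑' i : {i // i ∉ F}, iteratedFDeriv ℝ l (w i) x := by
      have h1 : (⇑(w₀ - ∑ i ∈ F, w i) : E d → ℂ) = ⇑w₀ - ∑ i ∈ F, ⇑(w i) := by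
        ext y; simp
      have h2 : iteratedFDeriv ℝ l (∑ i ∈ F, ⇑(w i)) x = ∑ i ∈ F, iteratedFDeriv ℝ l (w i) x := by
        have := iteratedFDeriv_sum (𝕜 := ℝ) (f := fun i => ⇑(w i)) (u := F) (i := l)
          (fun j _ => (w j).smooth _)
        rw [show (∑ i ∈ F, ⇑(w i)) = (fun y => ∑ i ∈ F, w i y) by ext y; simp, this]
        simp
      rw [h1, iteratedFDeriv_sub_apply ((w₀.smooth l).contDiffAt)
        (by
          rw [show (∑ i ∈ F, ⇑(w i)) = (fun y => ∑ i ∈ F, w i y) by ext y; simp]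
          exact (ContDiff.sum fun i _ => (w i).smooth l).contDiffAt), h2,
        ← (hD l hl x).tsum_eq, ← (hD l hl x).summable.sum_add_tsum_compl (s := F)]
      simp only [add_sub_cancel_left]
      rfl
    have hs' : Summable fun i : {i // i ∉ F} => sNorm m (w i) := hs.subtype _
    have hk' : ∀ i : {i // i ∉ F}, ‖x‖ ^ k * ‖iteratedFDeriv ℝ l (w i) x‖ ≤ sNorm m (w i) :=
      fun i => le_sNorm hk hl _ x
    have hn : Summable fun i : {i // i ∉ F} => ‖iteratedFDeriv ℝ l (w i) x‖ :=
      Summable.of_nonneg_of_le (fun _ => norm_nonneg _) (fun i => hb l i x hl) hs'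
    rw [hsub]
    calc ‖x‖ ^ k * ‖∑' i : {i // i ∉ F}, iteratedFDeriv ℝ l (w i) x‖
        ≤ ‖x‖ ^ k * ∑' i : {i // i ∉ F}, ‖iteratedFDeriv ℝ l (w i) x‖ := by
          gcongr; exact norm_tsum_le_tsum_norm hn
      _ = ∑' i : {i // i ∉ F}, ‖x‖ ^ k * ‖iteratedFDeriv ℝ l (w i) x‖ := tsum_mul_left.symm
      _ ≤ _ := (hn.mul_left _).tsum_le_tsum hk' hs'
  rw [HasSum, SummationFilter.unconditional_filter, tendsto_iff_norm_sub_tendsto_zero]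
  have h0 : Tendsto (fun F : Finset ι => |C| * ∑' i : {i // i ∉ F}, sNorm m (w i)) atTop (𝓝 0) := by
    simpa using (tendsto_tsum_compl_atTop_zero fun i => sNorm m (w i)).const_mul |C|
  refine squeeze_zero (fun _ => norm_nonneg _) (fun F => ?_) h0
  rw [← map_sum, norm_sub_rev, ← map_sub]
  refine (hΛ _).trans ?_
  exact (mul_le_mul_of_nonneg_right (le_abs_self C) (sNorm_nonneg _ _)).trans
    (mul_le_mul_of_nonneg_left (htail F) (abs_nonneg C))

end sNorm

/-! ### Modulation and translation of Schwartz functions -/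

/-- The character `ξ ↦ e^{i y·ξ}`. -/
noncomputable def character {d : ℕ} (y ξ : E d) : ℂ :=
  Complex.exp (Complex.I * ((inner ℝ y ξ : ℝ) : ℂ))

section character

variable {d : ℕ}

theorem norm_character (y ξ : E d) : ‖character y ξ‖ = 1 := by
  rw [character, mul_comm]; exact Complex.norm_exp_ofReal_mul_I _

theorem character_add (y z ξ : E d) : character (y + z) ξ = character y ξ * character z ξ := by
  rw [character, character, character, ← Complex.exp_add, inner_add_left]
  push_cast
  rw [mul_add]

theorem character_zero (ξ : E d) : character 0 ξ = 1 := by simp [character]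

theorem character_neg_mul (y ξ : E d) : character (-y) ξ * character y ξ = 1 := by
  rw [← character_add, neg_add_cancel, character_zero]

theorem character_comm (y ξ : E d) : character y ξ = character ξ y := by
  rw [character, character, real_inner_comm]

theorem character_hasTemperateGrowth (y : E d) : (character y).HasTemperateGrowth :=
  hasTemperateGrowth_exp.comp (innerSL ℝ y).hasTemperateGrowth

theorem norm_iteratedFDeriv_expI (n : ℕ) (t : ℝ) :
    ‖iteratedFDeriv ℝ n (fun t : ℝ => Complex.exp (Complex.I * (t : ℂ))) t‖ = 1 := by
  have hd : ∀ n : ℕ, iteratedDeriv n (fun t : ℝ => Complex.exp (Complex.I * (t : ℂ))) =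
      fun t : ℝ => Complex.I ^ n * Complex.exp (Complex.I * (t : ℂ)) := by
    intro n
    induction n with
    | zero => simp
    | succ n ih =>
      rw [iteratedDeriv_succ, ih]
      ext t
      have h1 : HasDerivAt (fun t : ℝ => Complex.I * (t : ℂ)) (Complex.I * 1) t :=
        (Complex.ofRealCLM.hasDerivAt (x := t)).const_mul Complex.I
      rw [(h1.cexp.const_mul (Complex.I ^ n)).deriv]
      ring
  rw [norm_iteratedFDeriv_eq_norm_iteratedDeriv, hd]
  simp [Complex.norm_exp]

theorem norm_iteratedFDeriv_character_le (y : E d) (n : ℕ) (ξ : E d) :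
    ‖iteratedFDeriv ℝ n (character y) ξ‖ ≤ ‖y‖ ^ n := by
  have h : character y = (fun t : ℝ => Complex.exp (Complex.I * (t : ℂ))) ∘ (innerSL ℝ y) := rfl
  rw [h, ContinuousLinearMap.iteratedFDeriv_comp_right (innerSL ℝ y)
    (n := ∞) (by exact hasTemperateGrowth_exp.1) ξ (by exact_mod_cast le_top)]
  refine (ContinuousMultilinearMap.norm_compContinuousLinearMap_le _ _).trans ?_
  rw [norm_iteratedFDeriv_expI, one_mul, Finset.prod_const, Finset.card_univ, Fintype.card_fin,
    innerSL_apply_norm]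

/-- Multiplication of Schwartz functions by the character `e^{i y·ξ}`. -/
noncomputable def modS (y : E d) : 𝓢(E d, ℂ) →L[ℂ] 𝓢(E d, ℂ) := smulLeftCLM ℂ (character y)

theorem modS_apply (y : E d) (w : 𝓢(E d, ℂ)) (ξ : E d) : modS y w ξ = character y ξ * w ξ :=
  smulLeftCLM_apply_apply (character_hasTemperateGrowth y) w ξ

theorem modS_modS (y z : E d) (w : 𝓢(E d, ℂ)) : modS y (modS z w) = modS (y + z) w := by
  ext ξ
  rw [modS_apply, modS_apply, modS_apply, character_add, mul_assoc]

theorem sNorm_modS_le (m : ℕ) (y : E d) (w : 𝓢(E d, ℂ)) :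
    sNorm m (modS y w) ≤ 2 ^ m * (1 + ‖y‖) ^ m * sNorm m w := by
  refine sNorm_le (by have := sNorm_nonneg m w; positivity) fun k hk l hl x => ?_
  have h1 : (⇑(modS y w) : E d → ℂ) = fun ξ => character y ξ * w ξ := funext fun ξ =>
    modS_apply y w ξ
  rw [h1]
  have h2 := norm_iteratedFDeriv_mul_le (𝕜 := ℝ) (A := ℂ) (n := l) (N := ∞)
    (f := character y) (g := w)
    (character_hasTemperateGrowth y).1 (w.smooth ⊤) x (by exact_mod_cast le_top)
  calc ‖x‖ ^ k * _ ≤ ‖x‖ ^ k * _ := mul_le_mul_of_nonneg_left h2 (by positivity)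
    _ = ∑ i ∈ Finset.range (l + 1), (l.choose i : ℝ) * ‖iteratedFDeriv ℝ i (character y) x‖ *
        (‖x‖ ^ k * ‖iteratedFDeriv ℝ (l - i) w x‖) := by
      rw [Finset.mul_sum]; exact Finset.sum_congr rfl fun _ _ => by ring
    _ ≤ ∑ i ∈ Finset.range (l + 1), (l.choose i : ℝ) * (1 + ‖y‖) ^ m * sNorm m w := by
      refine Finset.sum_le_sum fun i hi => ?_
      have hi' : i ≤ m := by have := Finset.mem_range.1 hi; omega
      have h3 : ‖iteratedFDeriv ℝ i (character y) x‖ ≤ (1 + ‖y‖) ^ m :=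
        (norm_iteratedFDeriv_character_le y i x).trans
          ((pow_le_pow_left₀ (norm_nonneg y) (by linarith) i).trans
            (pow_le_pow_right₀ (by have := norm_nonneg y; linarith) hi'))
      have h4 := le_sNorm hk ((Nat.sub_le l i).trans hl) w x
      have := sNorm_nonneg m w
      gcongr
    _ = 2 ^ l * (1 + ‖y‖) ^ m * sNorm m w := by
      rw [← Finset.sum_mul, ← Finset.sum_mul]
      congr 2
      exact_mod_cast Nat.sum_range_choose l
    _ ≤ _ := by
      have := sNorm_nonneg m w
      gcongr
      norm_num

end character

/-! ### Fourier series of functions supported in the unit cube -/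

section FourierSeries

variable {d : ℕ}

/-- The representative of `t` modulo `ℤ^d` in the unit cube centred at the origin. -/
noncomputable def fracVec (t : Fin d → ℝ) : E d := WithLp.toLp 2 fun i => t i - round (t i)

theorem fracVec_add_intCast (t : Fin d → ℝ) (k : Fin d → ℤ) :
    fracVec (fun i => t i + k i) = fracVec t := by
  ext i
  simp [fracVec, round_add_intCast]

theorem eq_zero_of_half_le {u : 𝓢(E d, ℂ)} (hu : ∀ t : E d, (∃ i, 1 / 2 < |t i|) → u t = 0)
    {t : E d} {i : Fin d} (ht : 1 / 2 ≤ |t i|) : u t = 0 := by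
  have h1 : Tendsto (fun s : ℝ => s • t) (𝓝[>] 1) (𝓝 t) := by
    have : Tendsto (fun s : ℝ => s • t) (𝓝 1) (𝓝 ((1 : ℝ) • t)) :=
      (continuous_id.smul continuous_const).tendsto _
    rw [one_smul] at this
    exact this.mono_left nhdsWithin_le_nhds
  refine tendsto_nhds_unique ((u.continuous.tendsto t).comp h1) ?_
  refine tendsto_const_nhds.congr' ?_
  filter_upwards [self_mem_nhdsWithin] with s hs
  have hs' : (1 : ℝ) < s := hs
  refine (hu _ ⟨i, ?_⟩).symm
  rw [PiLp.smul_apply, smul_eq_mul, abs_mul, abs_of_pos (by linarith)]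
  nlinarith

theorem exists_lipschitz (u : 𝓢(E d, ℂ)) : ∃ K : ℝ, 0 ≤ K ∧ ∀ x y, ‖u x - u y‖ ≤ K * ‖x - y‖ := by
  refine ⟨sNorm 1 u, sNorm_nonneg _ _, fun x y => ?_⟩
  refine convex_univ.norm_image_sub_le_of_norm_fderiv_le (𝕜 := ℝ)
    (fun z _ => u.differentiableAt) (fun z _ => ?_) (Set.mem_univ y) (Set.mem_univ x)
  have := le_sNorm (Nat.zero_le 1) le_rfl u z
  rwa [pow_zero, one_mul, ← zero_add 1, ← norm_iteratedFDeriv_fderiv, norm_iteratedFDeriv_zero]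
    at this

theorem continuous_comp_fracVec {u : 𝓢(E d, ℂ)}
    (hu : ∀ t : E d, (∃ i, 1 / 2 < |t i|) → u t = 0) :
    Continuous fun t : Fin d → ℝ => u (fracVec t) := by
  obtain ⟨K, hK, hL⟩ := exists_lipschitz u
  have hdist : ∀ (s t : Fin d → ℝ), ‖u (fracVec t) - u (fracVec s)‖ ≤
      2 * (K * ‖(WithLp.toLp 2 t : E d) - WithLp.toLp 2 s‖) := by
    intro s t
    by_cases h : ∀ i, round (t i) = round (s i)
    · have h1 : fracVec t - fracVec s = (WithLp.toLp 2 t : E d) - WithLp.toLp 2 s := by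
        ext i; simp [fracVec, h i]
      have := hL (fracVec t) (fracVec s)
      rw [h1] at this
      have h2 := norm_nonneg ((WithLp.toLp 2 t : E d) - WithLp.toLp 2 s)
      nlinarith [mul_nonneg hK h2]
    · push Not at h
      obtain ⟨i, hi⟩ := h
      have key : ∀ s t : Fin d → ℝ, round (t i) ≠ round (s i) → ‖u (fracVec t)‖ ≤
          K * ‖(WithLp.toLp 2 t : E d) - WithLp.toLp 2 s‖ := by
        intro s t hi
        -- the translate of `s` by the integer vector of `t` lies outside the open cube
        have h0 : u (WithLp.toLp 2 fun i => s i - round (t i)) = 0 := by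
          refine eq_zero_of_half_le hu (i := i) ?_
          change 1 / 2 ≤ |s i - round (t i)|
          by_contra! hlt
          apply hi
          rw [abs_lt] at hlt
          symm
          rw [round_eq, Int.floor_eq_iff]
          constructor <;> linarith [hlt.1, hlt.2]
        have := hL (fracVec t) (WithLp.toLp 2 fun i => s i - round (t i))
        rw [h0, sub_zero] at this
        convert this using 3
        ext j
        simp [fracVec]
      have h1 := key s t hi
      have h2 := key t s hi.symm
      rw [norm_sub_rev] at h2
      linarith [norm_sub_le (u (fracVec t)) (u (fracVec s))]
  rw [continuous_iff_continuousAt]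
  intro s
  rw [ContinuousAt, tendsto_iff_norm_sub_tendsto_zero]
  refine squeeze_zero (fun _ => norm_nonneg _) (fun t => hdist s t) ?_
  have : Continuous fun t : Fin d → ℝ =>
      2 * (K * ‖(WithLp.toLp 2 t : E d) - WithLp.toLp 2 s‖) := by
    have := PiLp.continuous_toLp 2 (fun _ : Fin d => ℝ)
    fun_prop
  simpa using this.tendsto s

theorem fracVec_eq_self_of_lt {t : Fin d → ℝ} (ht : ∀ i, |t i| < 1 / 2) :
    fracVec t = WithLp.toLp 2 t := by
  ext i
  have h := abs_lt.1 (ht i)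
  have : round (t i) = 0 := by
    rw [round_eq, Int.floor_eq_iff]
    constructor <;> push_cast <;> linarith [h.1, h.2]
  simp [fracVec, this]

theorem apply_fracVec_of_le {u : 𝓢(E d, ℂ)} (hu : ∀ t : E d, (∃ i, 1 / 2 < |t i|) → u t = 0)
    {t : Fin d → ℝ} (ht : ∀ i, |t i| ≤ 1 / 2) : u (fracVec t) = u (WithLp.toLp 2 t) := by
  by_cases h : ∀ i, |t i| < 1 / 2
  · rw [fracVec_eq_self_of_lt h]
  · push Not at h
    obtain ⟨i, hi⟩ := h
    have h1 : |t i| = 1 / 2 := le_antisymm (ht i) hi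
    rw [eq_zero_of_half_le hu (t := WithLp.toLp 2 t) (i := i) hi]
    refine eq_zero_of_half_le hu (i := i) ?_
    change 1 / 2 ≤ |t i - round (t i)|
    rcases (abs_eq (by norm_num)).1 h1 with h2 | h2
    · rw [h2, show round (1 / 2 : ℝ) = 1 by rw [round_eq]; norm_num]; norm_num [abs_le]
    · rw [h2, show round (-(1 / 2) : ℝ) = 0 by rw [round_eq]; norm_num]; norm_num

/-- The periodization of a function supported in the unit cube, as a function on the torus. -/
noncomputable def torusFun (u : 𝓢(E d, ℂ)) (x : UnitAddTorus (Fin d)) : ℂ :=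
  u (fracVec fun i => Quotient.out (x i))

theorem torusFun_coe (u : 𝓢(E d, ℂ)) (t : Fin d → ℝ) :
    torusFun u (fun i => (t i : UnitAddCircle)) = u (fracVec t) := by
  have h : ∀ i, ∃ k : ℤ, Quotient.out (t i : UnitAddCircle) = t i + k := by
    intro i
    have h1 : ((Quotient.out (t i : UnitAddCircle) : ℝ) : UnitAddCircle) = t i :=
      Quotient.out_eq _
    rw [← sub_eq_zero, ← AddCircle.coe_sub] at h1
    obtain ⟨k, hk⟩ := (AddCircle.coe_eq_zero_iff _).1 h1
    rw [zsmul_eq_mul, mul_one] at hk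
    exact ⟨k, by linarith⟩
  choose k hk using h
  rw [torusFun, funext hk, fracVec_add_intCast]

theorem continuous_torusFun {u : 𝓢(E d, ℂ)} (hu : ∀ t : E d, (∃ i, 1 / 2 < |t i|) → u t = 0) :
    Continuous (torusFun u) := by
  have hq : IsOpenQuotientMap fun (t : Fin d → ℝ) (i : Fin d) => (t i : UnitAddCircle) := by
    refine ⟨fun x => ⟨fun i => Quotient.out (x i), funext fun i => Quotient.out_eq _⟩,
      by fun_prop, ?_⟩
    exact IsOpenMap.piMap (fun _ => QuotientAddGroup.isOpenMap_coe) (by simp)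
  rw [hq.isQuotientMap.continuous_iff]
  exact (continuous_comp_fracVec hu).congr fun t => (torusFun_coe u t).symm

theorem mFourier_coe (n : Fin d → ℤ) (t : Fin d → ℝ) :
    UnitAddTorus.mFourier n (fun i => (t i : UnitAddCircle)) =
      character ((2 * Real.pi) • intVec n) (WithLp.toLp 2 t) := by
  rw [UnitAddTorus.mFourier, ContinuousMap.coe_mk, character, inner_smul_left]
  simp only [fourier_coe_apply]
  rw [← Complex.exp_sum]
  congr 1
  simp only [intVec, PiLp.inner_apply, RCLike.inner_apply, conj_trivial]
  push_cast
  rw [Finset.mul_sum, Finset.mul_sum]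
  exact Finset.sum_congr rfl fun i _ => by ring

theorem mFourierCoeff_torusFun {u : 𝓢(E d, ℂ)}
    (hu : ∀ t : E d, (∃ i, 1 / 2 < |t i|) → u t = 0) (n : Fin d → ℤ) :
    UnitAddTorus.mFourierCoeff (torusFun u) n = 𝓕 u (intVec n) := by
  rw [UnitAddTorus.mFourierCoeff_eq_integral _ _ fun _ => -(1 / 2)]
  have hm : MeasurableSet {t : Fin d → ℝ | ∀ i, t i ∈ Set.Ioc (-(1 / 2) : ℝ) (-(1 / 2) + 1)} :=
    MeasurableSet.univ_pi' fun i => measurableSet_Ioc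
  have h1 : ∀ t ∈ {t : Fin d → ℝ | ∀ i, t i ∈ Set.Ioc (-(1 / 2) : ℝ) (-(1 / 2) + 1)},
      UnitAddTorus.mFourier (-n) (fun i => (t i : UnitAddCircle)) •
        torusFun u (fun i => (t i : UnitAddCircle)) =
      character ((2 * Real.pi) • intVec (-n)) (WithLp.toLp 2 t) * u (WithLp.toLp 2 t) := by
    intro t ht
    rw [mFourier_coe, torusFun_coe, smul_eq_mul, apply_fracVec_of_le hu]
    intro i
    have := ht i
    rw [abs_le]
    exact ⟨this.1.le, by linarith [this.2]⟩
  rw [setIntegral_congr_fun hm h1, setIntegral_eq_integral_of_forall_compl_eq_zero,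
    SchwartzMap.fourier_coe, Real.fourier_eq',
    ← (PiLp.volume_preserving_toLp (Fin d)).integral_comp
      (MeasurableEquiv.toLp 2 (Fin d → ℝ)).measurableEmbedding]
  · refine integral_congr_ae (ae_of_all _ fun t => ?_)
    dsimp only
    rw [smul_eq_mul, character, inner_smul_left, real_inner_comm]
    congr 2
    have : intVec (-n) = -(intVec n : E d) := by ext i; simp [intVec]
    rw [this, inner_neg_right]
    simp
    ring
  · intro t ht
    rw [mul_eq_zero]
    right
    simp only [Set.mem_ofPred_eq, not_forall, Set.mem_Ioc, not_and_or, not_lt, not_le] at ht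
    obtain ⟨i, hi⟩ := ht
    refine eq_zero_of_half_le hu (i := i) ?_
    change 1 / 2 ≤ |t i|
    rw [le_abs]
    rcases hi with hi | hi
    · right; linarith
    · left; linarith

theorem norm_intVec_ge (n : Fin d → ℤ) (i : Fin d) : |(n i : ℝ)| ≤ ‖(intVec n : E d)‖ := by
  have := PiLp.norm_apply_le (intVec n : E d) i
  simpa [intVec] using this

theorem summable_one_add_norm_intVec :
    Summable fun n : Fin d → ℤ => ((1 + ‖(intVec n : E d)‖) ^ (2 * d))⁻¹ := by
  have h1 : Summable fun k : ℤ => ((1 + |(k : ℝ)|) ^ 2)⁻¹ := by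
    refine Summable.of_nonneg_of_le (fun _ => by positivity) (fun k => ?_)
      ((Real.summable_one_div_int_pow (p := 2)).2 (by norm_num) |>.add
        (summable_of_hasFiniteSupport (f := fun k : ℤ => if k = 0 then (1 : ℝ) else 0)
          ((Set.finite_singleton 0).subset (by intro k; simp))))
    by_cases hk : k = 0
    · simp [hk]
    · have : (0 : ℝ) < |(k : ℝ)| := by positivity
      rw [if_neg hk, add_zero, one_div, ← sq_abs (k : ℝ)]
      gcongr
      linarith
  have h2 : Summable fun n : Fin d → ℤ => ∏ i, ((1 + |(n i : ℝ)|) ^ 2)⁻¹ := by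
    refine summable_of_sum_le (c := (∑' k : ℤ, ((1 + |(k : ℝ)|) ^ 2)⁻¹) ^ d)
      (fun n => Finset.prod_nonneg fun i _ => by positivity) fun F => ?_
    calc ∑ n ∈ F, ∏ i, ((1 + |(n i : ℝ)|) ^ 2)⁻¹
        ≤ ∑ n ∈ Fintype.piFinset (fun i => F.image fun n : Fin d → ℤ => n i), ∏ i, ((1 + |(n i : ℝ)|) ^ 2)⁻¹ := by
          refine Finset.sum_le_sum_of_subset_of_nonneg (fun n hn => ?_)
            fun n _ _ => Finset.prod_nonneg fun i _ => by positivity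
          exact Fintype.mem_piFinset.2 fun i => Finset.mem_image_of_mem _ hn
      _ = ∏ i, ∑ k ∈ F.image (fun n : Fin d → ℤ => n i), ((1 + |(k : ℝ)|) ^ 2)⁻¹ :=
          (Finset.prod_univ_sum (fun i => F.image fun n : Fin d → ℤ => n i)
            (fun _ (k : ℤ) => ((1 + |(k : ℝ)|) ^ 2)⁻¹)).symm
      _ ≤ ∏ i : Fin d, ∑' k : ℤ, ((1 + |(k : ℝ)|) ^ 2)⁻¹ := by
          refine Finset.prod_le_prod (fun i _ => Finset.sum_nonneg fun k _ => by positivity)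
            fun i _ => h1.sum_le_tsum _ fun k _ => by positivity
      _ = _ := by rw [Finset.prod_const, Finset.card_univ, Fintype.card_fin]
  refine Summable.of_nonneg_of_le (fun _ => by positivity) (fun n => ?_) h2
  rw [Finset.prod_inv_distrib]
  refine inv_anti₀ (Finset.prod_pos fun i _ => by positivity) ?_
  · calc ∏ i, (1 + |(n i : ℝ)|) ^ 2 ≤ ∏ i : Fin d, (1 + ‖(intVec n : E d)‖) ^ 2 := by
          gcongr with i; exact norm_intVec_ge n i
      _ = _ := by rw [Finset.prod_const, Finset.card_univ, Fintype.card_fin, ← pow_mul]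

/-- The Fourier series of a Schwartz function supported in the unit cube converges to its
periodization. -/
theorem hasSum_fourier_fracVec {u : 𝓢(E d, ℂ)}
    (hu : ∀ t : E d, (∃ i, 1 / 2 < |t i|) → u t = 0) (t : Fin d → ℝ) :
    HasSum (fun n : Fin d → ℤ => 𝓕 u (intVec n) *
      character ((2 * Real.pi) • intVec n) (WithLp.toLp 2 t)) (u (fracVec t)) := by
  have hs : Summable (UnitAddTorus.mFourierCoeff (⟨torusFun u, continuous_torusFun hu⟩ :
      C(UnitAddTorus (Fin d), ℂ))) := by
    refine Summable.of_norm_bounded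
      (summable_one_add_norm_intVec.mul_left (2 ^ (2 * d) * sNorm (2 * d) (𝓕 u))) fun n => ?_
    rw [ContinuousMap.coe_mk, mFourierCoeff_torusFun hu]
    exact norm_le_sNorm _ _ _
  have h := UnitAddTorus.hasSum_mFourier_series_apply_of_summable hs
    (fun i => (t i : UnitAddCircle))
  simpa only [ContinuousMap.coe_mk, mFourierCoeff_torusFun hu, mFourier_coe, torusFun_coe,
    smul_eq_mul] using h

end FourierSeries

/-! ### The Fourier transform on the Schwartz space -/

section Fourier

variable {d : ℕ}

theorem fourierS_eq (w : 𝓢(E d, ℂ)) (y : E d) :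
    fourierS d w y = (((2 * Real.pi) ^ (-(d : ℝ) / 2) : ℝ) : ℂ) * ∫ ξ, character (-y) ξ * w ξ := by
  rw [fourierS_apply]
  congr 2
  ext ξ
  rw [character, inner_neg_left, real_inner_comm]
  push_cast
  ring_nf

theorem fourierInvS_eq (w : 𝓢(E d, ℂ)) (y : E d) :
    fourierInvS d w y =
      (((2 * Real.pi) ^ (-(d : ℝ) / 2) : ℝ) : ℂ) * ∫ ξ, character y ξ * w ξ := by
  rw [fourierInvS_apply]
  congr 2
  ext ξ
  rw [character, real_inner_comm]

theorem fourierInvS_eq_fourierS_neg (w : 𝓢(E d, ℂ)) (y : E d) :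
    fourierInvS d w y = fourierS d w (-y) := by
  rw [fourierInvS_eq, fourierS_eq, neg_neg]

theorem two_pi_rpow_mul_self (d : ℕ) :
    (((2 * Real.pi) ^ (-(d : ℝ) / 2) : ℝ) : ℂ) * (((2 * Real.pi) ^ (-(d : ℝ) / 2) : ℝ) : ℂ) *
      (((2 * Real.pi) ^ d : ℝ) : ℂ) = 1 := by
  have h : (0 : ℝ) < 2 * Real.pi := by positivity
  rw [← Complex.ofReal_mul, ← Complex.ofReal_mul, ← Real.rpow_add h, ← Real.rpow_natCast,
    ← Real.rpow_add h]
  norm_num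

theorem fourierInvS_fourierS (w : 𝓢(E d, ℂ)) : fourierInvS d (fourierS d w) = w := by
  ext x
  have h1 : fourierInvS d (fourierS d w) x = (((2 * Real.pi) ^ (-(d : ℝ) / 2) : ℝ) : ℂ) *
      ∫ ξ, Complex.exp (Complex.I * ((inner ℝ ξ x : ℝ) : ℂ)) * fourierS d w ξ :=
    fourierInvS_apply _ _
  have h2 : ∀ ξ, fourierS d w ξ = (((2 * Real.pi) ^ (-(d : ℝ) / 2) : ℝ) : ℂ) *
      𝓕 w ((2 * Real.pi)⁻¹ • ξ) := fun ξ => rfl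
  set κ := (((2 * Real.pi) ^ (-(d : ℝ) / 2) : ℝ) : ℂ)
  have h3 : ∀ ξ : E d, Complex.exp (Complex.I * ((inner ℝ ξ x : ℝ) : ℂ)) * fourierS d w ξ =
      (fun η : E d => κ * (Complex.exp (((2 * Real.pi * inner ℝ η x : ℝ) : ℂ) * Complex.I) *
        𝓕 w η)) ((2 * Real.pi)⁻¹ • ξ) := by
    intro ξ
    simp only [h2, inner_smul_left]
    have : (2 * Real.pi * ((starRingEnd ℝ) (2 * Real.pi)⁻¹ * inner ℝ ξ x)) = inner ℝ ξ x := by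
      simp only [conj_trivial]; field_simp
    rw [this, mul_comm Complex.I]
    ring
  rw [h1, integral_congr_ae (ae_of_all _ h3), Measure.integral_comp_smul volume (fun η : E d =>
    κ * (Complex.exp (((2 * Real.pi * inner ℝ η x : ℝ) : ℂ) * Complex.I) * 𝓕 w η)),
    integral_const_mul]
  have h4 : ∫ η, Complex.exp (((2 * Real.pi * inner ℝ η x : ℝ) : ℂ) * Complex.I) * 𝓕 w η = w x := by
    have := congrArg (fun u : 𝓢(E d, ℂ) => u x) (FourierTransform.fourierInv_fourier_eq (F := 𝓢(E d, ℂ)) w)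
    rw [← this, SchwartzMap.fourierInv_coe, Real.fourierInv_eq']
    rfl
  rw [h4, finrank_euclideanSpace_fin]
  have h5 := two_pi_rpow_mul_self d
  have h6 : |(((2 * Real.pi)⁻¹ ^ d)⁻¹ : ℝ)| = (2 * Real.pi) ^ d := by
    rw [abs_of_pos (by positivity), inv_pow, inv_inv]
  rw [h6, Complex.real_smul]
  calc _ = (κ * κ * (((2 * Real.pi) ^ d : ℝ) : ℂ)) * w x := by ring
    _ = w x := by rw [h5, one_mul]

theorem fourierS_fourierInvS (w : 𝓢(E d, ℂ)) : fourierS d (fourierInvS d w) = w := by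
  ext x
  have h1 : fourierInvS d w = compCLMOfContinuousLinearEquiv ℂ (ContinuousLinearEquiv.neg ℝ)
      (fourierS d w) := by
    ext y; exact fourierInvS_eq_fourierS_neg w y
  have h2 : fourierS d (compCLMOfContinuousLinearEquiv ℂ (ContinuousLinearEquiv.neg ℝ)
      (fourierS d w)) x = fourierInvS d (fourierS d w) x := by
    rw [fourierS_eq, fourierInvS_eq]
    congr 1
    rw [← integral_neg_eq_self]
    refine integral_congr_ae (ae_of_all _ fun ξ => ?_)
    have h : character (-x) (-ξ) = character x ξ := by simp [character]
    change character (-x) (-ξ) * fourierS d w (- -ξ) = character x ξ * fourierS d w ξ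
    rw [neg_neg, h]
  rw [h1, h2, fourierInvS_fourierS]

theorem integral_fourierS_mul (w u : 𝓢(E d, ℂ)) :
    ∫ x, fourierS d w x * u x = ∫ x, w x * fourierS d u x := by
  -- both sides are the double integral of the kernel, up to the dilation in the normalization
  have hd : ∀ (v₁ v₂ : 𝓢(E d, ℂ)), ∫ x, 𝓕 v₁ ((2 * Real.pi)⁻¹ • x) * v₂ x =
      ((2 * Real.pi) ^ d : ℝ) • ∫ x, 𝓕 v₁ x * v₂ ((2 * Real.pi) • x) := by
    intro v₁ v₂
    have h := Measure.integral_comp_smul (volume : Measure (E d))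
      (fun x => 𝓕 v₁ x * v₂ ((2 * Real.pi) • x)) (2 * Real.pi)⁻¹
    have h0 : (2 * Real.pi : ℝ) ≠ 0 := by positivity
    simp only [smul_smul, mul_inv_cancel₀ h0, one_smul] at h
    rw [h, finrank_euclideanSpace_fin, abs_of_pos (by positivity), inv_pow, inv_inv]
  have h0 : (2 * Real.pi : ℝ) ≠ 0 := by positivity
  set D : E d ≃L[ℝ] E d := ContinuousLinearEquiv.smulLeft (Units.mk0 (2 * Real.pi : ℝ) h0)
  have hD : ∀ (v : 𝓢(E d, ℂ)) x, compCLMOfContinuousLinearEquiv ℂ D v x =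
    v ((2 * Real.pi) • x) := fun v x => rfl
  have hF : ∀ (v : 𝓢(E d, ℂ)) x, ((2 * Real.pi) ^ d : ℝ) •
      𝓕 (compCLMOfContinuousLinearEquiv ℂ D v) x = 𝓕 v ((2 * Real.pi)⁻¹ • x) := by
    intro v x
    have h := Measure.integral_comp_smul (volume : Measure (E d))
      (fun y => Complex.exp (((-2 * Real.pi * inner ℝ y ((2 * Real.pi)⁻¹ • x) : ℝ) : ℂ) *
        Complex.I) • v y) (2 * Real.pi)
    rw [finrank_euclideanSpace_fin, abs_of_pos (by positivity)] at h
    rw [SchwartzMap.fourier_coe, SchwartzMap.fourier_coe, Real.fourier_eq', Real.fourier_eq']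
    have h1 := congrArg (fun z : ℂ => ((2 * Real.pi) ^ d : ℝ) • z) h
    simp only [smul_smul] at h1
    rw [mul_inv_cancel₀ (by positivity), one_smul] at h1
    rw [← h1]
    congr 2
    ext y
    rw [hD, inner_smul_left, inner_smul_right]
    congr 4
    simp only [conj_trivial]
    field_simp
  have hmid : ∫ x, 𝓕 w x * u ((2 * Real.pi) • x) =
      ∫ x, w x * 𝓕 (compCLMOfContinuousLinearEquiv ℂ D u) x :=
    SchwartzMap.integral_fourier_mul_eq w (compCLMOfContinuousLinearEquiv ℂ D u)
  have hl : ∀ (v : 𝓢(E d, ℂ)) x, fourierS d v x = (((2 * Real.pi) ^ (-(d : ℝ) / 2) : ℝ) : ℂ) *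
      𝓕 v ((2 * Real.pi)⁻¹ • x) := fun v ξ => rfl
  simp only [hl, mul_assoc, mul_left_comm (w _)]
  rw [integral_const_mul, integral_const_mul, hd, hmid]
  congr 1
  rw [← integral_smul]
  congr 1
  ext x
  rw [← hF, mul_smul_comm]

theorem integral_fourierInvS_mul (w u : 𝓢(E d, ℂ)) :
    ∫ x, fourierInvS d w x * u x = ∫ x, w x * fourierInvS d u x := by
  have h := integral_fourierS_mul (fourierInvS d w) (fourierInvS d u)
  rw [fourierS_fourierInvS, fourierS_fourierInvS] at h
  exact h.symm

theorem fourierS_modS (x : E d) (w : 𝓢(E d, ℂ)) (y : E d) :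
    fourierS d (modS x w) y = fourierS d w (y - x) := by
  rw [fourierS_eq, fourierS_eq]
  congr 2
  ext ξ
  rw [modS_apply, ← mul_assoc, ← character_add, neg_sub, sub_eq_neg_add]

theorem fourierS_modS_fourierS (x : E d) (h : 𝓢(E d, ℂ)) :
    fourierS d (modS x (fourierS d h)) = reflTrans h x := by
  ext y
  rw [fourierS_modS, reflTrans_apply, ← neg_sub x y, ← fourierInvS_eq_fourierS_neg,
    fourierInvS_fourierS]

theorem fourierT_apply (g : 𝓢'(E d, ℂ)) (w : 𝓢(E d, ℂ)) : fourierT g w = g (fourierS d w) := rfl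

/-- A tempered distribution, in terms of its Fourier transform. -/
theorem apply_eq_fourierT (g : 𝓢'(E d, ℂ)) (w : 𝓢(E d, ℂ)) :
    g w = fourierT g (fourierInvS d w) := by
  rw [fourierT_apply, fourierS_fourierInvS]

theorem conv_eq_fourierT (g : 𝓢'(E d, ℂ)) (h : 𝓢(E d, ℂ)) (x : E d) :
    conv g h x = fourierT g (modS x (fourierS d h)) := by
  rw [fourierT_apply, fourierS_modS_fourierS, conv]

theorem conjS_apply (w : 𝓢(E d, ℂ)) (x : E d) : conjS w x = starRingEnd ℂ (w x) := rfl

theorem conjS_fourierInvS (w : 𝓢(E d, ℂ)) : conjS (fourierInvS d w) = fourierS d (conjS w) := by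
  ext y
  rw [conjS_apply, fourierInvS_eq, fourierS_eq, map_mul, Complex.conj_ofReal, ← integral_conj]
  congr 2
  ext ξ
  rw [map_mul, conjS_apply]
  congr 1
  rw [character, character, ← Complex.exp_conj]
  simp

end Fourier

/-! ### Fourier series over a parallelepiped -/

section Affine

variable {d : ℕ}

/-- The Schwartz function `t ↦ w (L t + s)`. -/
noncomputable def pullS (L : E d ≃L[ℝ] E d) (s : E d) (w : 𝓢(E d, ℂ)) : 𝓢(E d, ℂ) :=
  compCLMOfContinuousLinearEquiv ℂ L (compSubConstCLM ℂ (-s) w)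

theorem pullS_apply (L : E d ≃L[ℝ] E d) (s : E d) (w : 𝓢(E d, ℂ)) (t : E d) :
    pullS L s w t = w (L t + s) := by
  change w (L t - -s) = _
  rw [sub_neg_eq_add]

/-- The point of the lattice `2π (L⁻¹)ᵀ ℤ^d` with index `n`; the characters with these frequencies
are the ones which are periodic with respect to `L ℤ^d`. -/
noncomputable def dualVec (L : E d ≃L[ℝ] E d) (n : Fin d → ℤ) : E d :=
  (2 * Real.pi) • ContinuousLinearMap.adjoint (L.symm : E d →L[ℝ] E d) (intVec n)

theorem character_dualVec (L : E d ≃L[ℝ] E d) (n : Fin d → ℤ) (t : E d) :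
    character (dualVec L n) (L t) = character ((2 * Real.pi) • intVec n) t := by
  rw [character, character, dualVec, inner_smul_left, inner_smul_left,
    ContinuousLinearMap.adjoint_inner_left]
  simp

/-- The Fourier coefficient of index `n` with respect to the lattice `L ℤ^d`. -/
noncomputable def fcoef (L : E d ≃L[ℝ] E d) (w : 𝓢(E d, ℂ)) (n : Fin d → ℤ) : ℂ :=
  ((|(L : E d →L[ℝ] E d).det|⁻¹ : ℝ) : ℂ) * ∫ ξ, character (-dualVec L n) ξ * w ξ

theorem fourier_pullS (L : E d ≃L[ℝ] E d) (s : E d) (w : 𝓢(E d, ℂ)) (n : Fin d → ℤ) :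
    𝓕 (pullS L s w) (intVec n) = fcoef L w n * character (dualVec L n) s := by
  set f : E d → ℂ := fun ξ => character (-dualVec L n) ξ * w ξ with hf
  have h2 : ∫ t, f (L t + s) = ((|(L : E d →L[ℝ] E d).det|⁻¹ : ℝ) : ℂ) * ∫ ξ, f ξ := by
    have := integral_image_eq_integral_abs_det_fderiv_smul (volume : Measure (E d))
      (f := L) (f' := fun _ => (L : E d →L[ℝ] E d)) (s := Set.univ) MeasurableSet.univ
      (fun x _ => L.hasFDerivAt.hasFDerivWithinAt) L.injective.injOn (fun ξ => f (ξ + s))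
    rw [Set.image_univ, L.surjective.range_eq, Measure.restrict_univ, integral_smul,
      integral_add_right_eq_self f s] at this
    rw [this, Complex.real_smul, ← mul_assoc, ← Complex.ofReal_mul, inv_mul_cancel₀,
      Complex.ofReal_one, one_mul]
    rw [abs_ne_zero]
    exact (LinearEquiv.isUnit_det' L.toLinearEquiv).ne_zero
  rw [SchwartzMap.fourier_coe, Real.fourier_eq', fcoef, ← h2, mul_comm (∫ t, f (L t + s)),
    ← integral_const_mul]
  congr 1
  ext t
  have h3 : character (dualVec L n) s * character (-dualVec L n) (L t + s) =
      character (-((2 * Real.pi) • intVec n)) t := by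
    have h4 : character (-dualVec L n) (L t + s) =
        character (-dualVec L n) (L t) * character (-dualVec L n) s := by
      rw [character_comm, character_add, character_comm, character_comm s]
    have h5 : character (-dualVec L n) (L t) = character (-((2 * Real.pi) • intVec n)) t := by
      have h6 := character_dualVec L n t
      have h7 := character_neg_mul (dualVec L n) (L t)
      have h8 := character_neg_mul ((2 * Real.pi) • intVec n) t
      rw [h6] at h7
      have h9 : character ((2 * Real.pi) • intVec n) t ≠ 0 := right_ne_zero_of_mul_eq_one h8
      exact mul_right_cancel₀ h9 (h7.trans h8.symm)
    rw [h4, h5, mul_left_comm, mul_comm (character (dualVec L n) s), character_neg_mul, mul_one]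
  rw [hf]
  dsimp only
  rw [← mul_assoc, h3, smul_eq_mul, pullS_apply, character, inner_neg_left, inner_smul_left,
    real_inner_comm]
  congr 2
  simp
  ring

theorem fcoef_eq_fourierS (L : E d ≃L[ℝ] E d) (w : 𝓢(E d, ℂ)) (n : Fin d → ℤ) :
    fcoef L w n = ((|(L : E d →L[ℝ] E d).det|⁻¹ : ℝ) : ℂ) *
      ((((2 * Real.pi) ^ (-(d : ℝ) / 2) : ℝ) : ℂ)⁻¹ * fourierS d w (dualVec L n)) := by
  have : (((2 * Real.pi) ^ (-(d : ℝ) / 2) : ℝ) : ℂ) ≠ 0 := by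
    rw [Complex.ofReal_ne_zero]; positivity
  rw [fcoef, fourierS_eq, inv_mul_cancel_left₀ this]

/-- Fourier series of a function supported in the parallelepiped `L [-1/2, 1/2]^d + s`. -/
theorem hasSum_fcoef {L : E d ≃L[ℝ] E d} {s : E d} {w : 𝓢(E d, ℂ)}
    (hw : ∀ t : E d, (∃ i, 1 / 2 < |t i|) → w (L t + s) = 0) (t : E d) :
    HasSum (fun n => fcoef L w n * character (dualVec L n) (L t + s))
      (w (L (fracVec t) + s)) := by
  have h := hasSum_fourier_fracVec (u := pullS L s w)
    (fun t ht => by rw [pullS_apply]; exact hw t ht) t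
  rw [pullS_apply] at h
  convert h using 2 with n
  rw [fourier_pullS, mul_assoc]
  congr 1
  rw [character_comm, character_add, character_comm, character_dualVec, character_comm s, mul_comm]

theorem exists_norm_intVec_le (L : E d ≃L[ℝ] E d) :
    ∃ C : ℝ, 1 ≤ C ∧ ∀ n, 1 + ‖(intVec n : E d)‖ ≤ C * (1 + ‖dualVec L n‖) ∧
      1 + ‖dualVec L n‖ ≤ C * (1 + ‖(intVec n : E d)‖) := by
  set B : E d →L[ℝ] E d := ContinuousLinearMap.adjoint (L.symm : E d →L[ℝ] E d)
  set B' : E d →L[ℝ] E d := ContinuousLinearMap.adjoint (L : E d →L[ℝ] E d)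
  have hB : ∀ x, B' (B x) = x := by
    intro x
    have : B' ∘L B = ContinuousLinearMap.adjoint ((L.symm : E d →L[ℝ] E d) ∘L L) := by
      rw [ContinuousLinearMap.adjoint_comp]
    have h2 : ((L.symm : E d →L[ℝ] E d) ∘L L) = ContinuousLinearMap.id ℝ _ := by
      ext1 y; simp
    rw [← ContinuousLinearMap.comp_apply, this, h2]
    simp [ContinuousLinearMap.adjoint_id]
  have hpi : (0 : ℝ) < 2 * Real.pi := by positivity
  have h1 : ∀ n, ‖dualVec L n‖ = 2 * Real.pi * ‖B (intVec n)‖ := fun n => by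
    rw [dualVec, norm_smul, Real.norm_of_nonneg hpi.le]
  refine ⟨1 + ‖B'‖ + 2 * Real.pi * ‖B‖, by
    have := norm_nonneg B'
    have : 0 ≤ 2 * Real.pi * ‖B‖ := by positivity
    linarith, fun n => ⟨?_, ?_⟩⟩
  · have h2 : ‖(intVec n : E d)‖ ≤ ‖B'‖ * ‖B (intVec n)‖ := by
      conv_lhs => rw [← hB (intVec n)]
      exact B'.le_opNorm _
    have h3 : ‖B (intVec n)‖ ≤ ‖dualVec L n‖ := by
      rw [h1]
      have : (1 : ℝ) ≤ 2 * Real.pi := by have := Real.pi_gt_three; linarith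
      nlinarith [norm_nonneg (B (intVec n))]
    have h4 := mul_le_mul_of_nonneg_left h3 (norm_nonneg B')
    have h5 : 0 ≤ 2 * Real.pi * ‖B‖ := by positivity
    nlinarith [norm_nonneg (dualVec L n), norm_nonneg B', norm_nonneg B]
  · have h2 := B.le_opNorm (intVec n)
    rw [h1]
    have h3 := mul_le_mul_of_nonneg_left h2 hpi.le
    nlinarith [norm_nonneg (intVec n : E d), norm_nonneg B', mul_nonneg (norm_nonneg B')
      (norm_nonneg (intVec n : E d)), norm_nonneg B]

/-- Fourier coefficients decay rapidly. -/
theorem exists_fcoef_bound (L : E d ≃L[ℝ] E d) (k : ℕ) :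
    ∃ (m : ℕ) (C : ℝ), 0 ≤ C ∧ ∀ w n,
      ‖fcoef L w n‖ ≤ C * sNorm m w * ((1 + ‖(intVec n : E d)‖) ^ k)⁻¹ := by
  obtain ⟨m, C, hC, h⟩ := ContinuousLinearMap.exists_sNorm_bound (fourierS d) k
  obtain ⟨K, hK, hd⟩ := exists_norm_intVec_le L
  set c : ℂ := ((|(L : E d →L[ℝ] E d).det|⁻¹ : ℝ) : ℂ) *
    (((2 * Real.pi) ^ (-(d : ℝ) / 2) : ℝ) : ℂ)⁻¹ with hc
  refine ⟨m, ‖c‖ * (2 ^ k * C * K ^ k), by positivity, fun w n => ?_⟩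
  rw [fcoef_eq_fourierS, ← mul_assoc, ← hc, norm_mul, mul_assoc ‖c‖, mul_assoc ‖c‖]
  refine mul_le_mul_of_nonneg_left ?_ (norm_nonneg _)
  refine (norm_le_sNorm k _ _).trans ?_
  have h1 : ((1 + ‖dualVec L n‖) ^ k)⁻¹ ≤ K ^ k * ((1 + ‖(intVec n : E d)‖) ^ k)⁻¹ := by
    rw [← div_eq_mul_inv, le_div_iff₀ (by positivity), inv_mul_le_iff₀ (by positivity), ← mul_pow,
      mul_comm _ K]
    exact pow_le_pow_left₀ (by positivity) (hd n).1 k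
  have h2 := h w
  have h3 := sNorm_nonneg m w
  calc 2 ^ k * sNorm k (fourierS d w) * ((1 + ‖dualVec L n‖) ^ k)⁻¹
      ≤ 2 ^ k * (C * sNorm m w) * (K ^ k * ((1 + ‖(intVec n : E d)‖) ^ k)⁻¹) := by
        gcongr
    _ = _ := by ring

/-- Expansion of `χ w` in the lattice characters, tested against a tempered distribution. Here `w`
is supported in `L [-1/2, 1/2]^d + s`, and `v` is the product of `χ` with its periodization. -/
theorem hasSum_fcoef_apply {L : E d ≃L[ℝ] E d} {s : E d} {w χ v : 𝓢(E d, ℂ)}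
    (hw : ∀ t : E d, (∃ i, 1 / 2 < |t i|) → w (L t + s) = 0)
    (hv : ∀ t : E d, χ (L t + s) * w (L (fracVec t) + s) = v (L t + s)) (Λ : 𝓢'(E d, ℂ)) :
    HasSum (fun n => fcoef L w n * Λ (modS (dualVec L n) χ)) (Λ v) := by
  obtain ⟨m, C, hC, hΛ⟩ := TemperedDistribution.exists_sNorm_bound Λ
  obtain ⟨m', C', hC', hb⟩ := exists_fcoef_bound L (m + 2 * d)
  obtain ⟨K, hK, hd⟩ := exists_norm_intVec_le L
  have h := hasSum_apply_of_summable_sNorm Λ hΛ (ι := Fin d → ℤ)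
    (w := fun n => fcoef L w n • modS (dualVec L n) χ) (w₀ := v) ?_ ?_
  · simpa using h
  · refine Summable.of_nonneg_of_le (fun _ => sNorm_nonneg _ _) (fun n => ?_)
      (summable_one_add_norm_intVec.mul_left
        (C' * sNorm m' w * (2 ^ m * K ^ m * sNorm m χ)))
    have h1 : sNorm m (fcoef L w n • modS (dualVec L n) χ) =
        ‖fcoef L w n‖ * sNorm m (modS (dualVec L n) χ) := map_smul_eq_mul _ _ _
    have h2 : sNorm m (modS (dualVec L n) χ) ≤
        2 ^ m * (K * (1 + ‖(intVec n : E d)‖)) ^ m * sNorm m χ := by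
      refine (sNorm_modS_le m _ χ).trans ?_
      have := sNorm_nonneg m χ
      gcongr
      exact (hd n).2
    have h3 := sNorm_nonneg m χ
    have h4 := sNorm_nonneg m' w
    rw [h1]
    calc _ ≤ (C' * sNorm m' w * ((1 + ‖(intVec n : E d)‖) ^ (m + 2 * d))⁻¹) *
          (2 ^ m * (K * (1 + ‖(intVec n : E d)‖)) ^ m * sNorm m χ) := by
          gcongr
          · exact sNorm_nonneg _ _
          · exact hb w n
      _ = _ := by
          have : (0 : ℝ) < 1 + ‖(intVec n : E d)‖ := by positivity
          rw [pow_add, mul_pow K]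
          field_simp
  · intro x
    have h1 : L (L.symm (x - s)) + s = x := by simp
    have h2 := (hasSum_fcoef hw (L.symm (x - s))).mul_left (χ x)
    rw [h1] at h2
    have h3 := hv (L.symm (x - s))
    rw [h1] at h3
    rw [h3] at h2
    refine h2.congr_fun fun n => ?_
    change fcoef L w n * modS (dualVec L n) χ x = _
    rw [modS_apply]
    ring

end Affine

/-! ### Temperate growth of `x ↦ Λ (e^{i x·ξ} w)` -/

section TemperateGrowth

variable {d : ℕ}

theorem sNorm_mul_le {m p : ℕ} {g : E d → ℂ} (hg : ContDiff ℝ ∞ g) {B : ℝ} (hB : 0 ≤ B)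
    (hgB : ∀ i ≤ m, ∀ ξ, ‖iteratedFDeriv ℝ i g ξ‖ ≤ B * (1 + ‖ξ‖) ^ p) {u w : 𝓢(E d, ℂ)}
    (hu : ∀ ξ, u ξ = g ξ * w ξ) :
    sNorm m u ≤ 2 ^ m * (B * (2 ^ (m + p) * sNorm (m + p) w)) := by
  have hn := sNorm_nonneg (m + p) w
  refine sNorm_le (by positivity) fun k hk l hl x => ?_
  have h1 : (⇑u : E d → ℂ) = fun ξ => g ξ * w ξ := funext hu
  rw [h1]
  have h2 := norm_iteratedFDeriv_mul_le (𝕜 := ℝ) (A := ℂ) (n := l) (N := ∞)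
    (f := g) (g := w) hg (w.smooth ⊤) x (by exact_mod_cast le_top)
  have hx : 0 ≤ ‖x‖ := norm_nonneg x
  calc ‖x‖ ^ k * _ ≤ ‖x‖ ^ k * _ := mul_le_mul_of_nonneg_left h2 (by positivity)
    _ = ∑ i ∈ Finset.range (l + 1), (l.choose i : ℝ) * (‖x‖ ^ k * ‖iteratedFDeriv ℝ i g x‖ *
        ‖iteratedFDeriv ℝ (l - i) w x‖) := by
      rw [Finset.mul_sum]; exact Finset.sum_congr rfl fun _ _ => by ring
    _ ≤ ∑ i ∈ Finset.range (l + 1), (l.choose i : ℝ) * (B * (2 ^ (m + p) * sNorm (m + p) w)) := by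
      refine Finset.sum_le_sum fun i hi => ?_
      have hi' : i ≤ m := by have := Finset.mem_range.1 hi; omega
      have h4 := one_add_pow_le_sNorm (Nat.add_le_add_right hk p)
        (((Nat.sub_le l i).trans hl).trans (Nat.le_add_right m p)) w x
      refine mul_le_mul_of_nonneg_left ?_ (Nat.cast_nonneg _)
      calc ‖x‖ ^ k * ‖iteratedFDeriv ℝ i g x‖ * ‖iteratedFDeriv ℝ (l - i) w x‖
          ≤ (1 + ‖x‖) ^ k * (B * (1 + ‖x‖) ^ p) * ‖iteratedFDeriv ℝ (l - i) w x‖ := by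
            gcongr
            · linarith
            · exact hgB i hi' x
        _ = B * ((1 + ‖x‖) ^ (k + p) * ‖iteratedFDeriv ℝ (l - i) w x‖) := by ring
        _ ≤ _ := mul_le_mul_of_nonneg_left h4 hB
    _ = 2 ^ l * (B * (2 ^ (m + p) * sNorm (m + p) w)) := by
      rw [← Finset.sum_mul]
      congr 1
      exact_mod_cast Nat.sum_range_choose l
    _ ≤ _ := by
      gcongr
      norm_num

theorem hasDerivAt_expI (t : ℝ) :
    HasDerivAt (fun t : ℝ => Complex.exp (Complex.I * (t : ℂ)))
      (Complex.I * Complex.exp (Complex.I * (t : ℂ))) t := by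
  have h1 : HasDerivAt (fun t : ℝ => Complex.I * (t : ℂ)) (Complex.I * 1) t :=
    (Complex.ofRealCLM.hasDerivAt (x := t)).const_mul Complex.I
  convert h1.cexp using 1
  ring

/-- The first order Taylor remainder of `e^{it}`. -/
noncomputable def expRem (t : ℝ) : ℂ := Complex.exp (Complex.I * (t : ℂ)) - 1 - Complex.I * t

theorem hasDerivAt_expRem (t : ℝ) :
    HasDerivAt expRem (Complex.I * (Complex.exp (Complex.I * (t : ℂ)) - 1)) t := by
  have h1 : HasDerivAt (fun t : ℝ => Complex.I * (t : ℂ)) (Complex.I * 1) t :=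
    (Complex.ofRealCLM.hasDerivAt (x := t)).const_mul Complex.I
  exact (((hasDerivAt_expI t).sub_const 1).sub h1).congr_deriv (by ring)

theorem contDiff_expRem : ContDiff ℝ ∞ expRem := by
  refine ((hasTemperateGrowth_exp.1).sub contDiff_const).sub ?_
  exact contDiff_const.mul Complex.ofRealCLM.contDiff

theorem norm_expRem_le (t : ℝ) : ‖expRem t‖ ≤ |t| ^ 2 := by
  have h := (convex_uIcc (0 : ℝ) t).norm_image_sub_le_of_norm_hasDerivWithin_le (𝕜 := ℝ)
    (f := expRem) (C := |t|) (fun s _ => (hasDerivAt_expRem s).hasDerivWithinAt)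
    (fun s hs => ?_) Set.left_mem_uIcc Set.right_mem_uIcc
  · have h0 : expRem 0 = 0 := by simp [expRem]
    rw [h0, sub_zero, sub_zero, Real.norm_eq_abs] at h
    rw [sq]; exact h
  · rw [norm_mul, Complex.norm_I, one_mul]
    refine (Real.norm_exp_I_mul_ofReal_sub_one_le).trans ?_
    rw [Real.norm_eq_abs]
    have := Set.abs_sub_left_of_mem_uIcc hs
    simpa using this

theorem norm_iteratedFDeriv_expRem_le (l : ℕ) (t : ℝ) :
    ‖iteratedFDeriv ℝ l expRem t‖ ≤ |t| ^ (2 - l) := by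
  rw [norm_iteratedFDeriv_eq_norm_iteratedDeriv]
  have h1 : deriv expRem = fun t : ℝ => Complex.I * (Complex.exp (Complex.I * (t : ℂ)) - 1) :=
    funext fun t => (hasDerivAt_expRem t).deriv
  have h2 : deriv (fun t : ℝ => Complex.I * (Complex.exp (Complex.I * (t : ℂ)) - 1)) =
      fun t : ℝ => Complex.I * (Complex.I * Complex.exp (Complex.I * (t : ℂ))) :=
    funext fun t => (((hasDerivAt_expI t).sub_const 1).const_mul Complex.I).deriv
  match l with
  | 0 => rw [iteratedDeriv_zero]; exact norm_expRem_le t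
  | 1 =>
    rw [iteratedDeriv_one, h1, norm_mul, Complex.norm_I, one_mul]
    simpa using Real.norm_exp_I_mul_ofReal_sub_one_le (x := t)
  | l + 2 =>
    rw [iteratedDeriv_succ', iteratedDeriv_succ', h1, h2]
    have h3 : (fun t : ℝ => Complex.I * (Complex.I * Complex.exp (Complex.I * (t : ℂ)))) =
        fun t : ℝ => (-1 : ℂ) * Complex.exp (Complex.I * (t : ℂ)) := by
      ext t; rw [← mul_assoc, Complex.I_mul_I]
    rw [h3, iteratedDeriv_const_mul_field, norm_mul, ← norm_iteratedFDeriv_eq_norm_iteratedDeriv,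
      norm_iteratedFDeriv_expI]
    simp

theorem norm_iteratedFDeriv_character_rem_le {v : E d} (hv : ‖v‖ ≤ 1) (l : ℕ) (ξ : E d) :
    ‖iteratedFDeriv ℝ l (fun ξ => expRem (inner ℝ v ξ)) ξ‖ ≤ ‖v‖ ^ 2 * (1 + ‖ξ‖) ^ 2 := by
  have h : (fun ξ => expRem (inner ℝ v ξ)) = expRem ∘ (innerSL ℝ v) := rfl
  rw [h, ContinuousLinearMap.iteratedFDeriv_comp_right (innerSL ℝ v)
    (n := ∞) contDiff_expRem ξ (by exact_mod_cast le_top)]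
  refine (ContinuousMultilinearMap.norm_compContinuousLinearMap_le _ _).trans ?_
  rw [Finset.prod_const, Finset.card_univ, Fintype.card_fin, innerSL_apply_norm]
  have h1 : |innerSL ℝ v ξ| ≤ ‖v‖ * ‖ξ‖ := abs_real_inner_le_norm v ξ
  have h2 := norm_iteratedFDeriv_expRem_le l (innerSL ℝ v ξ)
  have h0 := norm_nonneg v
  have h0' := norm_nonneg ξ
  calc _ ≤ (‖v‖ * ‖ξ‖) ^ (2 - l) * ‖v‖ ^ l := by
        refine mul_le_mul_of_nonneg_right (h2.trans ?_) (by positivity)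
        exact pow_le_pow_left₀ (abs_nonneg _) h1 _
    _ = ‖v‖ ^ (2 - l + l) * ‖ξ‖ ^ (2 - l) := by rw [mul_pow, pow_add]; ring
    _ ≤ ‖v‖ ^ 2 * (1 + ‖ξ‖) ^ 2 := by
        refine mul_le_mul (pow_le_pow_of_le_one h0 hv (by omega)) ?_ (by positivity) (by positivity)
        exact (pow_le_pow_left₀ h0' (by linarith) _).trans
          (pow_le_pow_right₀ (by linarith) (by omega))

theorem coord_hasTemperateGrowth (i : Fin d) :
    (fun ξ : E d => Complex.I * ((ξ i : ℝ) : ℂ)).HasTemperateGrowth :=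
  (Function.HasTemperateGrowth.const Complex.I).mul
    (Complex.ofRealCLM ∘L (EuclideanSpace.proj i : E d →L[ℝ] ℝ)).hasTemperateGrowth

/-- Multiplication of Schwartz functions by `i ξ_k`. -/
noncomputable def coordS (k : Fin d) : 𝓢(E d, ℂ) →L[ℂ] 𝓢(E d, ℂ) :=
  smulLeftCLM ℂ fun ξ : E d => Complex.I * ((ξ k : ℝ) : ℂ)

theorem coordS_apply (k : Fin d) (w : 𝓢(E d, ℂ)) (ξ : E d) :
    coordS k w ξ = Complex.I * ((ξ k : ℝ) : ℂ) * w ξ :=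
  smulLeftCLM_apply_apply (coord_hasTemperateGrowth k) w ξ

theorem exists_norm_apply_modS_le (Λ : 𝓢'(E d, ℂ)) :
    ∃ (m : ℕ) (C : ℝ), 0 ≤ C ∧ ∀ x w, ‖Λ (modS x w)‖ ≤ C * (1 + ‖x‖) ^ m * sNorm m w := by
  obtain ⟨m, C, hC, h⟩ := TemperedDistribution.exists_sNorm_bound Λ
  refine ⟨m, C * 2 ^ m, by positivity, fun x w => (h _).trans ?_⟩
  calc C * sNorm m (modS x w) ≤ C * (2 ^ m * (1 + ‖x‖) ^ m * sNorm m w) :=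
        mul_le_mul_of_nonneg_left (sNorm_modS_le m x w) hC
    _ = _ := by ring

theorem hasFDerivAt_apply_modS (Λ : 𝓢'(E d, ℂ)) (w : 𝓢(E d, ℂ)) (x : E d) :
    HasFDerivAt (fun x => Λ (modS x w))
      (∑ k, ContinuousLinearMap.smulRightL ℝ (E d) ℂ (EuclideanSpace.proj k)
        (Λ (modS x (coordS k w)))) x := by
  obtain ⟨m, C, hC, h⟩ := exists_norm_apply_modS_le Λ
  have key : ∀ v : E d, ‖v‖ ≤ 1 → ‖Λ (modS (x + v) w) - Λ (modS x w) -
      (∑ k, ContinuousLinearMap.smulRightL ℝ (E d) ℂ (EuclideanSpace.proj k)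
        (Λ (modS x (coordS k w)))) v‖ ≤
      (C * (1 + ‖x‖) ^ m * (2 ^ m * (2 ^ (m + 2) * sNorm (m + 2) w))) * ‖v‖ ^ 2 := by
    intro v hv
    set r : 𝓢(E d, ℂ) := modS v w - w - ∑ k, ((v k : ℝ) : ℂ) • coordS k w with hr
    have h1 : Λ (modS (x + v) w) - Λ (modS x w) -
      (∑ k, ContinuousLinearMap.smulRightL ℝ (E d) ℂ (EuclideanSpace.proj k)
        (Λ (modS x (coordS k w)))) v = Λ (modS x r) := by
      rw [hr, map_sub, map_sub, map_sub, map_sub, modS_modS, map_sum, map_sum]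
      congr 1
      simp only [map_smul, _root_.sum_apply]
      refine Finset.sum_congr rfl fun k _ => ?_
      change (v k : ℝ) • Λ (modS x (coordS k w)) = _
      rw [Complex.real_smul, smul_eq_mul]
    have h2 : sNorm m r ≤ 2 ^ m * (‖v‖ ^ 2 * (2 ^ (m + 2) * sNorm (m + 2) w)) := by
      refine sNorm_mul_le (g := fun ξ => expRem (inner ℝ v ξ)) ?_ (by positivity)
        (fun i _ ξ => norm_iteratedFDeriv_character_rem_le hv i ξ) fun ξ => ?_
      · exact contDiff_expRem.comp (innerSL ℝ v).contDiff
      · have h3 : r ξ = modS v w ξ - w ξ - ∑ k, ((v k : ℝ) : ℂ) * coordS k w ξ := by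
          simp [hr]
        rw [h3, modS_apply, expRem, character, PiLp.inner_apply]
        simp only [coordS_apply, RCLike.inner_apply, conj_trivial]
        push_cast
        rw [sub_mul, sub_mul, one_mul, Finset.mul_sum, Finset.sum_mul]
        congr 1
        exact Finset.sum_congr rfl fun k _ => by ring
    rw [h1]
    refine (h x r).trans ?_
    calc _ ≤ C * (1 + ‖x‖) ^ m * (2 ^ m * (‖v‖ ^ 2 * (2 ^ (m + 2) * sNorm (m + 2) w))) := by
          gcongr
      _ = _ := by ring
  rw [hasFDerivAt_iff_isLittleO_nhds_zero]
  refine Asymptotics.IsBigO.trans_isLittleO (g := fun v : E d => ‖v‖ ^ 2) ?_ ?_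
  · refine Asymptotics.IsBigO.of_bound
      (C * (1 + ‖x‖) ^ m * (2 ^ m * (2 ^ (m + 2) * sNorm (m + 2) w))) ?_
    filter_upwards [Metric.closedBall_mem_nhds (0 : E d) one_pos] with v hv
    rw [Real.norm_of_nonneg (by positivity)]
    exact key v (by simpa using hv)
  · exact Asymptotics.isLittleO_norm_pow_id one_lt_two

theorem hasTemperateGrowth_apply_modS (Λ : 𝓢'(E d, ℂ)) (w : 𝓢(E d, ℂ)) :
    (fun x => Λ (modS x w)).HasTemperateGrowth := by
  have hfd : ∀ w : 𝓢(E d, ℂ), fderiv ℝ (fun x => Λ (modS x w)) = fun x =>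
      ∑ k, ContinuousLinearMap.smulRightL ℝ (E d) ℂ (EuclideanSpace.proj k)
        (Λ (modS x (coordS k w))) := fun w =>
    funext fun x => (hasFDerivAt_apply_modS Λ w x).fderiv
  have main : ∀ (n : ℕ) (w : 𝓢(E d, ℂ)), ContDiff ℝ n (fun x => Λ (modS x w)) ∧
      ∃ (k : ℕ) (C : ℝ), ∀ x, ‖iteratedFDeriv ℝ n (fun x => Λ (modS x w)) x‖ ≤
        C * (1 + ‖x‖) ^ k := by
    intro n
    induction n with
    | zero =>
      intro w
      refine ⟨contDiff_zero.2 (continuous_iff_continuousAt.2 fun x =>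
        (hasFDerivAt_apply_modS Λ w x).continuousAt), ?_⟩
      obtain ⟨m, C, hC, h⟩ := exists_norm_apply_modS_le Λ
      refine ⟨m, C * sNorm m w, fun x => ?_⟩
      rw [norm_iteratedFDeriv_zero]
      exact (h x w).trans_eq (by ring)
    | succ n ih =>
      intro w
      have hcd : ∀ k, ContDiff ℝ n fun x =>
          ContinuousLinearMap.smulRightL ℝ (E d) ℂ (EuclideanSpace.proj k)
            (Λ (modS x (coordS k w))) := fun k =>
        (ContinuousLinearMap.contDiff _).comp (ih (coordS k w)).1
      constructor
      · push_cast
        rw [contDiff_succ_iff_fderiv]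
        refine ⟨fun x => (hasFDerivAt_apply_modS Λ w x).differentiableAt, by simp, ?_⟩
        rw [hfd]
        exact ContDiff.sum fun k _ => hcd k
      · choose K C hKC using fun k => (ih (coordS k w)).2
        refine ⟨∑ k, K k, ∑ k, ‖ContinuousLinearMap.smulRightL ℝ (E d) ℂ
          (EuclideanSpace.proj k)‖ * |C k|, fun x => ?_⟩
        rw [← norm_iteratedFDeriv_fderiv, hfd,
          iteratedFDeriv_sum fun k _ => (hcd k), Finset.sum_apply, Finset.sum_mul]
        refine (norm_sum_le _ _).trans (Finset.sum_le_sum fun k _ => ?_)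
        refine (ContinuousLinearMap.norm_iteratedFDeriv_comp_left
          (ContinuousLinearMap.smulRightL ℝ (E d) ℂ (EuclideanSpace.proj k))
          ((ih (coordS k w)).1.contDiffAt) le_rfl).trans ?_
        rw [mul_assoc]
        refine mul_le_mul_of_nonneg_left ((hKC k x).trans ?_) (norm_nonneg _)
        have h1 : (1 : ℝ) ≤ 1 + ‖x‖ := by linarith [norm_nonneg x]
        refine mul_le_mul (le_abs_self _) (pow_le_pow_right₀ h1 ?_) (by positivity) (abs_nonneg _)
        exact Finset.single_le_sum (f := K) (fun _ _ => Nat.zero_le _) (Finset.mem_univ k)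
  exact ⟨contDiff_infty.2 fun n => (main n w).1, fun n => (main n w).2⟩

end TemperateGrowth

/-! ### Supports of tempered distributions -/

section Support

variable {d : ℕ}

open scoped Manifold in
theorem apply_eq_zero_of_compact_of_disjoint_dsupport {Λ : 𝓢'(E d, ℂ)} {u : 𝓢(E d, ℂ)}
    (hc : HasCompactSupport u) (hd : Disjoint (tsupport u) (Distribution.dsupport Λ)) :
    Λ u = 0 := by
  have h1 : ∀ x : tsupport u, ∃ s : Set (E d), Distribution.IsVanishingOn Λ s ∧ IsOpen s ∧
      (x : E d) ∈ s := fun x =>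
    (Distribution.notMem_dsupport_iff _).1 (Set.disjoint_left.1 hd x.2)
  choose U hU hUo hxU using h1
  obtain ⟨t, ht⟩ := hc.isCompact.elim_finite_subcover U hUo
    fun x hx => Set.mem_iUnion.2 ⟨⟨x, hx⟩, hxU _⟩
  obtain ⟨f, hf⟩ := SmoothPartitionOfUnity.exists_isSubordinate 𝓘(ℝ, E d) (isClosed_tsupport u)
    (fun i : t => U i) (fun i => hUo i) (fun x hx => by
      obtain ⟨i, hi, hxi⟩ := Set.mem_iUnion₂.1 (ht hx)
      exact Set.mem_iUnion.2 ⟨⟨i, hi⟩, hxi⟩)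
  have hcp : ∀ i : t, HasCompactSupport fun x => ((f i x : ℝ) : ℂ) * u x := fun i => hc.mul_left
  have hsm : ∀ i : t, ContDiff ℝ ∞ fun x => ((f i x : ℝ) : ℂ) * u x := fun i =>
    (Complex.ofRealCLM.contDiff.comp (f i).contMDiff.contDiff).mul (u.smooth ⊤)
  set p : t → 𝓢(E d, ℂ) := fun i => (hcp i).toSchwartzMap (hsm i)
  have hp : ∀ i, Λ (p i) = 0 := by
    intro i
    refine hU i (p i) (subset_trans ?_ (hf i))
    have h2 : (⇑(p i) : E d → ℂ) = fun x => ((f i x : ℝ) : ℂ) * u x := rfl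
    rw [h2]
    refine (tsupport_mul_subset_left).trans ?_
    exact closure_mono fun x hx => by
      intro h0; exact hx (by simp [h0])
  have hu : u = ∑ i, p i := by
    ext x
    have h2 : (∑ i, p i) x = ∑ i, ((f i x : ℝ) : ℂ) * u x := by
      rw [_root_.sum_apply]; rfl
    rw [h2, ← Finset.sum_mul]
    by_cases hx : x ∈ tsupport u
    · have h3 := f.sum_eq_one hx
      rw [finsum_eq_sum_of_fintype] at h3
      rw [← Complex.ofReal_sum, h3, Complex.ofReal_one, one_mul]
    · rw [image_eq_zero_of_notMem_tsupport hx, mul_zero]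
  rw [hu, map_sum, Finset.sum_eq_zero fun i _ => hp i]

open scoped Manifold in
/-- Smooth cut-off functions. -/
theorem exists_schwartz_cutoff {K U : Set (E d)} (hK : IsClosed K) (hU : IsOpen U) (hKU : K ⊆ U)
    (hb : Bornology.IsBounded U) :
    ∃ χ : 𝓢(E d, ℂ), (∀ᶠ x in 𝓝ˢ K, χ x = 1) ∧ (∀ x ∉ U, χ x = 0) ∧ HasCompactSupport χ := by
  obtain ⟨f, h1, h0, -⟩ := exists_contMDiffMap_one_nhds_of_subset_interior (n := ⊤) 𝓘(ℝ, E d) hK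
    (hKU.trans hU.interior_eq.symm.subset)
  have hc : HasCompactSupport fun x => ((f x : ℝ) : ℂ) := by
    refine HasCompactSupport.of_support_subset_isCompact
      (Metric.isCompact_of_isClosed_isBounded isClosed_closure hb.closure) fun x hx => ?_
    refine subset_closure ?_
    by_contra hxU
    exact hx (by simp [h0 x hxU])
  refine ⟨hc.toSchwartzMap (Complex.ofRealCLM.contDiff.comp f.contMDiff.contDiff), ?_, ?_, hc⟩
  · filter_upwards [h1] with x hx
    change ((f x : ℝ) : ℂ) = 1
    rw [hx, Complex.ofReal_one]
  · intro x hx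
    change ((f x : ℝ) : ℂ) = 0
    rw [h0 x hx, Complex.ofReal_zero]

/-- A tempered distribution vanishes on every Schwartz function whose support is disjoint from its
own, even if neither support is compact. -/
theorem apply_eq_zero_of_disjoint_dsupport {Λ : 𝓢'(E d, ℂ)} {u : 𝓢(E d, ℂ)}
    (hd : Disjoint (tsupport u) (Distribution.dsupport Λ)) : Λ u = 0 := by
  obtain ⟨χ, h1, -, hc⟩ := exists_schwartz_cutoff (d := d) (K := Metric.closedBall 0 1)
    (U := Metric.ball 0 2) Metric.isClosed_closedBall Metric.isOpen_ball
    (Metric.closedBall_subset_ball (by norm_num)) Metric.isBounded_ball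
  obtain ⟨m, C, hC, hΛ⟩ := TemperedDistribution.exists_sNorm_bound Λ
  -- the tails `(1 - χ(x / R)) u` are of size `O(1 / R)`
  set D : ℝ → E d →L[ℝ] E d := fun R => R⁻¹ • ContinuousLinearMap.id ℝ (E d)
  set g : E d → ℂ := fun x => 1 - χ x with hg
  have hgs : ContDiff ℝ ∞ g := contDiff_const.sub (χ.smooth ⊤)
  set B : ℝ := 1 + sNorm m χ
  have hB : 0 ≤ B := by have := sNorm_nonneg m χ; positivity
  have hgB : ∀ i ≤ m, ∀ x, ‖iteratedFDeriv ℝ i g x‖ ≤ B := by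
    intro i hi x
    have h2 : ‖iteratedFDeriv ℝ i χ x‖ ≤ sNorm m χ := by
      simpa using le_sNorm (Nat.zero_le m) hi χ x
    have h3 : g = (fun _ => (1 : ℂ)) - ⇑χ := rfl
    rw [h3, iteratedFDeriv_sub_apply contDiff_const.contDiffAt (χ.smooth i).contDiffAt]
    refine (norm_sub_le _ _).trans (add_le_add ?_ h2)
    rcases Nat.eq_zero_or_pos i with rfl | hi0
    · rw [norm_iteratedFDeriv_zero]; simp
    · rw [iteratedFDeriv_const_of_ne (by omega)]; simp
  have hgR : ∀ R : ℝ, 1 ≤ R → ∀ i ≤ m, ∀ x, ‖iteratedFDeriv ℝ i (g ∘ D R) x‖ ≤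
      (B / R) * (1 + ‖x‖) ^ 1 := by
    intro R hR i hi x
    have hR0 : 0 < R := by linarith
    have hx0 := norm_nonneg x
    have h2 : ‖iteratedFDeriv ℝ i (g ∘ D R) x‖ ≤ ‖iteratedFDeriv ℝ i g (D R x)‖ := by
      rw [ContinuousLinearMap.iteratedFDeriv_comp_right (D R) (n := ∞) hgs x
        (by exact_mod_cast le_top)]
      refine (ContinuousMultilinearMap.norm_compContinuousLinearMap_le _ _).trans ?_
      rw [Finset.prod_const, Finset.card_univ, Fintype.card_fin]
      refine mul_le_of_le_one_right (norm_nonneg _) (pow_le_one₀ (norm_nonneg _) ?_)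
      refine (norm_smul_le _ _).trans ?_
      rw [Real.norm_of_nonneg (by positivity)]
      exact mul_le_one₀ (inv_le_one_of_one_le₀ hR) (norm_nonneg _)
        ContinuousLinearMap.norm_id_le
    rcases le_total ‖x‖ R with hxR | hxR
    · have h3 : g =ᶠ[𝓝 (D R x)] fun _ => 0 := by
        have hmem : D R x ∈ Metric.closedBall (0 : E d) 1 := by
          rw [mem_closedBall_zero_iff]
          change ‖R⁻¹ • x‖ ≤ 1
          rw [norm_smul, Real.norm_of_nonneg (by positivity), inv_mul_le_iff₀ hR0]
          linarith
        filter_upwards [eventually_nhdsSet_iff_forall.1 h1 _ hmem] with y hy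
        rw [hg]; simp [hy]
      have h4 : iteratedFDeriv ℝ i g (D R x) = 0 := by
        rw [(h3.iteratedFDeriv ℝ i).eq_of_nhds]
        have : iteratedFDeriv ℝ i (fun _ : E d => (0 : ℂ)) = 0 := iteratedFDeriv_fun_zero
        rw [this]; rfl
      rw [h4, norm_zero] at h2
      exact h2.trans (by positivity)
    · refine (h2.trans (hgB i hi _)).trans ?_
      rw [pow_one, div_mul_eq_mul_div, le_div_iff₀ hR0]
      gcongr
      linarith
  have hvR : ∀ R : ℝ, 1 ≤ R → ∃ v : 𝓢(E d, ℂ), Λ v = 0 ∧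
      sNorm m (u - v) ≤ (2 ^ m * (B * (2 ^ (m + 1) * sNorm (m + 1) u))) / R := by
    intro R hR
    have hR0 : 0 < R := by linarith
    have hcR : HasCompactSupport fun x => χ (D R x) := by
      have := hc.comp_homeomorph (Homeomorph.smulOfNeZero (R⁻¹) (by positivity))
      exact this
    have hcu : HasCompactSupport fun x => χ (D R x) * u x := hcR.mul_right
    have hsu : ContDiff ℝ ∞ fun x => χ (D R x) * u x :=
      ((χ.smooth ⊤).comp (D R).contDiff).mul (u.smooth ⊤)
    refine ⟨hcu.toSchwartzMap hsu, ?_, ?_⟩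
    · refine apply_eq_zero_of_compact_of_disjoint_dsupport hcu (hd.mono_left ?_)
      exact tsupport_mul_subset_right
    · have := sNorm_mul_le (m := m) (p := 1) (g := g ∘ D R) (hgs.comp (D R).contDiff)
        (B := B / R) (by positivity) (hgR R hR) (u := u - hcu.toSchwartzMap hsu) (w := u)
        (fun ξ => by
          change u ξ - χ (D R ξ) * u ξ = (1 - χ (D R ξ)) * u ξ
          ring)
      refine this.trans_eq ?_
      ring
  have hlim : Tendsto (fun R : ℝ => C * ((2 ^ m * (B * (2 ^ (m + 1) * sNorm (m + 1) u))) / R))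
      atTop (𝓝 0) := by
    simpa using (tendsto_id.const_div_atTop
      (2 ^ m * (B * (2 ^ (m + 1) * sNorm (m + 1) u)))).const_mul C
  have hle : ‖Λ u‖ ≤ 0 := by
    refine ge_of_tendsto hlim ?_
    filter_upwards [eventually_ge_atTop (1 : ℝ)] with R hR
    obtain ⟨v, hv, hvs⟩ := hvR R hR
    have h2 := hΛ (u - v)
    rw [map_sub, hv, sub_zero] at h2
    exact h2.trans (mul_le_mul_of_nonneg_left hvs hC)
  exact norm_le_zero_iff.1 hle

/-- A tempered distribution does not see the values of test functions away from its support. -/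
theorem apply_eq_of_eventuallyEq {Λ : 𝓢'(E d, ℂ)} {K : Set (E d)}
    (hK : Distribution.dsupport Λ ⊆ K) {u v : 𝓢(E d, ℂ)} (h : ∀ᶠ x in 𝓝ˢ K, u x = v x) :
    Λ u = Λ v := by
  rw [← sub_eq_zero, ← map_sub]
  refine apply_eq_zero_of_disjoint_dsupport (Set.disjoint_left.2 fun x hx hxd => ?_)
  have h1 := eventually_nhdsSet_iff_forall.1 h x (hK hxd)
  refine (notMem_tsupport_iff_eventuallyEq.2 ?_) hx
  filter_upwards [h1] with y hy
  change u y - v y = 0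
  rw [hy, sub_self]

end Support

/-! ### Band-limited distributions are functions -/

section BandLimited

variable {d : ℕ}

/-- The product of two Schwartz functions. -/
noncomputable def mulS (φ w : 𝓢(E d, ℂ)) : 𝓢(E d, ℂ) := smulLeftCLM ℂ φ w

theorem mulS_apply (φ w : 𝓢(E d, ℂ)) (x : E d) : mulS φ w x = φ x * w x :=
  smulLeftCLM_apply_apply φ.hasTemperateGrowth w x

theorem fcoef_modS (L : E d ≃L[ℝ] E d) (χ : 𝓢(E d, ℂ)) (n : Fin d → ℤ) (y : E d) :
    fcoef L (modS y χ) n = ((|(L : E d →L[ℝ] E d).det|⁻¹ : ℝ) : ℂ) *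
      ((((2 * Real.pi) ^ (-(d : ℝ) / 2) : ℝ) : ℂ)⁻¹ *
        fourierInvS d (modS (-dualVec L n) χ) y) := by
  have : (((2 * Real.pi) ^ (-(d : ℝ) / 2) : ℝ) : ℂ) ≠ 0 := by
    rw [Complex.ofReal_ne_zero]; positivity
  rw [fcoef, fourierInvS_eq, inv_mul_cancel_left₀ this]
  congr 2
  ext ξ
  rw [modS_apply, modS_apply]
  ring

theorem fcoef_mulS_fourierInvS (L : E d ≃L[ℝ] E d) (χ ψ : 𝓢(E d, ℂ)) (n : Fin d → ℤ) :
    fcoef L (mulS χ (fourierInvS d ψ)) n = (((2 * Real.pi) ^ (-(d : ℝ) / 2) : ℝ) : ℂ) *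
      ∫ y, fcoef L (modS y χ) n * ψ y := by
  have hne : (((2 * Real.pi) ^ (-(d : ℝ) / 2) : ℝ) : ℂ) ≠ 0 := by
    rw [Complex.ofReal_ne_zero]; positivity
  simp only [fcoef_modS, mul_assoc]
  rw [integral_const_mul, integral_const_mul, integral_fourierInvS_mul, fcoef, mul_left_comm,
    mul_inv_cancel_left₀ hne]
  congr 2
  ext ξ
  rw [modS_apply, mulS_apply]
  ring

theorem integrable_fcoef_modS (L : E d ≃L[ℝ] E d) (χ ψ : 𝓢(E d, ℂ)) (n : Fin d → ℤ) :
    Integrable fun y => fcoef L (modS y χ) n * ψ y := by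
  have h0 : (fun y => fcoef L (modS y χ) n * ψ y) = fun y =>
      (((|(L : E d →L[ℝ] E d).det|⁻¹ : ℝ) : ℂ) *
        (((2 * Real.pi) ^ (-(d : ℝ) / 2) : ℝ) : ℂ)⁻¹) *
        mulS (fourierInvS d (modS (-dualVec L n) χ)) ψ y := by
    ext y
    rw [mulS_apply, fcoef_modS]
    ring
  rw [h0]
  exact (mulS _ ψ).integrable.const_mul _

theorem exists_closedBall_parallelepiped {K : Set (E d)} (hK : Bornology.IsBounded K) :
    ∃ R : ℝ, 0 < R ∧ K ⊆ Metric.ball 0 (R / 2) := by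
  obtain ⟨r, hr⟩ := hK.subset_closedBall 0
  refine ⟨2 * (|r| + 1), by positivity, hr.trans ?_⟩
  refine Metric.closedBall_subset_ball ?_
  have := le_abs_self r
  linarith

theorem summable_norm_mul_fcoef_modS (L : E d ≃L[ℝ] E d) (Λ : 𝓢'(E d, ℂ)) (χ ψ : 𝓢(E d, ℂ)) :
    Summable fun n => ∫ y, ‖Λ (modS (dualVec L n) χ) * (fcoef L (modS y χ) n * ψ y)‖ := by
  obtain ⟨m, C, hC, hΛ⟩ := exists_norm_apply_modS_le Λ
  obtain ⟨m', C', hC', hb⟩ := exists_fcoef_bound L (m + 2 * d)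
  obtain ⟨K, hK, hd⟩ := exists_norm_intVec_le L
  have h1 := sNorm_nonneg m χ
  have h2 := sNorm_nonneg m' χ
  -- the weight `(1 + ‖y‖) ^ m'` from the modulation is absorbed by `ψ`
  have hint : Integrable fun y : E d => (1 + ‖y‖) ^ m' * ‖ψ y‖ := by
    have h3 := (ψ.integrable_pow_mul (volume : Measure (E d)) m')
    have h4 := (ψ.integrable (μ := (volume : Measure (E d)))).norm
    refine ((h3.add h4).const_mul (2 ^ m')).mono' (by fun_prop) (ae_of_all _ fun y => ?_)
    have hy := norm_nonneg y
    rw [Real.norm_of_nonneg (by positivity), Pi.add_apply, ← add_one_mul, ← mul_assoc]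
    refine mul_le_mul_of_nonneg_right ?_ (norm_nonneg _)
    rcases le_total ‖y‖ 1 with h | h
    · calc (1 + ‖y‖) ^ m' ≤ 2 ^ m' := pow_le_pow_left₀ (by positivity) (by linarith) _
        _ ≤ 2 ^ m' * (‖y‖ ^ m' + 1) := le_mul_of_one_le_right (by positivity) (by
            have : 0 ≤ ‖y‖ ^ m' := by positivity
            linarith)
    · calc (1 + ‖y‖) ^ m' ≤ (2 * ‖y‖) ^ m' := pow_le_pow_left₀ (by positivity) (by linarith) _
        _ = 2 ^ m' * ‖y‖ ^ m' := mul_pow _ _ _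
        _ ≤ _ := by gcongr; linarith
  refine Summable.of_nonneg_of_le (fun n => integral_nonneg fun y => norm_nonneg _) (fun n => ?_)
    (summable_one_add_norm_intVec.mul_left
      (C * K ^ m * sNorm m χ * (C' * (2 ^ m' * sNorm m' χ)) * ∫ y, (1 + ‖y‖) ^ m' * ‖ψ y‖))
  rw [mul_assoc _ (∫ y, _), mul_comm (∫ y, _), ← mul_assoc, ← integral_const_mul]
  refine integral_mono_of_nonneg (ae_of_all _ fun _ => norm_nonneg _) (hint.const_mul _)
    (ae_of_all _ fun y => ?_)
  have hn0 : (0 : ℝ) < 1 + ‖(intVec n : E d)‖ := by positivity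
  have h5 : ‖Λ (modS (dualVec L n) χ)‖ ≤ C * (K * (1 + ‖(intVec n : E d)‖)) ^ m * sNorm m χ := by
    refine (hΛ _ _).trans ?_
    gcongr
    exact (hd n).2
  have h6 : ‖fcoef L (modS y χ) n‖ ≤ C' * (2 ^ m' * (1 + ‖y‖) ^ m' * sNorm m' χ) *
      ((1 + ‖(intVec n : E d)‖) ^ (m + 2 * d))⁻¹ := by
    refine (hb _ _).trans ?_
    gcongr
    exact sNorm_modS_le m' y χ
  simp only [norm_mul]
  calc _ ≤ (C * (K * (1 + ‖(intVec n : E d)‖)) ^ m * sNorm m χ) *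
        (C' * (2 ^ m' * (1 + ‖y‖) ^ m' * sNorm m' χ) *
          ((1 + ‖(intVec n : E d)‖) ^ (m + 2 * d))⁻¹ * ‖ψ y‖) := by gcongr
    _ = _ := by
      rw [pow_add, mul_pow K]
      field_simp

/-- **Paley-Wiener-Schwartz.** A distribution `g` whose Fourier transform `Λ` has compact support
is the function `x ↦ (2π)^{-d/2} Λ (e^{i x·ξ} χ)`. The interchange of `Λ` with the integral is
reduced to an interchange of sum and integral by expanding in a Fourier series over a large cube. -/
theorem apply_eq_integral_of_dsupport {g : 𝓢'(E d, ℂ)} {K : Set (E d)}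
    (hK : Distribution.dsupport (fourierT g) ⊆ K) (hKb : IsCompact K) {χ₀ : 𝓢(E d, ℂ)}
    (hχ₀ : ∀ᶠ x in 𝓝ˢ K, χ₀ x = 1) (ψ : 𝓢(E d, ℂ)) :
    g ψ = ∫ y, ψ y * ((((2 * Real.pi) ^ (-(d : ℝ) / 2) : ℝ) : ℂ) * fourierT g (modS y χ₀)) := by
  set κ := (((2 * Real.pi) ^ (-(d : ℝ) / 2) : ℝ) : ℂ)
  obtain ⟨R, hR, hKR⟩ := exists_closedBall_parallelepiped hKb.isBounded
  obtain ⟨χ, h1, h0, -⟩ := exists_schwartz_cutoff hKb.isClosed Metric.isOpen_ball hKR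
    Metric.isBounded_ball
  set Λ := fourierT g
  set L : E d ≃L[ℝ] E d := ContinuousLinearEquiv.smulLeft (Units.mk0 R hR.ne')
  have hL : ∀ t, L t = R • t := fun t => rfl
  -- `χ` is supported in the open cube
  have hχ : ∀ t : E d, (∃ i, 1 / 2 ≤ |t i|) → χ (L t + 0) = 0 := by
    rintro t ⟨i, hi⟩
    refine h0 _ ?_
    rw [add_zero, hL, mem_ball_zero_iff, norm_smul, Real.norm_of_nonneg hR.le, not_lt]
    have := PiLp.norm_apply_le t i
    rw [Real.norm_eq_abs] at this
    nlinarith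
  have hexp : ∀ w : 𝓢(E d, ℂ), HasSum
      (fun n => fcoef L (mulS χ w) n * Λ (modS (dualVec L n) χ)) (Λ w) := by
    intro w
    have h2 := hasSum_fcoef_apply (L := L) (s := 0) (w := mulS χ w) (χ := χ)
      (v := mulS χ (mulS χ w)) (fun t ⟨i, hi⟩ => by
        rw [mulS_apply, hχ t ⟨i, hi.le⟩, zero_mul]) (fun t => by
        rw [mulS_apply χ (mulS χ w)]
        by_cases ht : ∃ i, 1 / 2 ≤ |t i|
        · rw [hχ t ht, zero_mul, zero_mul]
        · push Not at ht
          rw [fracVec_eq_self_of_lt ht]) Λ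
    convert h2 using 1
    refine apply_eq_of_eventuallyEq hK ?_
    filter_upwards [h1] with x hx
    rw [mulS_apply, mulS_apply, hx, one_mul, one_mul]
  have hmod : ∀ y, Λ (modS y χ₀) = Λ (modS y χ) := by
    intro y
    refine apply_eq_of_eventuallyEq hK ?_
    filter_upwards [h1, hχ₀] with x hx hx'
    rw [modS_apply, modS_apply, hx, hx']
  have hcoef : ∀ y n, fcoef L (mulS χ (modS y χ)) n = fcoef L (modS y (mulS χ χ)) n := by
    intro y n
    congr 1
    ext x
    rw [mulS_apply, modS_apply, modS_apply, mulS_apply]; ring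
  have hF := hasSum_integral_of_summable_integral_norm
    (F := fun n y => κ * (Λ (modS (dualVec L n) χ) * (fcoef L (modS y χ) n * ψ y)))
    (μ := volume)
    (fun n => (((integrable_fcoef_modS L χ ψ n).const_mul _).const_mul κ)) (by
      simp only [norm_mul κ, integral_const_mul]
      exact (summable_norm_mul_fcoef_modS L Λ χ ψ).mul_left _)
  have hleft := hexp (fourierInvS d ψ)
  rw [← apply_eq_fourierT] at hleft
  have heq : ∀ n, fcoef L (mulS χ (fourierInvS d ψ)) n * Λ (modS (dualVec L n) χ) =
      ∫ y, κ * (Λ (modS (dualVec L n) χ) * (fcoef L (modS y χ) n * ψ y)) := by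
    intro n
    rw [fcoef_mulS_fourierInvS, integral_const_mul, integral_const_mul]
    ring
  rw [hleft.unique (hF.congr_fun heq)]
  refine integral_congr_ae (ae_of_all _ fun y => ?_)
  dsimp only
  rw [tsum_mul_left, hmod]
  have h3 : HasSum (fun n => Λ (modS (dualVec L n) χ) * (fcoef L (modS y χ) n * ψ y))
      (Λ (modS y χ) * ψ y) := by
    have h2 := hasSum_fcoef_apply (L := L) (s := 0) (w := modS y χ) (χ := χ)
      (v := mulS χ (modS y χ)) (fun t ⟨i, hi⟩ => by
        rw [modS_apply, hχ t ⟨i, hi.le⟩, mul_zero]) (fun t => by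
        rw [mulS_apply]
        by_cases ht : ∃ i, 1 / 2 ≤ |t i|
        · rw [hχ t ht, zero_mul, zero_mul]
        · push Not at ht
          rw [fracVec_eq_self_of_lt ht]) Λ
    have h4 : Λ (mulS χ (modS y χ)) = Λ (modS y χ) := by
      refine apply_eq_of_eventuallyEq hK ?_
      filter_upwards [h1] with x hx
      rw [mulS_apply, hx, one_mul]
    rw [h4] at h2
    refine (h2.mul_right (ψ y)).congr_fun fun n => ?_
    ring
  rw [h3.tsum_eq]
  ring

end BandLimited

/-! ### The sampling formula -/

section Sampling

variable {d : ℕ}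

/-- The closed parallelepiped `L [-1/2, 1/2]^d + s`. -/
def latticeCell (L : E d ≃L[ℝ] E d) (s : E d) : Set (E d) :=
  (fun t => L t + s) '' {t | ∀ i, |t i| ≤ 1 / 2}

theorem isCompact_latticeCell (L : E d ≃L[ℝ] E d) (s : E d) :
    IsCompact (latticeCell L s) := by
  have h : IsCompact {t : E d | ∀ i, |t i| ≤ 1 / 2} := by
    refine Metric.isCompact_of_isClosed_isBounded ?_ ?_
    · rw [Set.ofPred_forall]
      exact isClosed_iInter fun i => isClosed_le (by fun_prop) continuous_const
    · refine (Metric.isBounded_iff_subset_closedBall 0).2 ⟨√d * (1 / 2), fun t ht => ?_⟩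
      rw [mem_closedBall_zero_iff, EuclideanSpace.norm_eq]
      rw [← Real.sqrt_sq (show (0 : ℝ) ≤ 1 / 2 by norm_num), ← Real.sqrt_mul (by positivity)]
      refine Real.sqrt_le_sqrt ?_
      calc ∑ i, ‖t i‖ ^ 2 ≤ ∑ _i : Fin d, (1 / 2 : ℝ) ^ 2 :=
            Finset.sum_le_sum fun i _ => pow_le_pow_left₀ (norm_nonneg _) (ht i) 2
        _ = _ := by simp
  exact h.image (by fun_prop)

theorem dualVec_neg (L : E d ≃L[ℝ] E d) (n : Fin d → ℤ) : dualVec L (-n) = -dualVec L n := by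
  have : intVec (-n) = -(intVec n : E d) := by ext i; simp [intVec]
  rw [dualVec, this, map_neg, smul_neg, dualVec]

/-- The sampling formula, if the band of `h` lies in the interior of the parallelepiped. -/
theorem hasSum_sampling_of_interior {L : E d ≃L[ℝ] E d} {s : E d} {Λ : 𝓢'(E d, ℂ)}
    (hΛ : Distribution.dsupport Λ ⊆ latticeCell L s) {χ₀ : 𝓢(E d, ℂ)}
    (hχ₀ : ∀ᶠ x in 𝓝ˢ (latticeCell L s), χ₀ x = 1) {h : 𝓢(E d, ℂ)} {r : ℝ} (hr : r < 1 / 2)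
    (hh : ∀ t : E d, (∃ i, r < |t i|) → fourierS d h (L t + s) = 0) (x v : E d) :
    HasSum (fun n => ((|(L : E d →L[ℝ] E d).det|⁻¹ : ℝ) : ℂ) *
      (((2 * Real.pi) ^ (-(d : ℝ) / 2) : ℝ) : ℂ)⁻¹ * h (x + (dualVec L n + v)) *
      Λ (modS (-(dualVec L n + v)) χ₀)) (Λ (modS x (fourierS d h))) := by
  set U : Set (E d) := (fun t => L t + s) '' {t | ∀ i, |t i| < 1 - r}
  have hUo : IsOpen U := by
    have h1 : IsOpen {t : E d | ∀ i, |t i| < 1 - r} := by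
      rw [Set.ofPred_forall]
      exact isOpen_iInter_of_finite fun i => isOpen_lt (by fun_prop) continuous_const
    exact ((Homeomorph.addRight s).isOpenMap.comp L.toHomeomorph.isOpenMap) _ h1
  have hKU : latticeCell L s ⊆ U := Set.image_mono fun t ht i => by
    have := ht i; linarith
  obtain ⟨V, hV1, hV2, hV3⟩ : ∃ V : Set (E d), IsOpen V ∧ Bornology.IsBounded V ∧
      latticeCell L s ⊆ V := by
    obtain ⟨R, -, hR⟩ := exists_closedBall_parallelepiped
      (isCompact_latticeCell L s).isBounded
    exact ⟨_, Metric.isOpen_ball, Metric.isBounded_ball, hR⟩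
  obtain ⟨χ, h1, h0, -⟩ := exists_schwartz_cutoff (isCompact_latticeCell L s).isClosed
    (hUo.inter hV1) (Set.subset_inter hKU hV3) (hV2.subset Set.inter_subset_right)
  have hχ : ∀ t : E d, (∃ i, 1 - r ≤ |t i|) → χ (L t + s) = 0 := by
    rintro t ⟨i, hi⟩
    refine h0 _ fun hmem => ?_
    obtain ⟨t', ht', he⟩ := hmem.1
    have : t' = t := L.injective (by simpa using he)
    subst this
    exact absurd (ht' i) (not_lt.2 hi)
  have key := hasSum_fcoef_apply (L := L) (s := s) (w := modS (x + v) (fourierS d h))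
    (χ := modS (-v) χ) (v := modS x (fourierS d h))
    (fun t ⟨i, hi⟩ => by rw [modS_apply, hh t ⟨i, by linarith⟩, mul_zero]) (fun t => ?_) Λ
  · rw [← (Equiv.neg (Fin d → ℤ)).hasSum_iff] at key
    refine key.congr_fun fun n => ?_
    rw [Function.comp_apply, Equiv.neg_apply, modS_modS, dualVec_neg]
    have h2 : Λ (modS (-dualVec L n + -v) χ) = Λ (modS (-(dualVec L n + v)) χ₀) := by
      rw [neg_add]
      refine apply_eq_of_eventuallyEq hΛ ?_
      filter_upwards [h1, hχ₀] with y hy hy'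
      rw [modS_apply, modS_apply, hy, hy']
    rw [h2, fcoef_eq_fourierS, dualVec_neg, fourierS_modS, ← neg_sub _ (-dualVec L n),
      ← fourierInvS_eq_fourierS_neg, fourierInvS_fourierS, ← mul_assoc]
    congr 3
    abel
  · rw [modS_apply]
    by_cases ht : ∃ i, 1 - r ≤ |t i|
    · have h2 : fourierS d h (L t + s) = 0 := by
        obtain ⟨i, hi⟩ := ht
        exact hh t ⟨i, by linarith⟩
      rw [hχ t ht, modS_apply x, h2]
      simp
    · push Not at ht
      by_cases ht' : ∃ i, 1 / 2 ≤ |t i|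
      · obtain ⟨i, hi⟩ := ht'
        have h2 : fourierS d h (L t + s) = 0 := hh t ⟨i, by linarith⟩
        -- the reduction of `t` modulo `ℤ^d` stays close to the boundary of the cube
        have h3 : r < |(fracVec t : E d) i| := by
          change r < |t i - round (t i)|
          rcases eq_or_ne (round (t i)) 0 with hz | hz
          · rw [hz]; push_cast; rw [sub_zero]; linarith
          · have h4 : (1 : ℝ) ≤ |(round (t i) : ℝ)| := by
              rw [← Int.cast_abs]; exact_mod_cast Int.one_le_abs hz
            have h5 := abs_sub_abs_le_abs_sub (round (t i) : ℝ) (t i)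
            rw [abs_sub_comm] at h5
            have := ht i
            linarith
        rw [modS_apply _ (fourierS d h), hh _ ⟨i, h3⟩, modS_apply, h2]
        simp
      · push Not at ht'
        have h2 : χ (L t + s) = 1 := by
          refine eventually_nhdsSet_iff_forall.1 h1 _ ?_ |>.self_of_nhds
          exact ⟨t, fun i => (ht' i).le, rfl⟩
        rw [fracVec_eq_self_of_lt ht', h2, mul_one]
        rw [← modS_apply, modS_modS, neg_add_cancel_comm_assoc]

end Sampling

/-! ### Sampling of functions with band in the closed cell -/

section Sampling

variable {d : ℕ}

theorem one_add_norm_le_mul (x y : E d) : 1 + ‖y‖ ≤ (1 + ‖x‖) * (1 + ‖x + y‖) := by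
  have h : ‖y‖ ≤ ‖x‖ + ‖x + y‖ := by
    calc ‖y‖ = ‖(x + y) - x‖ := by rw [add_sub_cancel_left]
      _ ≤ ‖x + y‖ + ‖x‖ := norm_sub_le _ _
      _ = _ := add_comm _ _
  nlinarith [norm_nonneg x, norm_nonneg (x + y), mul_nonneg (norm_nonneg x) (norm_nonneg (x + y))]

theorem inv_one_add_norm_add_pow_le (x y : E d) (k : ℕ) :
    ((1 + ‖x + y‖) ^ k)⁻¹ ≤ (1 + ‖x‖) ^ k * ((1 + ‖y‖) ^ k)⁻¹ := by
  rw [← div_eq_mul_inv, le_div_iff₀ (by positivity), inv_mul_le_iff₀ (by positivity), ← mul_pow,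
    mul_comm (1 + ‖x + y‖)]
  exact pow_le_pow_left₀ (by positivity) (one_add_norm_le_mul x y) k

theorem summable_one_add_norm_dualVec_add (L : E d ≃L[ℝ] E d) (v : E d) :
    Summable fun n => ((1 + ‖dualVec L n + v‖) ^ (2 * d))⁻¹ := by
  obtain ⟨K, hK, hd⟩ := exists_norm_intVec_le L
  refine Summable.of_nonneg_of_le (fun _ => by positivity) (fun n => ?_)
    (summable_one_add_norm_intVec.mul_left ((1 + ‖v‖) ^ (2 * d) * K ^ (2 * d)))
  rw [add_comm (dualVec L n)]
  refine (inv_one_add_norm_add_pow_le v _ _).trans ?_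
  rw [mul_assoc]
  gcongr
  rw [← div_eq_mul_inv, le_div_iff₀ (by positivity), inv_mul_le_iff₀ (by positivity), ← mul_pow,
    mul_comm _ K]
  exact pow_le_pow_left₀ (by positivity) (hd n).1 _

theorem integrable_inv_one_add_norm_pow : Integrable fun x : E d => ((1 + ‖x‖) ^ (d + 1))⁻¹ := by
  have h1 : Integrable fun y : E d => (1 + ‖y‖) ^ (-((d + 1 : ℕ) : ℝ)) :=
    integrable_one_add_norm (by simp)
  refine h1.congr (ae_of_all _ fun y => ?_)
  dsimp only
  rw [Real.rpow_neg (by positivity), Real.rpow_natCast]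

theorem fourierS_pullS_smul {σ : ℝ} (hσ : 0 < σ) (h : 𝓢(E d, ℂ)) (ξ : E d) :
    fourierS d (pullS (ContinuousLinearEquiv.smulLeft (Units.mk0 σ⁻¹ (inv_ne_zero hσ.ne'))) 0 h) ξ =
      (σ ^ d : ℝ) • fourierS d h (σ • ξ) := by
  rw [fourierS_eq, fourierS_eq]
  have h1 := Measure.integral_comp_smul (volume : Measure (E d))
    (fun x => character (-(σ • ξ)) x * h x) σ⁻¹
  rw [finrank_euclideanSpace_fin, inv_pow, inv_inv, abs_of_pos (by positivity)] at h1
  rw [← mul_smul_comm, ← h1]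
  congr 2
  ext x
  rw [pullS_apply, add_zero]
  change _ * h (σ⁻¹ • x) = _
  congr 1
  simp only [character, inner_neg_left, inner_smul_left, inner_smul_right, conj_trivial]
  rw [mul_neg, inv_mul_cancel_left₀ hσ.ne']

/-- Modulation and slight dilation of a Schwartz function `h`. On the Fourier side, it contracts the
spectrum of `h` towards the centre `s`. -/
noncomputable def contractS (σ : ℝ) (hσ : 0 < σ) (s : E d) (h : 𝓢(E d, ℂ)) : 𝓢(E d, ℂ) :=
  modS ((1 - σ⁻¹) • s)
    (pullS (ContinuousLinearEquiv.smulLeft (Units.mk0 σ⁻¹ (inv_ne_zero hσ.ne'))) 0 h)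

theorem contractS_apply (σ : ℝ) (hσ : 0 < σ) (s : E d) (h : 𝓢(E d, ℂ)) (z : E d) :
    contractS σ hσ s h z = character ((1 - σ⁻¹) • s) z * h (σ⁻¹ • z) := by
  rw [contractS, modS_apply, pullS_apply, add_zero]
  rfl

theorem fourierS_contractS (σ : ℝ) (hσ : 0 < σ) (s : E d) (h : 𝓢(E d, ℂ)) (ξ : E d) :
    fourierS d (contractS σ hσ s h) (ξ + s) = (σ ^ d : ℝ) • fourierS d h (σ • ξ + s) := by
  rw [contractS, fourierS_modS, fourierS_pullS_smul hσ]
  congr 2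
  rw [add_sub_assoc, sub_smul, one_smul, sub_sub_cancel, smul_add, smul_inv_smul₀ hσ.ne']

theorem norm_contractS_le (k : ℕ) {σ : ℝ} (hσ : 0 < σ) (hσ2 : σ ≤ 2) (s : E d) (h : 𝓢(E d, ℂ))
    (z : E d) :
    ‖contractS σ hσ s h z‖ ≤ 2 ^ k * 2 ^ k * sNorm k h * ((1 + ‖z‖) ^ k)⁻¹ := by
  rw [contractS_apply, norm_mul, norm_character, one_mul]
  refine (norm_le_sNorm k _ _).trans ?_
  have h1 : ((1 + ‖σ⁻¹ • z‖) ^ k)⁻¹ ≤ 2 ^ k * ((1 + ‖z‖) ^ k)⁻¹ := by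
    rw [← div_eq_mul_inv, le_div_iff₀ (by positivity), inv_mul_le_iff₀ (by positivity), ← mul_pow]
    refine pow_le_pow_left₀ (by positivity) ?_ k
    rw [norm_smul, Real.norm_of_nonneg (by positivity)]
    have h2 : ‖z‖ = σ * (σ⁻¹ * ‖z‖) := by rw [mul_inv_cancel_left₀ hσ.ne']
    have h3 : 0 ≤ σ⁻¹ * ‖z‖ := by positivity
    nlinarith
  have := sNorm_nonneg k h
  calc _ ≤ 2 ^ k * sNorm k h * (2 ^ k * ((1 + ‖z‖) ^ k)⁻¹) := by gcongr
    _ = _ := by ring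

theorem tendsto_contractS {σ : ℕ → ℝ} (hσ : ∀ j, 0 < σ j) (h1 : Tendsto σ atTop (𝓝 1)) (s : E d)
    (h : 𝓢(E d, ℂ)) (z : E d) :
    Tendsto (fun j => contractS (σ j) (hσ j) s h z) atTop (𝓝 (h z)) := by
  have h2 : Tendsto (fun j => (σ j)⁻¹) atTop (𝓝 1) := by
    simpa using h1.inv₀ one_ne_zero
  have h3 : Continuous fun t : ℝ => character ((1 - t) • s) z * h (t • z) := by
    have := h.continuous
    unfold character
    fun_prop
  have h4 := (h3.tendsto 1).comp h2
  simp only [sub_self, zero_smul, one_smul, character_zero, one_mul] at h4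
  convert h4 using 2 with j
  rw [Function.comp_apply, contractS_apply]

/-- The terms of the sampling series are dominated by a summable family, polynomially in `x`. -/
theorem exists_sampling_bound (L : E d ≃L[ℝ] E d) (v : E d) (Λ : 𝓢'(E d, ℂ)) (χ₀ : 𝓢(E d, ℂ)) :
    ∃ (k : ℕ) (β : (Fin d → ℤ) → ℝ), Summable β ∧ ∀ (K : ℝ) (H : E d → ℂ),
      (∀ z, ‖H z‖ ≤ K * ((1 + ‖z‖) ^ k)⁻¹) → ∀ x n,
      ‖H (x + (dualVec L n + v)) * Λ (modS (-(dualVec L n + v)) χ₀)‖ ≤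
        K * (1 + ‖x‖) ^ k * β n := by
  obtain ⟨m, C, hC, hΛ⟩ := exists_norm_apply_modS_le Λ
  have hX := sNorm_nonneg m χ₀
  refine ⟨m + 2 * d, fun n => C * sNorm m χ₀ * ((1 + ‖dualVec L n + v‖) ^ (2 * d))⁻¹,
    (summable_one_add_norm_dualVec_add L v).mul_left _, fun K H hH x n => ?_⟩
  have hK : 0 ≤ K := by
    have := (norm_nonneg _).trans (hH 0)
    simpa using this
  have h1 := hΛ (-(dualVec L n + v)) χ₀
  rw [norm_neg] at h1
  have h2 := inv_one_add_norm_add_pow_le x (dualVec L n + v) (m + 2 * d)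
  rw [norm_mul]
  calc _ ≤ (K * ((1 + ‖x‖) ^ (m + 2 * d) * ((1 + ‖dualVec L n + v‖) ^ (m + 2 * d))⁻¹)) *
        (C * (1 + ‖dualVec L n + v‖) ^ m * sNorm m χ₀) := by
          gcongr
          exact (hH _).trans (by gcongr)
    _ = _ := by
          have : (0 : ℝ) < 1 + ‖dualVec L n + v‖ := by positivity
          rw [pow_add (1 + ‖dualVec L n + v‖)]
          field_simp

/-- The sampling formula for band-limited functions: the samples of `g` (expressed through the
Fourier transform `Λ` of `g`) and of `h` on a translate of the dual lattice determine `g * h`.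
It follows by contracting the spectrum of `h` into the interior of the cell. -/
theorem hasSum_sampling {L : E d ≃L[ℝ] E d} {s : E d} {g : 𝓢'(E d, ℂ)}
    (hg : Distribution.dsupport (fourierT g) ⊆ latticeCell L s) {χ₀ : 𝓢(E d, ℂ)}
    (hχ₀ : ∀ᶠ x in 𝓝ˢ (latticeCell L s), χ₀ x = 1) {h : 𝓢(E d, ℂ)}
    (hh : ∀ t : E d, (∃ i, 1 / 2 < |t i|) → fourierS d h (L t + s) = 0) (x v : E d) :
    HasSum (fun n => ((|(L : E d →L[ℝ] E d).det|⁻¹ : ℝ) : ℂ) *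
      (((2 * Real.pi) ^ (-(d : ℝ) / 2) : ℝ) : ℂ)⁻¹ * h (x + (dualVec L n + v)) *
      fourierT g (modS (-(dualVec L n + v)) χ₀)) (conv g h x) := by
  obtain ⟨m, C, hC, hΛ⟩ := exists_norm_apply_modS_le (fourierT g)
  set σ : ℕ → ℝ := fun j => 1 + 1 / ((j : ℝ) + 1) with hσdef
  have hσ1 : ∀ j, 1 < σ j := fun j => by
    have : (0 : ℝ) < 1 / ((j : ℝ) + 1) := by positivity
    simp only [hσdef]; linarith
  have hσ0 : ∀ j, 0 < σ j := fun j => zero_lt_one.trans (hσ1 j)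
  have hσ2 : ∀ j, σ j ≤ 2 := fun j => by
    have : (1 : ℝ) / ((j : ℝ) + 1) ≤ 1 := by
      rw [div_le_one (by positivity)]
      have : (0 : ℝ) ≤ j := by positivity
      linarith
    simp only [hσdef]; linarith
  have hσt : Tendsto σ atTop (𝓝 1) := by
    simpa [hσdef] using (tendsto_one_div_add_atTop_nhds_zero_nat (𝕜 := ℝ)).const_add 1
  set H : ℕ → 𝓢(E d, ℂ) := fun j => contractS (σ j) (hσ0 j) s h
  have hsum : ∀ j, HasSum (fun n => ((|(L : E d →L[ℝ] E d).det|⁻¹ : ℝ) : ℂ) *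
      (((2 * Real.pi) ^ (-(d : ℝ) / 2) : ℝ) : ℂ)⁻¹ * H j (x + (dualVec L n + v)) *
      fourierT g (modS (-(dualVec L n + v)) χ₀)) (conv g (H j) x) := by
    intro j
    rw [conv_eq_fourierT]
    refine hasSum_sampling_of_interior hg hχ₀ (r := (σ j)⁻¹ * (1 / 2)) ?_ ?_ x v
    · have := inv_lt_one_of_one_lt₀ (hσ1 j)
      linarith
    · rintro t ⟨i, hi⟩
      rw [fourierS_contractS, ← map_smul L, hh, smul_zero]
      refine ⟨i, ?_⟩
      rw [PiLp.smul_apply, smul_eq_mul, abs_mul, abs_of_pos (hσ0 j)]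
      rwa [inv_mul_lt_iff₀ (hσ0 j)] at hi
  have hdom' : ∀ j z, ‖H j z‖ ≤ _ := fun j z =>
    norm_contractS_le (m + (d + 1)) (hσ0 j) (hσ2 j) s h z
  have hS' := sNorm_nonneg (m + (d + 1)) h
  have hX := sNorm_nonneg m χ₀
  -- convergence of the left hand sides, from the integral representation of `g`
  have hconv : Tendsto (fun j => conv g (H j) x) atTop (𝓝 (conv g h x)) := by
    simp only [conv, apply_eq_integral_of_dsupport hg (isCompact_latticeCell L s) hχ₀]
    have hint : Integrable fun y : E d => ((1 + ‖x - y‖) ^ (d + 1))⁻¹ :=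
      integrable_inv_one_add_norm_pow.comp_sub_left x
    refine tendsto_integral_of_dominated_convergence
      (fun y => 2 ^ (m + (d + 1)) * 2 ^ (m + (d + 1)) * sNorm (m + (d + 1)) h *
        (‖(((2 * Real.pi) ^ (-(d : ℝ) / 2) : ℝ) : ℂ)‖ * (C * (1 + ‖x‖) ^ m * sNorm m χ₀)) *
          ((1 + ‖x - y‖) ^ (d + 1))⁻¹) (fun j => ?_) (hint.const_mul _) (fun j => ?_) ?_
    · have h1 := (hasTemperateGrowth_apply_modS (fourierT g) χ₀).1.continuous
      exact ((reflTrans (H j) x).continuous.mul (continuous_const.mul h1)).aestronglyMeasurable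
    · refine ae_of_all _ fun y => ?_
      rw [reflTrans_apply, norm_mul, norm_mul]
      have h1 : ‖fourierT g (modS y χ₀)‖ ≤ C * ((1 + ‖x‖) * (1 + ‖x - y‖)) ^ m * sNorm m χ₀ := by
        refine (hΛ _ _).trans ?_
        have := one_add_norm_le_mul x (-y)
        rw [norm_neg, ← sub_eq_add_neg] at this
        gcongr
      calc _ ≤ (2 ^ (m + (d + 1)) * 2 ^ (m + (d + 1)) * sNorm (m + (d + 1)) h *
            ((1 + ‖x - y‖) ^ (m + (d + 1)))⁻¹) *
            (‖(((2 * Real.pi) ^ (-(d : ℝ) / 2) : ℝ) : ℂ)‖ *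
              (C * ((1 + ‖x‖) * (1 + ‖x - y‖)) ^ m * sNorm m χ₀)) := by
            gcongr
            exact hdom' j _
        _ = _ := by
            have : (0 : ℝ) < 1 + ‖x - y‖ := by positivity
            rw [pow_add _ m (d + 1), mul_pow (1 + ‖x‖), pow_add (1 + ‖x - y‖)]
            field_simp
    · refine ae_of_all _ fun y => ?_
      simp only [reflTrans_apply]
      exact (tendsto_contractS hσ0 hσt s h _).mul_const _
  -- dominated convergence for the series
  set D : ℂ := ((|(L : E d →L[ℝ] E d).det|⁻¹ : ℝ) : ℂ) *
      (((2 * Real.pi) ^ (-(d : ℝ) / 2) : ℝ) : ℂ)⁻¹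
  obtain ⟨k, β, hβ, hbd⟩ := exists_sampling_bound L v (fourierT g) χ₀
  have hsb : Summable fun n =>
      ‖D‖ * (2 ^ k * 2 ^ k * sNorm k h * (1 + ‖x‖) ^ k * β n) := (hβ.mul_left _).mul_left _
  have hlim := tendsto_tsum_of_dominated_convergence hsb
    (f := fun j n => D * H j (x + (dualVec L n + v)) *
      fourierT g (modS (-(dualVec L n + v)) χ₀))
    (fun n => ((tendsto_contractS hσ0 hσt s h _).const_mul _).mul_const _)
    (Eventually.of_forall fun j n => by
      rw [mul_assoc, norm_mul]
      exact mul_le_mul_of_nonneg_left (hbd _ _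
        (fun z => norm_contractS_le k (hσ0 j) (hσ2 j) s h z) x n) (norm_nonneg _))
  simp only [(hsum _).tsum_eq] at hlim
  rw [tendsto_nhds_unique hconv hlim]
  refine Summable.hasSum (Summable.of_norm_bounded
    (g := fun n => ‖D‖ * (2 ^ k * sNorm k h * (1 + ‖x‖) ^ k * β n))
    ((hβ.mul_left _).mul_left _) fun n => ?_)
  rw [mul_assoc, norm_mul]
  exact mul_le_mul_of_nonneg_left (hbd _ _ (norm_le_sNorm k h) x n) (norm_nonneg _)

theorem toT_apply (η θ : 𝓢(E d, ℂ)) : toT η θ = ∫ x, θ x * η x :=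
  toTemperedDistributionCLM_apply_apply volume η θ

/-- A tempered series of functions converges in the sense of distributions. -/
theorem hasSum_toT {F : E d → ℂ} (hF : F.HasTemperateGrowth) {ι : Type*} [Countable ι]
    {c : ι → ℂ} {w : ι → 𝓢(E d, ℂ)} (hsum : ∀ x, HasSum (fun i => c i * w i x) (F x))
    {k : ℕ} {β : ι → ℝ} (hβ : Summable β) (hb : ∀ i x, ‖c i * w i x‖ ≤ β i * (1 + ‖x‖) ^ k) :
    HasSum (fun i => c i • toT (w i)) (hF.toTemperedDistribution (volume : Measure (E d))) := by
  rw [HasSum, PointwiseConvergenceCLM.tendsto_iff_forall_tendsto]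
  intro θ
  have hint : Integrable fun x => (1 + ‖x‖) ^ k * ‖θ x‖ := by
    refine (integrable_inv_one_add_norm_pow.const_mul
      (2 ^ (k + (d + 1)) * sNorm (k + (d + 1)) θ)).mono'
      (Continuous.aestronglyMeasurable (by have := θ.continuous; fun_prop))
      (ae_of_all _ fun x => ?_)
    rw [Real.norm_of_nonneg (by positivity)]
    calc _ ≤ (1 + ‖x‖) ^ k * (2 ^ (k + (d + 1)) * sNorm (k + (d + 1)) θ *
          ((1 + ‖x‖) ^ (k + (d + 1)))⁻¹) := by
          gcongr
          exact norm_le_sNorm _ _ _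
      _ = _ := by
        have : (0 : ℝ) < 1 + ‖x‖ := by positivity
        rw [pow_add (1 + ‖x‖)]
        field_simp
  have h1 : ∀ i, Integrable fun x => θ x * (c i * w i x) := by
    intro i
    refine (hint.const_mul (β i)).mono' ?_ (ae_of_all _ fun x => ?_)
    · exact Continuous.aestronglyMeasurable
        (by have := θ.continuous; have := (w i).continuous; fun_prop)
    · rw [norm_mul]
      have := mul_le_mul_of_nonneg_left (hb i x) (norm_nonneg (θ x))
      linarith
  have h2 := hasSum_integral_of_summable_integral_norm h1 (by
    refine Summable.of_nonneg_of_le (fun i => integral_nonneg fun _ => norm_nonneg _)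
      (fun i => ?_) (hβ.mul_right (∫ x, (1 + ‖x‖) ^ k * ‖θ x‖))
    rw [← integral_const_mul]
    refine integral_mono (h1 i).norm (hint.const_mul _) fun x => ?_
    rw [norm_mul]
    have := mul_le_mul_of_nonneg_left (hb i x) (norm_nonneg (θ x))
    linarith)
  have h3 : (hF.toTemperedDistribution (volume : Measure (E d))) θ =
      ∫ x, ∑' i, θ x * (c i * w i x) := by
    refine (Function.HasTemperateGrowth.toTemperedDistribution_apply volume hF θ).trans ?_
    refine integral_congr_ae (ae_of_all _ fun x => ?_)
    exact ((hsum x).mul_left (θ x)).tsum_eq.symm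
  rw [h3]
  have h4 : HasSum (fun i => (c i • toT (w i)) θ) (∫ x, ∑' i, θ x * (c i * w i x)) := by
    refine h2.congr_fun fun i => ?_
    change c i * toT (w i) θ = _
    rw [toT_apply, ← integral_const_mul]
    refine integral_congr_ae (ae_of_all _ fun x => ?_)
    ring
  refine h4.congr fun t => ?_
  simp

end Sampling

/-! ### Lattice cells as affine images of cubes -/

section MatrixMaps

variable {d : ℕ}

theorem toEuclideanLin_inv_apply {A : Matrix (Fin d) (Fin d) ℝ} (hA : IsUnit A.det) (x : E d) :
    Matrix.toEuclideanLin A⁻¹ (Matrix.toEuclideanLin A x) = x := by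
  ext i
  simp [Matrix.toLpLin_apply, Matrix.mulVec_mulVec, Matrix.nonsing_inv_mul _ hA]

theorem toEuclideanLin_apply_inv {A : Matrix (Fin d) (Fin d) ℝ} (hA : IsUnit A.det) (x : E d) :
    Matrix.toEuclideanLin A (Matrix.toEuclideanLin A⁻¹ x) = x := by
  ext i
  simp [Matrix.toLpLin_apply, Matrix.mulVec_mulVec, Matrix.mul_nonsing_inv _ hA]

/-- The linear automorphism `t ↦ A (ρ t)` of `ℝ^d`, for an invertible matrix `A` and `ρ > 0`. -/
noncomputable def scaledEquiv (A : Matrix (Fin d) (Fin d) ℝ) (hA : IsUnit A.det) (ρ : ℝ)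
    (hρ : 0 < ρ) : E d ≃L[ℝ] E d :=
  ContinuousLinearEquiv.equivOfInverse
    (ρ • LinearMap.toContinuousLinearMap (Matrix.toEuclideanLin A))
    (ρ⁻¹ • LinearMap.toContinuousLinearMap (Matrix.toEuclideanLin A⁻¹))
    (fun x => by simp [toEuclideanLin_inv_apply hA, smul_smul, mul_inv_cancel₀ hρ.ne'])
    (fun x => by simp [toEuclideanLin_apply_inv hA, smul_smul, inv_mul_cancel₀ hρ.ne'])

theorem scaledEquiv_apply {A : Matrix (Fin d) (Fin d) ℝ} (hA : IsUnit A.det) {ρ : ℝ}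
    (hρ : 0 < ρ) (t : E d) : scaledEquiv A hA ρ hρ t = ρ • Matrix.toEuclideanLin A t := rfl

theorem scaledEquiv_symm_apply {A : Matrix (Fin d) (Fin d) ℝ} (hA : IsUnit A.det) {ρ : ℝ}
    (hρ : 0 < ρ) (t : E d) :
    (scaledEquiv A hA ρ hρ).symm t = ρ⁻¹ • Matrix.toEuclideanLin A⁻¹ t := rfl

theorem det_scaledEquiv {A : Matrix (Fin d) (Fin d) ℝ} (hA : IsUnit A.det) {ρ : ℝ}
    (hρ : 0 < ρ) : ((scaledEquiv A hA ρ hρ : E d ≃L[ℝ] E d) : E d →L[ℝ] E d).det = ρ ^ d * A.det := by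
  change LinearMap.det (ρ • Matrix.toEuclideanLin A) = _
  rw [LinearMap.det_smul, finrank_euclideanSpace_fin, LinearMap.det_toLpLin]

theorem dualVec_scaledEquiv {A : Matrix (Fin d) (Fin d) ℝ} (hA : IsUnit A.det)
    (hsym : A.IsHermitian) {a : ℝ} (ha : 0 < a) (h2a : 0 < 2 * a) (n : Fin d → ℤ) :
    dualVec (scaledEquiv A hA (2 * a) h2a) n =
      (Real.pi / a) • Matrix.toEuclideanLin A⁻¹ (intVec n) := by
  have h := Matrix.isSymmetric_toEuclideanLin_iff.2 hsym.inv
  have h1 : ContinuousLinearMap.adjoint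
      ((scaledEquiv A hA (2 * a) h2a).symm : E d →L[ℝ] E d) (intVec n) =
      (2 * a)⁻¹ • Matrix.toEuclideanLin A⁻¹ (intVec n) := by
    refine ext_inner_right ℝ fun z => ?_
    rw [ContinuousLinearMap.adjoint_inner_left]
    change inner ℝ (intVec n) ((scaledEquiv A hA (2 * a) h2a).symm z) = _
    rw [scaledEquiv_symm_apply, inner_smul_right, inner_smul_left, h]
    rfl
  rw [dualVec, h1, smul_smul]
  congr 1
  field_simp

theorem affMap_image_cube {A : Matrix (Fin d) (Fin d) ℝ} (hA : IsUnit A.det) (b c : E d) {a : ℝ}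
    (h2a : 0 < 2 * a) :
    affMap A b '' cube c a = latticeCell (scaledEquiv A hA (2 * a) h2a) (affMap A b c) := by
  have h : ∀ t : E d, scaledEquiv A hA (2 * a) h2a t + affMap A b c =
      affMap A b (c + (2 * a) • t) := by
    intro t
    rw [scaledEquiv_apply, affMap, affMap, map_add, map_smul]
    abel
  ext ξ
  constructor
  · rintro ⟨ζ, hζ, rfl⟩
    refine ⟨(2 * a)⁻¹ • (ζ - c), fun i => ?_, ?_⟩
    · have := hζ i
      rw [PiLp.smul_apply, PiLp.sub_apply, smul_eq_mul, abs_mul, abs_of_pos (by positivity),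
        inv_mul_le_iff₀ h2a]
      linarith
    · dsimp only
      rw [h, smul_inv_smul₀ h2a.ne', add_sub_cancel]
  · rintro ⟨t, ht, rfl⟩
    refine ⟨c + (2 * a) • t, fun i => ?_, (h t).symm⟩
    have := ht i
    rw [PiLp.add_apply, add_sub_cancel_left, PiLp.smul_apply, smul_eq_mul, abs_mul,
      abs_of_pos h2a]
    nlinarith

/-- Band-limited distributions are smooth functions of polynomial growth, and their convolution
with band-limited Schwartz functions is given by a sampling series. -/
theorem exists_sampling_series {A : Matrix (Fin d) (Fin d) ℝ} (hA : IsUnit A.det)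
    (hsym : A.IsHermitian) (b c : E d) {a : ℝ} (ha : 0 < a) (g : 𝓢'(E d, ℂ)) (h : 𝓢(E d, ℂ))
    (hg : Distribution.dsupport (fourierT g) ⊆ affMap A b '' cube c a)
    (hh : tsupport (fourierS d h) ⊆ affMap A b '' cube c a) :
    ∃ (G : E d → ℂ) (hG : G.HasTemperateGrowth) (hgh : (conv g h).HasTemperateGrowth),
      g = Function.HasTemperateGrowth.toTemperedDistribution volume hG ∧
      ∀ (v : E d) (y : (Fin d → ℤ) → E d),
        (∀ n, y n = (Real.pi / a) • Matrix.toEuclideanLin A⁻¹ (intVec n) + v) →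
        (∀ x, HasSum (fun n =>
          (((2 * Real.pi) ^ d * ((2 * a) ^ d)⁻¹ * |A.det|⁻¹ : ℝ) : ℂ) *
            G (-y n) * h (x + y n)) (conv g h x)) ∧
        HasSum (fun n =>
          ((((2 * Real.pi) ^ d * ((2 * a) ^ d)⁻¹ * |A.det|⁻¹ : ℝ) : ℂ) *
            G (-y n)) • toT (compSubConstCLM ℂ (-y n) h))
          (Function.HasTemperateGrowth.toTemperedDistribution volume hgh) := by
  have h2a : 0 < 2 * a := by positivity
  rw [affMap_image_cube hA b c h2a] at hg hh
  set L := scaledEquiv A hA (2 * a) h2a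
  set s := affMap A b c
  set κ := (((2 * Real.pi) ^ (-(d : ℝ) / 2) : ℝ) : ℂ) with hκ
  have hc := isCompact_latticeCell L s
  obtain ⟨R, -, hR⟩ := exists_closedBall_parallelepiped hc.isBounded
  obtain ⟨χ₀, hχ₀, -, -⟩ := exists_schwartz_cutoff hc.isClosed Metric.isOpen_ball hR
    Metric.isBounded_ball
  have hG : (fun y => κ * fourierT g (modS y χ₀)).HasTemperateGrowth :=
    (Function.HasTemperateGrowth.const _).mul (hasTemperateGrowth_apply_modS _ _)
  have hgh : (conv g h).HasTemperateGrowth := by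
    have := hasTemperateGrowth_apply_modS (fourierT g) (fourierS d h)
    convert this using 1
    exact funext fun x => conv_eq_fourierT g h x
  refine ⟨_, hG, hgh, ?_, fun v y hy => ?_⟩
  · ext ψ
    rw [apply_eq_integral_of_dsupport hg hc hχ₀]
    exact (Function.HasTemperateGrowth.toTemperedDistribution_apply volume hG ψ).symm
  have hy' : ∀ n, y n = dualVec L n + v := fun n => by
    rw [hy, dualVec_scaledEquiv hA hsym ha]
  have hκ0 : κ ≠ 0 := by
    rw [hκ, Complex.ofReal_ne_zero]; positivity
  have hconst : (((2 * Real.pi) ^ d * ((2 * a) ^ d)⁻¹ * |A.det|⁻¹ : ℝ) : ℂ) * κ =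
      ((|(L : E d →L[ℝ] E d).det|⁻¹ : ℝ) : ℂ) * κ⁻¹ := by
    have h1 := two_pi_rpow_mul_self d
    rw [← hκ] at h1
    rw [det_scaledEquiv, abs_mul, abs_of_pos (pow_pos h2a d), mul_inv]
    rw [Complex.ofReal_mul, Complex.ofReal_mul, Complex.ofReal_mul, eq_mul_inv_iff_mul_eq₀ hκ0]
    linear_combination ((((2 * a) ^ d)⁻¹ : ℝ) : ℂ) * ((|A.det|⁻¹ : ℝ) : ℂ) * h1
  have hterm : ∀ x n, (((2 * Real.pi) ^ d * ((2 * a) ^ d)⁻¹ * |A.det|⁻¹ : ℝ) : ℂ) *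
      (κ * fourierT g (modS (-y n) χ₀)) * h (x + y n) =
      ((|(L : E d →L[ℝ] E d).det|⁻¹ : ℝ) : ℂ) * κ⁻¹ * h (x + (dualVec L n + v)) *
      fourierT g (modS (-(dualVec L n + v)) χ₀) := by
    intro x n
    rw [← mul_assoc, hconst, hy']
    ring
  have hpt : ∀ x, HasSum (fun n =>
      (((2 * Real.pi) ^ d * ((2 * a) ^ d)⁻¹ * |A.det|⁻¹ : ℝ) : ℂ) *
        (κ * fourierT g (modS (-y n) χ₀)) * h (x + y n)) (conv g h x) := by
    intro x
    refine (hasSum_sampling hg hχ₀ (fun t ⟨i, hi⟩ => ?_) x v).congr_fun fun n => hterm x n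
    refine image_eq_zero_of_notMem_tsupport fun hmem => ?_
    obtain ⟨t', ht', he⟩ := hh hmem
    have : t' = t := L.injective (by simpa using he)
    subst this
    exact absurd (ht' i) (not_le.2 hi)
  refine ⟨hpt, ?_⟩
  obtain ⟨k, β, hβ, hbd⟩ := exists_sampling_bound L v (fourierT g) χ₀
  have happ : ∀ n x, compSubConstCLM ℂ (-y n) h x = h (x + y n) := fun n x => by
    change h (x - -y n) = _
    rw [sub_neg_eq_add]
  refine hasSum_toT hgh (fun x => by simpa only [happ] using hpt x) (k := k)
    (hβ.mul_left (‖((|(L : E d →L[ℝ] E d).det|⁻¹ : ℝ) : ℂ) * κ⁻¹‖ * (2 ^ k * sNorm k h)))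
    fun n x => ?_
  rw [happ, hterm, mul_assoc, norm_mul]
  calc _ ≤ ‖((|(L : E d →L[ℝ] E d).det|⁻¹ : ℝ) : ℂ) * κ⁻¹‖ *
        (2 ^ k * sNorm k h * (1 + ‖x‖) ^ k * β n) :=
        mul_le_mul_of_nonneg_left (hbd _ _ (norm_le_sNorm k h) x n) (norm_nonneg _)
    _ = _ := by ring

end MatrixMaps

/-! ### Anisotropic dilations and the anisotropic norm -/

section Anisotropic

variable {d : ℕ} {α : Fin d → ℝ}

theorem norm_diagonal_le {w : Fin d → ℝ} {r : ℝ} (hr : 0 ≤ r) (h : ∀ i, |w i| ≤ r) (x : E d) :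
    ‖Matrix.toEuclideanLin (Matrix.diagonal w) x‖ ≤ r * ‖x‖ := by
  rw [EuclideanSpace.norm_eq, EuclideanSpace.norm_eq, ← Real.sqrt_sq hr, ← Real.sqrt_mul (by positivity),
    Finset.mul_sum]
  refine Real.sqrt_le_sqrt (Finset.sum_le_sum fun i _ => ?_)
  rw [← mul_pow, Real.norm_eq_abs, Real.norm_eq_abs]
  refine pow_le_pow_left₀ (abs_nonneg _) ?_ 2
  have : Matrix.toEuclideanLin (Matrix.diagonal w) x i = w i * x i := by
    simp [Matrix.toLpLin_apply, Matrix.mulVec_diagonal]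
  rw [this, abs_mul]
  exact mul_le_mul_of_nonneg_right (h i) (abs_nonneg _)

theorem aniDilation_inv (α : Fin d → ℝ) {t : ℝ} (ht : 0 < t) :
    (aniDilation α t)⁻¹ = aniDilation α (1 / t) := by
  refine Matrix.inv_eq_right_inv ?_
  rw [aniDilation, aniDilation, Matrix.diagonal_mul_diagonal, ← Matrix.diagonal_one]
  congr 1
  ext i
  rw [one_div, Real.inv_rpow ht.le, mul_inv_cancel₀ (Real.rpow_pos_of_pos ht _).ne']

theorem det_aniDilation (hα : IsAnisotropy α) {t : ℝ} (ht : 0 < t) :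
    (aniDilation α t).det = t ^ d := by
  rw [aniDilation, Matrix.det_diagonal, ← Real.rpow_sum_of_pos ht, hα.2, Real.rpow_natCast]

theorem aniDilation_apply (t : ℝ) (x : E d) (i : Fin d) :
    Matrix.toEuclideanLin (aniDilation α t) x i = t ^ α i * x i := by
  simp [Matrix.toLpLin_apply, Matrix.mulVec_diagonal, aniDilation]

theorem aniDilation_one_div_apply {t : ℝ} (ht : 0 < t) (x : E d) :
    Matrix.toEuclideanLin (aniDilation α t) (Matrix.toEuclideanLin (aniDilation α (1 / t)) x) =
      x := by
  ext i
  rw [aniDilation_apply, aniDilation_apply, one_div, Real.inv_rpow ht.le,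
    mul_inv_cancel_left₀ (Real.rpow_pos_of_pos ht _).ne']

theorem aniDilation_apply_one_div {t : ℝ} (ht : 0 < t) (x : E d) :
    Matrix.toEuclideanLin (aniDilation α (1 / t)) (Matrix.toEuclideanLin (aniDilation α t) x) =
      x := by
  have h := aniDilation_one_div_apply (α := α) (t := 1 / t) (by positivity) x
  rwa [one_div_one_div] at h

/-- The quantity `t + 1/t`, which measures how far `t > 0` is from `0` and `∞`. -/
noncomputable def ecc (t : ℝ) : ℝ := t + t⁻¹

theorem le_ecc {t : ℝ} (ht : 0 < t) : t ≤ ecc t := by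
  have : 0 < t⁻¹ := by positivity
  rw [ecc]; linarith

theorem inv_le_ecc {t : ℝ} (ht : 0 < t) : t⁻¹ ≤ ecc t := by rw [ecc]; linarith

theorem one_le_ecc {t : ℝ} (ht : 0 < t) : 1 ≤ ecc t := by
  rcases le_total 1 t with h | h
  · exact h.trans (le_ecc ht)
  · exact (one_le_inv₀ ht |>.2 h).trans (inv_le_ecc ht)

theorem ecc_inv (t : ℝ) : ecc t⁻¹ = ecc t := by rw [ecc, ecc, inv_inv, add_comm]

theorem rpow_le_ecc_pow {t p : ℝ} (ht : 0 < t) {c : ℕ} (hp : |p| ≤ c) : t ^ p ≤ ecc t ^ c := by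
  have h1 := one_le_ecc ht
  rw [← Real.rpow_natCast]
  rcases le_total 0 p with h | h
  · rw [abs_of_nonneg h] at hp
    exact (Real.rpow_le_rpow ht.le (le_ecc ht) h).trans (Real.rpow_le_rpow_of_exponent_le h1 hp)
  · rw [abs_of_nonpos h] at hp
    have : t ^ p = t⁻¹ ^ (-p) := by rw [Real.inv_rpow ht.le, Real.rpow_neg ht.le, inv_inv]
    rw [this]
    exact (Real.rpow_le_rpow (by positivity) (inv_le_ecc ht) (by linarith)).trans
      (Real.rpow_le_rpow_of_exponent_le h1 hp)

/-- Bounds for the exponents of an anisotropy and their reciprocals. -/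
theorem exists_anisotropy_bounds (hα : IsAnisotropy α) :
    ∃ m > 0, (∀ i, m ≤ α i) ∧ ∃ c : ℕ, 1 ≤ c ∧ (∀ i, |α i| ≤ c) ∧ m⁻¹ ≤ c := by
  obtain ⟨m, hm, hm'⟩ : ∃ m > 0, ∀ i, m ≤ α i := by
    rcases isEmpty_or_nonempty (Fin d) with h | h
    · exact ⟨1, one_pos, fun i => h.elim i⟩
    · obtain ⟨i, hi⟩ := Finite.exists_min α
      exact ⟨α i, hα.1 i, hi⟩
  obtain ⟨c, hc⟩ := exists_nat_ge (max d m⁻¹ : ℝ)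
  refine ⟨m, hm, hm', c + 1, by omega, fun i => ?_, ?_⟩
  · rw [abs_of_pos (hα.1 i)]
    have h1 : α i ≤ ∑ i, α i :=
      Finset.single_le_sum (fun i _ => (hα.1 i).le) (Finset.mem_univ i)
    rw [hα.2] at h1
    push_cast
    linarith [le_max_left (d : ℝ) m⁻¹]
  · push_cast
    linarith [le_max_right (d : ℝ) m⁻¹]

theorem norm_aniDilation_le {c : ℕ} (hc : ∀ i, |α i| ≤ c) {t : ℝ} (ht : 0 < t) (x : E d) :
    ‖Matrix.toEuclideanLin (aniDilation α t) x‖ ≤ ecc t ^ c * ‖x‖ := by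
  have := one_le_ecc ht
  refine norm_diagonal_le (by positivity) (fun i => ?_) x
  rw [abs_of_pos (Real.rpow_pos_of_pos ht _)]
  exact rpow_le_ecc_pow ht (hc i)

theorem norm_aniDilation_le_of_le_one {m : ℝ} (hm : ∀ i, m ≤ α i) {t : ℝ} (ht : 0 < t)
    (ht1 : t ≤ 1) (x : E d) : ‖Matrix.toEuclideanLin (aniDilation α t) x‖ ≤ t ^ m * ‖x‖ := by
  refine norm_diagonal_le (by positivity) (fun i => ?_) x
  rw [abs_of_pos (Real.rpow_pos_of_pos ht _)]
  exact Real.rpow_le_rpow_of_exponent_ge ht ht1 (hm i)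

theorem le_norm_aniDilation_of_one_le {m : ℝ} (hm : ∀ i, m ≤ α i) {t : ℝ} (ht : 1 ≤ t) (x : E d) :
    t ^ m * ‖x‖ ≤ ‖Matrix.toEuclideanLin (aniDilation α t) x‖ := by
  have ht0 : 0 < t := one_pos.trans_le ht
  have h := norm_aniDilation_le_of_le_one hm (t := 1 / t) (by positivity)
    (by rw [div_le_one ht0]; exact ht) (Matrix.toEuclideanLin (aniDilation α t) x)
  rw [aniDilation_apply_one_div ht0, one_div, Real.inv_rpow ht0.le] at h
  rwa [← div_eq_inv_mul, le_div_iff₀' (by positivity)] at h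

theorem strictAnti_norm_aniDilation (hα : IsAnisotropy α) {ξ : E d} (hξ : ξ ≠ 0) :
    StrictAntiOn (fun t => ‖Matrix.toEuclideanLin (aniDilation α (1 / t)) ξ‖) (Set.Ioi 0) := by
  intro s hs t ht hst
  obtain ⟨m, hm, hm', -⟩ := exists_anisotropy_bounds hα
  rw [Set.mem_Ioi] at hs ht
  have h : Matrix.toEuclideanLin (aniDilation α (1 / t)) ξ =
      Matrix.toEuclideanLin (aniDilation α (s / t))
        (Matrix.toEuclideanLin (aniDilation α (1 / s)) ξ) := by
    ext i
    rw [aniDilation_apply, aniDilation_apply, aniDilation_apply, ← mul_assoc,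
      ← Real.mul_rpow (by positivity) (by positivity)]
    congr 2
    field_simp
  have h0 : 0 < ‖Matrix.toEuclideanLin (aniDilation α (1 / s)) ξ‖ := by
    rw [norm_pos_iff]
    intro h0
    apply hξ
    rw [← aniDilation_one_div_apply (α := α) hs ξ, h0, map_zero]
  have hst' : s / t < 1 := (div_lt_one ht).2 hst
  have h1 := norm_aniDilation_le_of_le_one hm' (t := s / t) (by positivity) hst'.le
    (Matrix.toEuclideanLin (aniDilation α (1 / s)) ξ)
  dsimp only
  rw [h]
  refine h1.trans_lt ?_
  have := Real.rpow_lt_one (by positivity) hst' hm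
  nlinarith

theorem aniNorm_spec (hα : IsAnisotropy α) {ξ : E d} (hξ : ξ ≠ 0) :
    0 < aniNorm α ξ ∧ ‖Matrix.toEuclideanLin (aniDilation α (1 / aniNorm α ξ)) ξ‖ = 1 := by
  obtain ⟨m, hm, hm', -⟩ := exists_anisotropy_bounds hα
  have hξ0 : 0 < ‖ξ‖ := norm_pos_iff.2 hξ
  have hcont : ContinuousOn (fun t => ‖Matrix.toEuclideanLin (aniDilation α (1 / t)) ξ‖)
      (Set.Ioi 0) := by
    have : (fun t => ‖Matrix.toEuclideanLin (aniDilation α (1 / t)) ξ‖) =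
        fun t => √(∑ i, ‖(1 / t) ^ α i * ξ i‖ ^ 2) := by
      ext t
      rw [EuclideanSpace.norm_eq]
      simp only [aniDilation_apply]
    rw [this]
    refine (continuousOn_finsetSum _ fun i _ => ContinuousOn.pow (ContinuousOn.norm
      (ContinuousOn.mul (ContinuousOn.rpow_const ?_ ?_) continuousOn_const)) 2).sqrt
    · exact continuousOn_const.div continuousOn_id fun t ht => (Set.mem_Ioi.1 ht).ne'
    · intro t ht
      exact Or.inr (hα.1 i).le
  set t₁ : ℝ := min 1 (‖ξ‖ ^ m⁻¹)
  set t₂ : ℝ := max 1 (‖ξ‖ ^ m⁻¹)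
  have ht₁ : 0 < t₁ := by positivity
  have h1 : 1 ≤ ‖Matrix.toEuclideanLin (aniDilation α (1 / t₁)) ξ‖ := by
    refine le_trans ?_ (le_norm_aniDilation_of_one_le hm' (t := 1 / t₁) ?_ ξ)
    · have : t₁ ^ m ≤ ‖ξ‖ := by
        calc t₁ ^ m ≤ (‖ξ‖ ^ m⁻¹) ^ m :=
              Real.rpow_le_rpow ht₁.le (min_le_right _ _) hm.le
          _ = ‖ξ‖ := Real.rpow_inv_rpow hξ0.le hm.ne'
      rw [one_div, Real.inv_rpow ht₁.le, ← div_eq_inv_mul, one_le_div (by positivity)]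
      exact this
    · rw [one_le_div ht₁]
      exact min_le_left _ _
  have h2 : ‖Matrix.toEuclideanLin (aniDilation α (1 / t₂)) ξ‖ ≤ 1 := by
    refine (norm_aniDilation_le_of_le_one hm' (t := 1 / t₂) (by positivity) ?_ ξ).trans ?_
    · rw [div_le_one (by positivity)]
      exact le_max_left _ _
    · have : ‖ξ‖ ≤ t₂ ^ m := by
        calc ‖ξ‖ = (‖ξ‖ ^ m⁻¹) ^ m := (Real.rpow_inv_rpow hξ0.le hm.ne').symm
          _ ≤ _ := Real.rpow_le_rpow (by positivity) (le_max_right _ _) hm.le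
      rw [one_div, Real.inv_rpow (by positivity), ← div_eq_inv_mul, div_le_one (by positivity)]
      exact this
  have hle : t₁ ≤ t₂ := (min_le_left _ _).trans (le_max_left _ _)
  obtain ⟨t, ht, ht'⟩ := intermediate_value_Icc' hle
    (hcont.mono fun t ht => ht₁.trans_le ht.1) ⟨h2, h1⟩
  have ht0 : 0 < t := ht₁.trans_le ht.1
  have hset : {t : ℝ | 0 < t ∧ ‖Matrix.toEuclideanLin (aniDilation α (1 / t)) ξ‖ = 1} = {t} := by
    ext s
    refine ⟨fun hs => ?_, ?_⟩
    · exact (strictAnti_norm_aniDilation hα hξ).injOn hs.1 ht0 (hs.2.trans ht'.symm)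
    · rintro rfl
      exact ⟨ht0, ht'⟩
  rw [aniNorm, hset, csInf_singleton]
  exact ⟨ht0, ht'⟩

theorem aniNorm_zero (α : Fin d → ℝ) : aniNorm α (0 : E d) = 0 := by
  simp [aniNorm]

theorem norm_le_ecc_aniNorm_pow (hα : IsAnisotropy α) {c : ℕ} (hc : ∀ i, |α i| ≤ c) {ξ : E d}
    (hξ : ξ ≠ 0) : ‖ξ‖ ≤ ecc (aniNorm α ξ) ^ c := by
  obtain ⟨h0, h1⟩ := aniNorm_spec hα hξ
  have h := norm_aniDilation_le hc h0 (Matrix.toEuclideanLin (aniDilation α (1 / aniNorm α ξ)) ξ)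
  rwa [aniDilation_one_div_apply h0, h1, mul_one] at h

/-- Elements of a small ball are small in the Euclidean norm. -/
theorem norm_le_rpow_of_aniNorm_le (hα : IsAnisotropy α) {m : ℝ} (hm : 0 < m)
    (hm' : ∀ i, m ≤ α i) {ξ : E d} {r : ℝ} (h : aniNorm α ξ ≤ r) (hr0 : 0 < r) (hr : r ≤ 1) :
    ‖ξ‖ ≤ r ^ m := by
  rcases eq_or_ne ξ 0 with rfl | hξ
  · rw [norm_zero]; positivity
  obtain ⟨h0, h1⟩ := aniNorm_spec hα hξ
  have h2 := norm_aniDilation_le_of_le_one hm' h0 (h.trans hr)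
    (Matrix.toEuclideanLin (aniDilation α (1 / aniNorm α ξ)) ξ)
  rw [aniDilation_one_div_apply h0, h1, mul_one] at h2
  exact h2.trans (Real.rpow_le_rpow h0.le h hm.le)

/-- Elements of a large ball are bounded by a power of the radius in the Euclidean norm. -/
theorem norm_le_pow_of_aniNorm_le (hα : IsAnisotropy α) {c : ℕ} (hc : ∀ i, |α i| ≤ c) {ξ : E d}
    {r : ℝ} (h : aniNorm α ξ ≤ r) (hr : 1 ≤ r) : ‖ξ‖ ≤ r ^ c := by
  rcases eq_or_ne ξ 0 with rfl | hξ
  · rw [norm_zero]; positivity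
  obtain ⟨h0, h1⟩ := aniNorm_spec hα hξ
  have h2 : ‖Matrix.toEuclideanLin (aniDilation α (aniNorm α ξ))
      (Matrix.toEuclideanLin (aniDilation α (1 / aniNorm α ξ)) ξ)‖ ≤
      r ^ c * ‖Matrix.toEuclideanLin (aniDilation α (1 / aniNorm α ξ)) ξ‖ := by
    refine norm_diagonal_le (by positivity) (fun i => ?_) _
    rw [abs_of_pos (Real.rpow_pos_of_pos h0 _), ← Real.rpow_natCast]
    have hi := hc i
    rw [abs_of_pos (hα.1 i)] at hi
    exact (Real.rpow_le_rpow h0.le h (hα.1 i).le).trans (Real.rpow_le_rpow_of_exponent_le hr hi)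
  rwa [aniDilation_one_div_apply h0, h1, mul_one] at h2

theorem aniNorm_le_pow (hα : IsAnisotropy α) {m : ℝ} (hm : 0 < m)
    (hm' : ∀ i, m ≤ α i) {c : ℕ} (hc : m⁻¹ ≤ c) {ξ : E d} {r : ℝ} (h : ‖ξ‖ ≤ r) (hr : 1 ≤ r) :
    aniNorm α ξ ≤ r ^ c := by
  rcases eq_or_ne ξ 0 with rfl | hξ
  · rw [aniNorm_zero]; positivity
  rcases le_total (aniNorm α ξ) 1 with h1 | h1
  · exact h1.trans (one_le_pow₀ hr)
  obtain ⟨h0, h2⟩ := aniNorm_spec hα hξ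
  have h3 := le_norm_aniDilation_of_one_le hm' h1
    (Matrix.toEuclideanLin (aniDilation α (1 / aniNorm α ξ)) ξ)
  rw [aniDilation_one_div_apply h0, h2, mul_one] at h3
  calc aniNorm α ξ = (aniNorm α ξ ^ m) ^ m⁻¹ := (Real.rpow_rpow_inv h0.le hm.ne').symm
    _ ≤ r ^ m⁻¹ := Real.rpow_le_rpow (by positivity) (h3.trans h) (by positivity)
    _ ≤ r ^ (c : ℝ) := Real.rpow_le_rpow_of_exponent_le hr hc
    _ = r ^ c := Real.rpow_natCast _ _

end Anisotropic

/-! ### Geometry of the covering -/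

section Covering

variable {d : ℕ}

theorem norm_le_sum_abs (y : E d) : ‖y‖ ≤ ∑ i, |y i| := by
  have h2 : y = ∑ i, y i • (EuclideanSpace.basisFun (Fin d) ℝ i) := by
    ext k
    simp [Finset.sum_apply, EuclideanSpace.basisFun_apply, Pi.single_apply]
  calc ‖y‖ = ‖∑ i, y i • (EuclideanSpace.basisFun (Fin d) ℝ i)‖ := by rw [← h2]
    _ ≤ ∑ i, ‖y i • (EuclideanSpace.basisFun (Fin d) ℝ i)‖ := norm_sum_le _ _
    _ = _ := by simp [norm_smul]

theorem norm_toEuclideanLin_le {M : Matrix (Fin d) (Fin d) ℝ} {K : ℝ} (h : ∀ r s, |M r s| ≤ K)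
    (x : E d) : ‖Matrix.toEuclideanLin M x‖ ≤ d * (d * K) * ‖x‖ := by
  have h2 : ∀ i, |Matrix.toEuclideanLin M x i| ≤ d * K * ‖x‖ := by
    intro i
    have h3 : Matrix.toEuclideanLin M x i = ∑ k, M i k * x k := by
      simp [Matrix.toLpLin_apply, Matrix.mulVec, dotProduct]
    rw [h3]
    calc |∑ k, M i k * x k| ≤ ∑ k, |M i k * x k| := Finset.abs_sum_le_sum_abs _ _
      _ ≤ ∑ _k : Fin d, K * ‖x‖ := by
        refine Finset.sum_le_sum fun k _ => ?_
        rw [abs_mul]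
        exact mul_le_mul (h i k) (by simpa using PiLp.norm_apply_le x k) (abs_nonneg _)
          ((abs_nonneg _).trans (h i k))
      _ = _ := by simp; ring
  calc _ ≤ ∑ i, |Matrix.toEuclideanLin M x i| := norm_le_sum_abs _
    _ ≤ ∑ _i : Fin d, d * K * ‖x‖ := Finset.sum_le_sum fun i _ => h2 i
    _ = _ := by simp; ring

variable {J : Type*} {A : J → Matrix (Fin d) (Fin d) ℝ} {b : J → E d} {P Q : Set (E d)}

theorem ne_zero_of_mem_image (hcov : IsStructuredCovering A b P Q) {j : J} {z : E d}
    (hz : z ∈ affMap (A j) (b j) '' Q) : z ≠ 0 := by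
  have h := hcov.covering_Q.2.1
  have : z ∈ ⋃ j, affMap (A j) (b j) '' Q := Set.mem_iUnion.2 ⟨j, hz⟩
  rw [h] at this
  exact this

/-- The covering sets stay away from the origin, at the scale given by their linear parts: if
`z` is covered by `T_i(P)`, the origin has a fixed positive distance from `T_i⁻¹ z`, because
it is not covered by `T_i(Q)`. -/
theorem exists_le_norm_inv_apply (hcov : IsStructuredCovering A b P Q) :
    ∃ η > 0, ∀ j, ∀ z ∈ affMap (A j) (b j) '' Q, η ≤ ‖Matrix.toEuclideanLin (A j)⁻¹ z‖ := by
  obtain ⟨K, hK⟩ := hcov.compat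
  have hPc : IsCompact (closure P) :=
    Metric.isCompact_of_isClosed_isBounded isClosed_closure
      (hcov.bounded_Q.subset hcov.closure_subset)
  obtain ⟨η, hη, hη'⟩ := hPc.exists_thickening_subset_open hcov.isOpen_Q hcov.closure_subset
  set D : ℝ := d * (d * max K 0) + 1
  have hD : 0 < D := by positivity
  refine ⟨η / D, by positivity, fun j z hz => ?_⟩
  have hz0 : z ∈ ⋃ i, affMap (A i) (b i) '' P := by
    rw [hcov.covering_P.2.1]
    exact ne_zero_of_mem_image hcov hz
  obtain ⟨i, p, hp, hpz⟩ := Set.mem_iUnion.1 hz0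
  have hunit := hcov.invertible i
  set q : E d := -Matrix.toEuclideanLin (A i)⁻¹ (b i) with hq
  have hq0 : affMap (A i) (b i) q = 0 := by
    rw [affMap, hq, map_neg, toEuclideanLin_apply_inv hunit, neg_add_cancel]
  have hqQ : q ∉ Q := fun h => ne_zero_of_mem_image hcov ⟨q, h, hq0⟩ rfl
  have hdist : η ≤ ‖p - q‖ := by
    by_contra hlt
    push Not at hlt
    refine hqQ (hη' (Metric.mem_thickening_iff.2 ⟨p, subset_closure hp, ?_⟩))
    rwa [dist_comm, dist_eq_norm]
  have h1 : Matrix.toEuclideanLin (A i)⁻¹ z = p - q := by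
    rw [← hpz, affMap, map_add, toEuclideanLin_inv_apply hunit, hq, sub_neg_eq_add]
  have h2 : Matrix.toEuclideanLin (A i)⁻¹ z =
      Matrix.toEuclideanLin ((A i)⁻¹ * A j) (Matrix.toEuclideanLin (A j)⁻¹ z) := by
    rw [Matrix.toLpLin_mul_same, LinearMap.comp_apply, toEuclideanLin_apply_inv (hcov.invertible j)]
  have h3 := norm_toEuclideanLin_le (fun r s => (hK j i
    ⟨z, hz, p, hcov.closure_subset (subset_closure hp), hpz⟩ r s).trans (le_max_left K 0))
    (Matrix.toEuclideanLin (A j)⁻¹ z)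
  rw [← h2, h1] at h3
  rw [div_le_iff₀ hD]
  have := norm_nonneg (Matrix.toEuclideanLin (A j)⁻¹ z)
  calc η ≤ _ := hdist.trans h3
    _ ≤ _ := by rw [mul_comm]; gcongr; simp [D]

/-- In a covering with bounded overlap, the measures of the sets are summable with respect to a
finite measure. -/
theorem summable_of_le_lintegral {S : J → Set (E d)} (hS : IsAdmissibleCovering S) {f : J → ℝ}
    (hf0 : ∀ j, 0 ≤ f j)
    (hf : ∀ j, ENNReal.ofReal (f j) ≤ ∫⁻ x in S j, ENNReal.ofReal ((1 + ‖x‖) ^ (d + 1))⁻¹)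
    [Countable J] : Summable f := by
  obtain ⟨hmeas, -, N, hN⟩ := hS
  set F : E d → ENNReal := fun x => ENNReal.ofReal ((1 + ‖x‖) ^ (d + 1))⁻¹
  have hF : ∫⁻ x, F x ≠ ⊤ := by
    have h := (integrable_inv_one_add_norm_pow (d := d)).2
    rw [hasFiniteIntegral_iff_norm] at h
    refine ne_top_of_le_ne_top h.ne (lintegral_mono fun x => ENNReal.ofReal_le_ofReal ?_)
    exact Real.le_norm_self _
  have hFm : Measurable F := by fun_prop
  have hcount : ∀ x, ∑' j, (S j).indicator F x ≤ N * F x := by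
    classical
    intro x
    refine ENNReal.summable.tsum_le_of_sum_le fun s => ?_
    have h1 : ∑ j ∈ s, (S j).indicator F x = ∑ j ∈ s with x ∈ S j, F x := by
      rw [Finset.sum_filter]
      exact Finset.sum_congr rfl fun j _ => by rw [Set.indicator_apply]
    rw [h1, Finset.sum_const, nsmul_eq_mul]
    gcongr
    rcases (s.filter fun j => x ∈ S j).eq_empty_or_nonempty with h | ⟨j₀, hj₀⟩
    · rw [h]; simp
    · have h2 : ((s.filter fun j => x ∈ S j : Finset J) : Set J) ⊆
          {i | (S i ∩ S j₀).Nonempty} := fun i hi =>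
        ⟨x, (Finset.mem_filter.1 hi).2, (Finset.mem_filter.1 hj₀).2⟩
      have h3 := (Set.encard_le_encard h2).trans (hN j₀)
      rw [Set.encard_coe_eq_coe_finsetCard] at h3
      exact_mod_cast h3
  have htotal : ∑' j, ENNReal.ofReal (f j) ≠ ⊤ := by
    refine ne_top_of_le_ne_top (ENNReal.mul_ne_top (ENNReal.natCast_ne_top N) hF) ?_
    calc ∑' j, ENNReal.ofReal (f j) ≤ ∑' j, ∫⁻ x in S j, F x := ENNReal.tsum_le_tsum hf
      _ = ∑' j, ∫⁻ x, (S j).indicator F x := by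
        congr 1; ext j; rw [lintegral_indicator (hmeas j)]
      _ = ∫⁻ x, ∑' j, (S j).indicator F x :=
        (lintegral_tsum fun j => (hFm.indicator (hmeas j)).aemeasurable).symm
      _ ≤ ∫⁻ x, N * F x := lintegral_mono hcount
      _ = N * ∫⁻ x, F x := lintegral_const_mul _ hFm
  have := ENNReal.summable_toReal htotal
  simpa only [ENNReal.toReal_ofReal (hf0 _)] using this

theorem volume_affMap_image {M : Matrix (Fin d) (Fin d) ℝ} (v : E d) (S : Set (E d)) :
    volume (affMap M v '' S) = ENNReal.ofReal |M.det| * volume S := by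
  have h1 : affMap M v '' S = (fun x => x + v) '' (Matrix.toEuclideanLin M '' S) := by
    rw [Set.image_image]; rfl
  rw [h1, Set.image_add_right, measure_preimage_add_right, Measure.addHaar_image_linearMap,
    LinearMap.det_toLpLin]

end Covering

section Weight

variable {d : ℕ}

/-- A weight `μ` which controls the geometry of a covering `T_j(Q)` polynomially: the size of the
linear parts and of their inverses, and the position of `T_j(Q)` relative to `0` and `∞`. -/
structure IsPolyWeight {J : Type*} (A : J → Matrix (Fin d) (Fin d) ℝ) (b : J → E d)
    (Q : Set (E d)) (μ : J → ℝ) : Prop where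
  one_le : ∀ j, 1 ≤ μ j
  exists_bound : ∃ (C : ℝ) (c : ℕ), 1 ≤ C ∧ ∀ j,
    (∀ x, ‖Matrix.toEuclideanLin (A j) x‖ ≤ C * μ j ^ c * ‖x‖) ∧
    (∀ x, ‖Matrix.toEuclideanLin (A j)⁻¹ x‖ ≤ C * μ j ^ c * ‖x‖) ∧
    ∀ ξ ∈ affMap (A j) (b j) '' Q, ‖ξ‖ ≤ C * μ j ^ c ∧ μ j ≤ C * ecc ‖ξ‖ ^ c
  summable : ∃ p : ℕ, Summable fun j => (μ j ^ p)⁻¹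

theorem exists_le_hybridRegulation {α : Fin d → ℝ} (hα : IsAnisotropy α) {ht : E d → ℝ}
    (hreg : IsHybridRegulation α ht) :
    ∃ c > 0, ∃ n : ℕ, ∀ ξ, ξ ≠ 0 → c * min 1 (aniNorm α ξ) ^ n ≤ ht ξ := by
  obtain ⟨ρ, h₁, h₂, -, hρ, hρ1, hρ0, -, -, ⟨c₀, hc₀, _, _, r, hr, hb₁⟩,
    ⟨c₂, hc₂, _, _, hb₂⟩, heq⟩ := hreg
  obtain ⟨n, hn⟩ := exists_nat_ge r
  refine ⟨min c₀ c₂, lt_min hc₀ hc₂, n, fun ξ hξ => ?_⟩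
  obtain ⟨hs, -⟩ := aniNorm_spec hα hξ
  set s := aniNorm α ξ
  have hmin0 : 0 < min 1 s := lt_min one_pos hs
  have hpow : min 1 s ^ n ≤ 1 := pow_le_one₀ hmin0.le (min_le_left _ _)
  have hpos : 0 < min 1 s ^ n := by positivity
  have hsr : min 1 s ^ n ≤ s ^ r := by
    calc min 1 s ^ n = min 1 s ^ (n : ℝ) := (Real.rpow_natCast _ _).symm
      _ ≤ min 1 s ^ r := Real.rpow_le_rpow_of_exponent_ge hmin0 (min_le_left _ _) hn
      _ ≤ s ^ r := Real.rpow_le_rpow hmin0.le (min_le_right _ _) (by linarith)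
  have hl := min_le_left c₀ c₂
  have hl' := min_le_right c₀ c₂
  have hl0 : 0 < min c₀ c₂ := lt_min hc₀ hc₂
  have hA : s ≤ 4 / 3 → min c₀ c₂ * min 1 s ^ n ≤ h₁ ξ := fun h => by
    refine le_trans ?_ (hb₁ ξ hξ h).1
    exact mul_le_mul hl hsr hpos.le hc₀.le
  have hB : 2 / 3 ≤ s → min c₀ c₂ * min 1 s ^ n ≤ h₂ ξ := fun h => by
    refine le_trans ?_ (hb₂ ξ h).1
    nlinarith
  rw [heq ξ hξ]
  obtain ⟨hρ_0, hρ_1⟩ := hρ ξ hξ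
  rcases le_total s (2 / 3) with h | h
  · rw [hρ1 ξ hξ h]
    have := hA (by linarith)
    linarith
  rcases le_total (4 / 3) s with h' | h'
  · rw [hρ0 ξ h']
    have := hB h
    linarith
  · nlinarith [hA h', hB h]

theorem aniNorm_neg (α : Fin d → ℝ) (ξ : E d) : aniNorm α (-ξ) = aniNorm α ξ := by
  simp [aniNorm]


theorem mem_aniBall_self (α : Fin d → ℝ) (ξ : E d) {r : ℝ} (hr : 0 < r) : ξ ∈ aniBall α ξ r := by
  change aniNorm α (ξ - ξ) < r
  rwa [sub_self, aniNorm_zero]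

theorem inv_ecc_pow_le_min_pow {s : ℝ} (hs : 0 < s) (n : ℕ) : (ecc s ^ n)⁻¹ ≤ min 1 s ^ n := by
  have h1 := one_le_ecc hs
  rw [← inv_pow]
  refine pow_le_pow_left₀ (by positivity) (le_min (inv_le_one_of_one_le₀ h1) ?_) n
  rw [inv_le_comm₀ (by positivity) hs]
  exact inv_le_ecc hs

variable {α : Fin d → ℝ} {ht : E d → ℝ} {δ κ : ℝ} {A : ℤ → Matrix (Fin d) (Fin d) ℝ}
  {b : ℤ → E d} {P Q : Set (E d)} {ξ₀ : ℤ → E d}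

/-- The radii are bounded above by the distances of the centres from the origin, since the covering
sets do not contain the origin, and below by the lower bounds for regulation functions. -/
theorem exists_radius_bounds (hα : IsAnisotropy α) (hreg : IsHybridRegulation α ht) (hδ : 0 < δ)
    (hcov : IsStructuredCovering A b P Q) (hξ₀ : ∀ j, ξ₀ j ≠ 0)
    (hball : ∀ j, affMap (A j) (b j) '' Q = aniBall α (ξ₀ j) (κ * (δ * ht (ξ₀ j)))) :
    ∃ c > 0, ∃ n : ℕ, ∀ j, 0 < δ * ht (ξ₀ j) ∧
      κ * (δ * ht (ξ₀ j)) ≤ aniNorm α (ξ₀ j) ∧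
      c * min 1 (aniNorm α (ξ₀ j)) ^ n ≤ δ * ht (ξ₀ j) := by
  obtain ⟨c, hc, n, h⟩ := exists_le_hybridRegulation hα hreg
  refine ⟨δ * c, by positivity, n, fun j => ?_⟩
  have h1 := h _ (hξ₀ j)
  obtain ⟨hs, -⟩ := aniNorm_spec hα (hξ₀ j)
  have h2 : 0 < min 1 (aniNorm α (ξ₀ j)) := lt_min one_pos hs
  have h3 : 0 < ht (ξ₀ j) := lt_of_lt_of_le (by positivity) h1
  refine ⟨by positivity, ?_, by rw [mul_assoc]; gcongr⟩
  by_contra hlt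
  push Not at hlt
  have h4 : (0 : E d) ∈ aniBall α (ξ₀ j) (κ * (δ * ht (ξ₀ j))) := by
    change aniNorm α (0 - ξ₀ j) < _
    rwa [zero_sub, aniNorm_neg]
  rw [← hball] at h4
  exact ne_zero_of_mem_image hcov h4 rfl

/-- The covering sets whose centres are far from the origin avoid a neighbourhood of the origin. -/
theorem exists_le_norm_of_le_aniNorm (hα : IsAnisotropy α) (hreg : IsHybridRegulation α ht)
    (hδ : 0 < δ) (hcov : IsStructuredCovering A b P Q) (hξ₀ : ∀ j, ξ₀ j ≠ 0)
    (hA : ∀ j, A j = aniDilation α (δ * ht (ξ₀ j)))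
    (hball : ∀ j, affMap (A j) (b j) '' Q = aniBall α (ξ₀ j) (κ * (δ * ht (ξ₀ j))))
    {C : ℝ} (hC : 0 < C) :
    ∃ ε > 0, ∀ j, C ≤ aniNorm α (ξ₀ j) → ∀ z ∈ affMap (A j) (b j) '' Q, ε ≤ ‖z‖ := by
  obtain ⟨c₀, hc₀, n, hrad⟩ := exists_radius_bounds hα hreg hδ hcov hξ₀ hball
  obtain ⟨η, hη, hη'⟩ := exists_le_norm_inv_apply hcov
  obtain ⟨m, hm, hm', c, hc1, hc, -⟩ := exists_anisotropy_bounds hα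
  -- a lower bound for the radii, which is at most `1`
  set r : ℝ := min 1 (c₀ * min 1 C ^ n) with hr
  have hr0 : 0 < r := lt_min one_pos (by have : 0 < min 1 C := lt_min one_pos hC; positivity)
  have hr1 : r ≤ 1 := min_le_left _ _
  refine ⟨η * r ^ c, by positivity, fun j hj z hz => ?_⟩
  obtain ⟨hh0, -, hh1⟩ := hrad j
  have hrh : r ≤ δ * ht (ξ₀ j) := by
    refine (min_le_right _ _).trans (le_trans ?_ hh1)
    have : 0 < min 1 C := lt_min one_pos hC
    gcongr
  have h1 := hη' j z hz
  rw [hA, aniDilation_inv α hh0] at h1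
  have h2 : ‖Matrix.toEuclideanLin (aniDilation α (1 / (δ * ht (ξ₀ j)))) z‖ ≤ (r ^ c)⁻¹ * ‖z‖ := by
    refine norm_diagonal_le (by positivity) (fun i => ?_) z
    have hi := hc i
    rw [abs_of_pos (hα.1 i)] at hi
    rw [one_div, Real.inv_rpow hh0.le, abs_of_pos (by positivity), ← Real.rpow_natCast]
    refine inv_anti₀ (by positivity) ?_
    exact (Real.rpow_le_rpow_of_exponent_ge hr0 hr1 hi).trans
      (Real.rpow_le_rpow hr0.le hrh (hα.1 i).le)
  have h3 := h1.trans h2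
  rwa [inv_mul_eq_div, le_div_iff₀ (by positivity)] at h3

/-- The position of a point of a covering set controls the position of the centre. -/
theorem exists_ecc_aniNorm_le (hα : IsAnisotropy α) (hreg : IsHybridRegulation α ht)
    (hδ : 0 < δ) (hcov : IsStructuredCovering A b P Q) (hξ₀ : ∀ j, ξ₀ j ≠ 0)
    (hA : ∀ j, A j = aniDilation α (δ * ht (ξ₀ j)))
    (hball : ∀ j, affMap (A j) (b j) '' Q = aniBall α (ξ₀ j) (κ * (δ * ht (ξ₀ j)))) :
    ∃ (C : ℝ) (c : ℕ), ∀ j, ∀ z ∈ affMap (A j) (b j) '' Q,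
      ecc (aniNorm α (ξ₀ j)) ≤ C * ecc ‖z‖ ^ c := by
  obtain ⟨c₀, hc₀, n, hrad⟩ := exists_radius_bounds hα hreg hδ hcov hξ₀ hball
  obtain ⟨η, hη, hη'⟩ := exists_le_norm_inv_apply hcov
  obtain ⟨m, hm, hm', c, hc1, hc, hmc⟩ := exists_anisotropy_bounds hα
  set B : ℝ := max 1 η⁻¹
  set k : ℝ := max 1 κ
  have hB : 1 ≤ B := le_max_left _ _
  have hk : 1 ≤ k := le_max_left _ _
  refine ⟨2 * (2 * k ^ c * B ^ (c * c)) ^ c, c * c * c, fun j z hz => ?_⟩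
  obtain ⟨hh0, hh1, hh2⟩ := hrad j
  obtain ⟨hs0, -⟩ := aniNorm_spec hα (hξ₀ j)
  set h := δ * ht (ξ₀ j)
  set s := aniNorm α (ξ₀ j)
  have hz0 : 0 < ‖z‖ := norm_pos_iff.2 (ne_zero_of_mem_image hcov hz)
  set w := ecc ‖z‖
  have hw : 1 ≤ w := one_le_ecc hz0
  have hBw : 1 ≤ B * w := one_le_mul_of_one_le_of_one_le hB hw
  have hzball : aniNorm α (z - ξ₀ j) < κ * h := by
    rw [hball] at hz
    exact hz
  -- the radius is bounded in terms of `w`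
  have hhw : h ≤ (B * w) ^ c := by
    rcases le_total h 1 with h1 | h1
    · exact h1.trans (one_le_pow₀ hBw)
    have h2 := hη' j z hz
    rw [hA, aniDilation_inv α hh0] at h2
    have h3 := h2.trans (norm_aniDilation_le_of_le_one hm' (t := 1 / h) (by positivity)
      (by rw [div_le_one hh0]; exact h1) z)
    rw [one_div, Real.inv_rpow hh0.le, inv_mul_eq_div, le_div_iff₀ (by positivity)] at h3
    have h4 : h ^ m ≤ B * w := by
      calc h ^ m = η⁻¹ * (η * h ^ m) := by rw [inv_mul_cancel_left₀ hη.ne']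
        _ ≤ B * w := by
          gcongr
          · exact le_max_right _ _
          · exact h3.trans (le_ecc hz0)
    calc h = (h ^ m) ^ m⁻¹ := (Real.rpow_rpow_inv hh0.le hm.ne').symm
      _ ≤ (B * w) ^ m⁻¹ := Real.rpow_le_rpow (by positivity) h4 (by positivity)
      _ ≤ (B * w) ^ (c : ℝ) := Real.rpow_le_rpow_of_exponent_le hBw hmc
      _ = (B * w) ^ c := Real.rpow_natCast _ _
  set r : ℝ := k * (B * w) ^ c
  have hr : 1 ≤ r := one_le_mul_of_one_le_of_one_le hk (one_le_pow₀ hBw)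
  have hrc : 1 ≤ r ^ c := one_le_pow₀ hr
  have hwr : w ≤ r ^ c := by
    calc w ≤ B * w := le_mul_of_one_le_left (by positivity) hB
      _ ≤ (B * w) ^ c := le_self_pow₀ hBw (by omega)
      _ ≤ r := le_mul_of_one_le_left (by positivity) hk
      _ ≤ r ^ c := le_self_pow₀ hr (by omega)
  have hsub : ‖z - ξ₀ j‖ ≤ r ^ c := by
    refine norm_le_pow_of_aniNorm_le hα hc (hzball.le.trans ?_) hr
    exact mul_le_mul (le_max_right _ _) hhw hh0.le (by positivity)
  have hξj : ‖ξ₀ j‖ ≤ 2 * r ^ c := by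
    calc ‖ξ₀ j‖ = ‖z - (z - ξ₀ j)‖ := by rw [sub_sub_cancel]
      _ ≤ ‖z‖ + ‖z - ξ₀ j‖ := norm_sub_le _ _
      _ ≤ _ := by linarith [le_ecc hz0]
  have hs1 : s ≤ (2 * r ^ c) ^ c := aniNorm_le_pow hα hm hm' hmc hξj (by linarith)
  have hs2 : s⁻¹ ≤ (2 * r ^ c) ^ c := by
    rcases le_total 1 s with h1 | h1
    · exact (inv_le_one_of_one_le₀ h1).trans (one_le_pow₀ (by linarith))
    have h2 := norm_le_rpow_of_aniNorm_le hα hm hm' (ξ := ξ₀ j) le_rfl hs0 h1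
    have h3 := norm_le_rpow_of_aniNorm_le hα hm hm' (hzball.le.trans hh1) hs0 h1
    have h4 : ‖z‖ ≤ 2 * s ^ m := by
      calc ‖z‖ = ‖(z - ξ₀ j) + ξ₀ j‖ := by rw [sub_add_cancel]
        _ ≤ ‖z - ξ₀ j‖ + ‖ξ₀ j‖ := norm_add_le _ _
        _ ≤ _ := by linarith
    have h5 : (s⁻¹) ^ m ≤ 2 * r ^ c := by
      rw [Real.inv_rpow hs0.le]
      calc (s ^ m)⁻¹ ≤ 2 * ‖z‖⁻¹ := by
            rw [← div_eq_mul_inv, le_div_iff₀ hz0, inv_mul_le_iff₀ (by positivity)]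
            linarith
        _ ≤ 2 * r ^ c := by linarith [inv_le_ecc hz0]
    calc s⁻¹ = (s⁻¹ ^ m) ^ m⁻¹ := (Real.rpow_rpow_inv (by positivity) hm.ne').symm
      _ ≤ (2 * r ^ c) ^ m⁻¹ := Real.rpow_le_rpow (by positivity) h5 (by positivity)
      _ ≤ (2 * r ^ c) ^ (c : ℝ) := Real.rpow_le_rpow_of_exponent_le (by linarith) hmc
      _ = _ := Real.rpow_natCast _ _
  calc ecc s = s + s⁻¹ := rfl
    _ ≤ 2 * (2 * r ^ c) ^ c := by linarith
    _ = _ := by simp only [r]; ring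

/-- The centres of the covering sets define a polynomial weight. -/
theorem isPolyWeight (hα : IsAnisotropy α) (hreg : IsHybridRegulation α ht)
    (hδ : 0 < δ) (hκ : 0 < κ) (hcov : IsStructuredCovering A b P Q) (hξ₀ : ∀ j, ξ₀ j ≠ 0)
    (hA : ∀ j, A j = aniDilation α (δ * ht (ξ₀ j)))
    (hball : ∀ j, affMap (A j) (b j) '' Q = aniBall α (ξ₀ j) (κ * (δ * ht (ξ₀ j)))) :
    IsPolyWeight A b Q fun j => ecc (aniNorm α (ξ₀ j)) := by
  obtain ⟨c₀, hc₀, n, hrad⟩ := exists_radius_bounds hα hreg hδ hcov hξ₀ hball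
  obtain ⟨C₃, c₃, h₃⟩ := exists_ecc_aniNorm_le hα hreg hδ hcov hξ₀ hA hball
  obtain ⟨m, hm, hm', c, hc1, hc, hmc⟩ := exists_anisotropy_bounds hα
  have hs : ∀ j, 0 < aniNorm α (ξ₀ j) := fun j => (aniNorm_spec hα (hξ₀ j)).1
  have hμ : ∀ j, 1 ≤ ecc (aniNorm α (ξ₀ j)) := fun j => one_le_ecc (hs j)
  set C₁ : ℝ := κ⁻¹ + c₀⁻¹
  have hC₁ : 0 < C₁ := by positivity
  have hecc : ∀ j, ecc (δ * ht (ξ₀ j)) ≤ C₁ * ecc (aniNorm α (ξ₀ j)) ^ (n + 1) := by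
    intro j
    obtain ⟨hh0, hh1, hh2⟩ := hrad j
    have h1 := hμ j
    have h2 : δ * ht (ξ₀ j) ≤ κ⁻¹ * ecc (aniNorm α (ξ₀ j)) ^ (n + 1) := by
      rw [← div_eq_inv_mul, le_div_iff₀' hκ]
      exact (hh1.trans (le_ecc (hs j))).trans (le_self_pow₀ h1 (by omega))
    have h3 : (δ * ht (ξ₀ j))⁻¹ ≤ c₀⁻¹ * ecc (aniNorm α (ξ₀ j)) ^ (n + 1) := by
      rw [← inv_inv (ecc _ ^ (n + 1)), ← mul_inv]
      refine inv_anti₀ (by positivity) (le_trans ?_ hh2)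
      gcongr
      refine le_trans ?_ (inv_ecc_pow_le_min_pow (hs j) n)
      exact inv_anti₀ (by positivity) (pow_le_pow_right₀ h1 (by omega))
    calc _ ≤ _ := add_le_add h2 h3
      _ = _ := by ring
  have hpt : ∀ j, ∀ z ∈ affMap (A j) (b j) '' Q, ‖z‖ ≤ 2 * ecc (aniNorm α (ξ₀ j)) ^ c := by
    intro j z hz
    rw [hball] at hz
    have h1 : ‖z - ξ₀ j‖ ≤ ecc (aniNorm α (ξ₀ j)) ^ c := norm_le_pow_of_aniNorm_le hα hc
      ((le_of_lt hz).trans ((hrad j).2.1.trans (le_ecc (hs j)))) (hμ j)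
    have h2 := norm_le_ecc_aniNorm_pow hα hc (hξ₀ j)
    calc ‖z‖ = ‖(z - ξ₀ j) + ξ₀ j‖ := by rw [sub_add_cancel]
      _ ≤ ‖z - ξ₀ j‖ + ‖ξ₀ j‖ := norm_add_le _ _
      _ ≤ _ := by linarith
  refine ⟨hμ, ⟨max (max 2 C₃) (C₁ ^ c), max (max c c₃) ((n + 1) * c), ?_, fun j => ⟨?_, ?_, ?_⟩⟩, ?_⟩
  · exact le_trans one_le_two ((le_max_left _ _).trans (le_max_left _ _))
  · intro x
    rw [hA]
    have h1 := hμ j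
    refine (norm_aniDilation_le hc (hrad j).1 x).trans ?_
    gcongr
    calc _ ≤ (C₁ * ecc (aniNorm α (ξ₀ j)) ^ (n + 1)) ^ c :=
          pow_le_pow_left₀ (zero_le_one.trans (one_le_ecc (hrad j).1)) (hecc j) c
      _ = C₁ ^ c * ecc (aniNorm α (ξ₀ j)) ^ ((n + 1) * c) := by rw [mul_pow, ← pow_mul]
      _ ≤ _ := by
        gcongr
        · exact le_max_right _ _
        · exact le_max_right _ _
  · intro x
    rw [hA, aniDilation_inv α (hrad j).1]
    have h1 := hμ j
    refine (norm_aniDilation_le hc (one_div_pos.2 (hrad j).1) x).trans ?_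
    rw [one_div, ecc_inv]
    gcongr
    calc _ ≤ (C₁ * ecc (aniNorm α (ξ₀ j)) ^ (n + 1)) ^ c :=
          pow_le_pow_left₀ (zero_le_one.trans (one_le_ecc (hrad j).1)) (hecc j) c
      _ = C₁ ^ c * ecc (aniNorm α (ξ₀ j)) ^ ((n + 1) * c) := by rw [mul_pow, ← pow_mul]
      _ ≤ _ := by
        gcongr
        · exact le_max_right _ _
        · exact le_max_right _ _
  · intro z hz
    have h1 := hμ j
    have h2 : 1 ≤ ecc ‖z‖ := one_le_ecc (norm_pos_iff.2 (ne_zero_of_mem_image hcov hz))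
    constructor
    · refine (hpt j z hz).trans ?_
      gcongr
      · exact (le_max_left _ _).trans (le_max_left _ _)
      · exact (le_max_left _ _).trans (le_max_left _ _)
    · refine (h₃ j z hz).trans ?_
      gcongr
      · exact (le_max_right _ _).trans (le_max_left _ _)
      · exact (le_max_right _ _).trans (le_max_left _ _)
  -- the volume of the set of index `j` is at least a negative power of the weight
  · have hvol : volume Q ≠ 0 := by
      refine (hcov.isOpen_Q.measure_pos volume ?_).ne'
      have hmem := mem_aniBall_self α (ξ₀ 0) (mul_pos hκ (hrad 0).1)
      rw [← hball 0] at hmem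
      obtain ⟨q, hq, -⟩ := hmem
      exact ⟨q, hq⟩
    have hvol' : volume Q ≠ ⊤ := hcov.bounded_Q.measure_lt_top.ne
    set V := (volume Q).toReal
    have hV : 0 < V := ENNReal.toReal_pos hvol hvol'
    refine ⟨c * (d + 1) + (n + 1) * d, ?_⟩
    have hsum : Summable fun j : ℤ => ((3 * ecc (aniNorm α (ξ₀ j)) ^ c) ^ (d + 1))⁻¹ *
        (((C₁ * ecc (aniNorm α (ξ₀ j)) ^ (n + 1)) ^ d)⁻¹ * V) := by
      refine summable_of_le_lintegral hcov.covering_Q (fun j => ?_) fun j => ?_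
      · have := hμ j
        positivity
      · have h1 := hμ j
        obtain ⟨hh0, -, -⟩ := hrad j
        calc ENNReal.ofReal (((3 * ecc (aniNorm α (ξ₀ j)) ^ c) ^ (d + 1))⁻¹ *
              (((C₁ * ecc (aniNorm α (ξ₀ j)) ^ (n + 1)) ^ d)⁻¹ * V))
            ≤ ENNReal.ofReal ((3 * ecc (aniNorm α (ξ₀ j)) ^ c) ^ (d + 1))⁻¹ *
              volume (affMap (A j) (b j) '' Q) := by
              rw [ENNReal.ofReal_mul (by positivity), volume_affMap_image,
                ENNReal.ofReal_mul (by positivity), ENNReal.ofReal_toReal hvol']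
              gcongr
              rw [hA, det_aniDilation hα hh0, abs_of_pos (by positivity), ← inv_pow]
              refine pow_le_pow_left₀ (by positivity) ?_ d
              rw [inv_le_comm₀ (by positivity) hh0]
              exact (inv_le_ecc hh0).trans (hecc j)
          _ = ∫⁻ _x in affMap (A j) (b j) '' Q,
              ENNReal.ofReal ((3 * ecc (aniNorm α (ξ₀ j)) ^ c) ^ (d + 1))⁻¹ := by
              rw [setLIntegral_const]
          _ ≤ _ := by
              refine setLIntegral_mono' (hcov.covering_Q.1 j) fun x hx => ?_
              refine ENNReal.ofReal_le_ofReal (inv_anti₀ (by positivity) ?_)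
              refine pow_le_pow_left₀ (by positivity) ?_ _
              have := one_le_pow₀ (n := c) h1
              linarith [hpt j x hx]
    refine (hsum.mul_left (3 ^ (d + 1) * C₁ ^ d * V⁻¹)).congr fun j => ?_
    have h1 := hμ j
    rw [pow_add, mul_pow, mul_pow C₁, ← pow_mul, ← pow_mul]
    field_simp
    ring

end Weight

/-! ### Uniform estimates for a partition of unity -/

section Estimates

variable {d : ℕ}

theorem norm_iteratedFDeriv_comp_affine_le {V F : Type*} [NormedAddCommGroup V] [NormedSpace ℝ V]
    [NormedAddCommGroup F] [NormedSpace ℝ F] {f : V → F} (hf : ContDiff ℝ ∞ f) (B : V →L[ℝ] V)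
    (v x : V) (n : ℕ) : ‖iteratedFDeriv ℝ n (fun x => f (B x + v)) x‖ ≤
      ‖iteratedFDeriv ℝ n f (B x + v)‖ * ‖B‖ ^ n := by
  have h1 : ContDiff ℝ ∞ fun y => f (y + v) := hf.comp (contDiff_id.add contDiff_const)
  have h2 : (fun x => f (B x + v)) = (fun y => f (y + v)) ∘ B := rfl
  rw [h2, B.iteratedFDeriv_comp_right h1 x (i := n) (by exact_mod_cast le_top),
    iteratedFDeriv_comp_add_right]
  refine (ContinuousMultilinearMap.norm_compContinuousLinearMap_le _ _).trans ?_
  simp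

/-- A real-valued Schwartz function, regarded as complex-valued. -/
noncomputable def ofRealS (φ : 𝓢(E d, ℝ)) : 𝓢(E d, ℂ) :=
  φ.postcompCLM (𝕜 := ℝ) Complex.ofRealCLM

theorem ofRealS_apply (φ : 𝓢(E d, ℝ)) (x : E d) : ofRealS φ x = (φ x : ℂ) := rfl

theorem norm_iteratedFDeriv_ofRealS (φ : 𝓢(E d, ℝ)) (n : ℕ) (x : E d) :
    ‖iteratedFDeriv ℝ n (ofRealS φ) x‖ = ‖iteratedFDeriv ℝ n φ x‖ :=
  Complex.ofRealLI.norm_iteratedFDeriv_comp_left ((φ.smooth n).contDiffAt) le_rfl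

/-- Collecting polynomial bounds for finitely many quantities into a single one. -/
theorem exists_common_polyBound {J X : Type*} {μ : J → ℝ} (hμ : ∀ j, 1 ≤ μ j) {f : ℕ → J → X → ℝ}
    (h : ∀ l, ∃ (C : ℝ) (c : ℕ), 0 ≤ C ∧ ∀ j x, f l j x ≤ C * μ j ^ c) (m : ℕ) :
    ∃ (C : ℝ) (c : ℕ), 0 ≤ C ∧ ∀ l ≤ m, ∀ j x, f l j x ≤ C * μ j ^ c := by
  choose C c hC hb using h
  refine ⟨∑ l ∈ Finset.range (m + 1), C l, ∑ l ∈ Finset.range (m + 1), c l,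
    Finset.sum_nonneg fun l _ => hC l, fun l hl j x => (hb l j x).trans ?_⟩
  have hmem : l ∈ Finset.range (m + 1) := Finset.mem_range.2 (by omega)
  have h1 := hμ j
  gcongr
  · exact Finset.sum_nonneg fun l _ => hC l
  · exact Finset.single_le_sum (f := C) (fun i _ => hC i) hmem
  · exact Finset.single_le_sum (f := c) (fun i _ => Nat.zero_le _) hmem

/-- Vanishing of order `M` at the origin and at infinity, together with the derivatives up to
order `M`. -/
def VanishesToOrder (M : ℕ) (W : E d → ℂ) : Prop :=
  ∃ C : ℝ, ∀ k ≤ M, ∀ ξ : E d, ξ ≠ 0 →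
    ‖iteratedFDeriv ℝ k W ξ‖ * (‖ξ‖ ^ M + (‖ξ‖ ^ M)⁻¹) ≤ C

theorem VanishesToOrder.exists_le_inv_ecc_pow {M : ℕ} {W : E d → ℂ} (hW : VanishesToOrder M W) :
    ∃ K : ℝ, 0 ≤ K ∧ ∀ k ≤ M, ∀ ξ : E d, ξ ≠ 0 →
      ‖iteratedFDeriv ℝ k W ξ‖ ≤ K * (ecc ‖ξ‖ ^ M)⁻¹ := by
  obtain ⟨C, hC⟩ := hW
  refine ⟨2 ^ M * max C 0, by positivity, fun k hk ξ hξ => ?_⟩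
  have h0 : 0 < ‖ξ‖ := norm_pos_iff.2 hξ
  have h1 := one_le_ecc h0
  have h2 : ecc ‖ξ‖ ^ M ≤ 2 ^ M * (‖ξ‖ ^ M + (‖ξ‖ ^ M)⁻¹) := by
    rw [← inv_pow]
    have h3 := add_pow_le h0.le (inv_nonneg.2 h0.le) M
    refine h3.trans ?_
    gcongr
    · norm_num
    · omega
  rw [← div_eq_mul_inv, le_div_iff₀ (by positivity)]
  calc _ ≤ ‖iteratedFDeriv ℝ k W ξ‖ * (2 ^ M * (‖ξ‖ ^ M + (‖ξ‖ ^ M)⁻¹)) := by gcongr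
    _ = 2 ^ M * (‖iteratedFDeriv ℝ k W ξ‖ * (‖ξ‖ ^ M + (‖ξ‖ ^ M)⁻¹)) := by ring
    _ ≤ _ := by
      gcongr
      exact (hC k hk ξ hξ).trans (le_max_left _ _)

variable {J : Type*} {A : J → Matrix (Fin d) (Fin d) ℝ} {b : J → E d} {P Q : Set (E d)}
  {φ : J → 𝓢(E d, ℝ)} {μ : J → ℝ}

theorem affMap_affInv {M : Matrix (Fin d) (Fin d) ℝ} (hM : IsUnit M.det) (v ξ : E d) :
    affMap M v (affInv M v ξ) = ξ := by
  rw [affMap, affInv, toEuclideanLin_apply_inv hM, sub_add_cancel]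

theorem affInv_affMap {M : Matrix (Fin d) (Fin d) ℝ} (hM : IsUnit M.det) (v ξ : E d) :
    affInv M v (affMap M v ξ) = ξ := by
  rw [affMap, affInv, add_sub_cancel_right, toEuclideanLin_inv_apply hM]

theorem contDiff_affMap (M : Matrix (Fin d) (Fin d) ℝ) (v : E d) : ContDiff ℝ ∞ (affMap M v) :=
  (LinearMap.toContinuousLinearMap (Matrix.toEuclideanLin M)).contDiff.add contDiff_const

theorem contDiff_affInv (M : Matrix (Fin d) (Fin d) ℝ) (v : E d) : ContDiff ℝ ∞ (affInv M v) :=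
  (LinearMap.toContinuousLinearMap (Matrix.toEuclideanLin M⁻¹)).contDiff.comp
    (contDiff_id.sub contDiff_const)

theorem opNorm_toEuclideanLin_le {M : Matrix (Fin d) (Fin d) ℝ} {K : ℝ} (hK : 0 ≤ K)
    (h : ∀ x, ‖Matrix.toEuclideanLin M x‖ ≤ K * ‖x‖) :
    ‖LinearMap.toContinuousLinearMap (Matrix.toEuclideanLin M)‖ ≤ K :=
  ContinuousLinearMap.opNorm_le_bound _ hK h

theorem exists_iteratedFDeriv_partition_le (hw : IsPolyWeight A b Q μ)
    (hA : ∀ j, IsUnit (A j).det) (hφ : IsRootPartition A b Q φ) (l : ℕ) :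
    ∃ (C : ℝ) (c : ℕ), 0 ≤ C ∧ ∀ j ξ, ‖iteratedFDeriv ℝ l (φ j) ξ‖ ≤ C * μ j ^ c := by
  obtain ⟨C, c, hC, hb⟩ := hw.exists_bound
  obtain ⟨B, hB⟩ := hφ.uniform l
  refine ⟨max B 0 * C ^ l, c * l, by positivity, fun j ξ => ?_⟩
  have hμ := hw.one_le j
  set g : E d → ℝ := fun ζ => φ j (affMap (A j) (b j) ζ)
  have hg : ContDiff ℝ ∞ g := (φ j).smooth'.comp (contDiff_affMap _ _)
  set S := LinearMap.toContinuousLinearMap (Matrix.toEuclideanLin (A j)⁻¹)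
  have h1 : (φ j : E d → ℝ) = fun ξ => g (S ξ + -S (b j)) := by
    ext x
    have : S x + -S (b j) = affInv (A j) (b j) x := by
      rw [← sub_eq_add_neg, ← map_sub]; rfl
    rw [this]
    simp only [g]
    rw [affMap_affInv (hA j)]
  rw [h1]
  refine (norm_iteratedFDeriv_comp_affine_le hg S _ ξ l).trans ?_
  have h2 : ‖S‖ ≤ C * μ j ^ c := opNorm_toEuclideanLin_le (by positivity) (hb j).2.1
  calc _ ≤ max B 0 * (C * μ j ^ c) ^ l := by
        gcongr
        exact (hB j _).trans (le_max_left _ _)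
    _ = _ := by rw [mul_pow, ← pow_mul, mul_assoc]

theorem exists_sNorm_partition_le (hw : IsPolyWeight A b Q μ)
    (hA : ∀ j, IsUnit (A j).det) (hφ : IsRootPartition A b Q φ) (m : ℕ) :
    ∃ (C : ℝ) (c : ℕ), 0 ≤ C ∧ ∀ j, sNorm m (ofRealS (φ j)) ≤ C * μ j ^ c := by
  obtain ⟨C, c, hC, hb⟩ := hw.exists_bound
  obtain ⟨B, p, hB0, hB⟩ := exists_common_polyBound hw.one_le
    (exists_iteratedFDeriv_partition_le hw hA hφ) m
  refine ⟨C ^ m * B, c * m + p, by positivity, fun j => ?_⟩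
  have hμ := hw.one_le j
  have hCμ : 1 ≤ C * μ j ^ c := one_le_mul_of_one_le_of_one_le hC (one_le_pow₀ hμ)
  refine sNorm_le (by positivity) fun k hk l hl ξ => ?_
  rw [norm_iteratedFDeriv_ofRealS]
  by_cases hξ : ξ ∈ tsupport (φ j)
  · calc ‖ξ‖ ^ k * ‖iteratedFDeriv ℝ l (φ j) ξ‖ ≤ (C * μ j ^ c) ^ k * (B * μ j ^ p) := by
          gcongr
          · exact ((hb j).2.2 ξ (hφ.support j hξ)).1
          · exact hB l hl j ξ
      _ ≤ (C * μ j ^ c) ^ m * (B * μ j ^ p) := by gcongr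
      _ = _ := by rw [mul_pow, ← pow_mul, pow_add]; ring
  · rw [Function.notMem_support.1 fun h => hξ (support_iteratedFDeriv_subset l h)]
    simp only [norm_zero, mul_zero]
    positivity

theorem tsupport_mulS_subset (φ w : 𝓢(E d, ℂ)) : tsupport (mulS φ w) ⊆ tsupport φ := by
  have : (mulS φ w : E d → ℂ) = fun x => φ x * w x := funext fun x => mulS_apply φ w x
  rw [this]
  exact tsupport_mul_subset_left

theorem tsupport_ofRealS_subset (φ : 𝓢(E d, ℝ)) : tsupport (ofRealS φ) ⊆ tsupport φ := by
  refine closure_mono fun x hx => ?_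
  rw [Function.mem_support, ofRealS_apply] at hx
  exact fun h => hx (by rw [h, Complex.ofReal_zero])

/-- The derivatives of `φ_j W` are bounded in terms of the derivatives of `W` on the support. -/
theorem exists_iteratedFDeriv_mul_partition_le (hw : IsPolyWeight A b Q μ)
    (hA : ∀ j, IsUnit (A j).det) (hφ : IsRootPartition A b Q φ) (m : ℕ) :
    ∃ (C : ℝ) (c : ℕ), 0 ≤ C ∧ ∀ l ≤ m, ∀ j (W : 𝓢(E d, ℂ)) (ξ : E d) (D : ℝ),
      (∀ i ≤ m, ‖iteratedFDeriv ℝ i W ξ‖ ≤ D) →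
      ‖iteratedFDeriv ℝ l (mulS (ofRealS (φ j)) W) ξ‖ ≤ C * μ j ^ c * D := by
  obtain ⟨B, p, hB0, hB⟩ := exists_common_polyBound hw.one_le
    (exists_iteratedFDeriv_partition_le hw hA hφ) m
  refine ⟨2 ^ m * B, p, by positivity, fun l hl j W ξ D hD => ?_⟩
  have hμ := hw.one_le j
  have hD0 : 0 ≤ D := (norm_nonneg _).trans (hD 0 (Nat.zero_le _))
  have h1 : (mulS (ofRealS (φ j)) W : E d → ℂ) = fun x => ofRealS (φ j) x * W x :=
    funext fun x => mulS_apply _ W x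
  rw [h1]
  refine (norm_iteratedFDeriv_mul_le ((ofRealS (φ j)).smooth l) (W.smooth l) ξ le_rfl).trans ?_
  calc _ ≤ ∑ i ∈ Finset.range (l + 1), (l.choose i : ℝ) * (B * μ j ^ p) * D := by
        refine Finset.sum_le_sum fun i hi => ?_
        have hi' := Finset.mem_range.1 hi
        rw [norm_iteratedFDeriv_ofRealS]
        gcongr
        · exact hB i (by omega) j ξ
        · exact hD _ (by omega)
    _ = 2 ^ l * (B * μ j ^ p) * D := by
        rw [← Finset.sum_mul, ← Finset.sum_mul]
        congr 2
        exact_mod_cast Nat.sum_range_choose l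
    _ ≤ 2 ^ m * (B * μ j ^ p) * D := by gcongr; norm_num
    _ = _ := by ring

end Estimates

/-! ### Fourier expansion of test functions vanishing to high order -/

section Expansion

variable {d : ℕ} {J : Type*} {A : J → Matrix (Fin d) (Fin d) ℝ} {b : J → E d} {P Q : Set (E d)}
  {φ : J → 𝓢(E d, ℝ)} {μ : J → ℝ} {o : E d} {a : ℝ}

/-- Seminorms of a pulled back function whose support is contained in the parallelepiped. -/
theorem sNorm_pullS_le {L : E d ≃L[ℝ] E d} {s : E d} {u : 𝓢(E d, ℂ)}
    (hu : tsupport u ⊆ latticeCell L s) {m : ℕ} {D N : ℝ} (hD : 0 ≤ D) (hN : 1 ≤ N)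
    (hL : ‖(L : E d →L[ℝ] E d)‖ ≤ N) (hb : ∀ l ≤ m, ∀ ξ, ‖iteratedFDeriv ℝ l u ξ‖ ≤ D) :
    sNorm m (pullS L s u) ≤ (1 + d : ℝ) ^ m * D * N ^ m := by
  refine sNorm_le (by positivity) fun k hk l hl t => ?_
  have h1 : (pullS L s u : E d → ℂ) = fun t => u ((L : E d →L[ℝ] E d) t + s) :=
    funext fun t => pullS_apply L s u t
  have hsm : ContDiff ℝ ∞ (u : E d → ℂ) := u.smooth'
  have h2 := norm_iteratedFDeriv_comp_affine_le hsm (L : E d →L[ℝ] E d) s t l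
  rw [h1]
  by_cases hmem : L t + s ∈ tsupport u
  · obtain ⟨t', ht', he⟩ := hu hmem
    have : t' = t := L.injective (by simpa using he)
    subst this
    have h3 : ‖t'‖ ≤ 1 + d := by
      calc ‖t'‖ ≤ ∑ i, |t' i| := norm_le_sum_abs _
        _ ≤ ∑ _i : Fin d, (1 / 2 : ℝ) := Finset.sum_le_sum fun i _ => ht' i
        _ = d * (1 / 2) := by simp
        _ ≤ _ := by have : (0 : ℝ) ≤ d := by positivity
                    linarith
    have h4 : (1 : ℝ) ≤ 1 + d := by linarith [show (0 : ℝ) ≤ d by positivity]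
    calc _ ≤ (1 + d : ℝ) ^ k * (D * N ^ l) := by
          gcongr
          refine h2.trans ?_
          gcongr
          exact hb l hl _
      _ ≤ (1 + d : ℝ) ^ m * (D * N ^ m) := by gcongr
      _ = _ := by ring
  · have h3 : iteratedFDeriv ℝ l u ((L : E d →L[ℝ] E d) t + s) = 0 :=
      Function.notMem_support.1 fun h => hmem (support_iteratedFDeriv_subset l h)
    rw [h3, norm_zero, zero_mul] at h2
    rw [le_antisymm h2 (norm_nonneg _), mul_zero]
    positivity

theorem norm_fcoef_eq (L : E d ≃L[ℝ] E d) (s : E d) (w : 𝓢(E d, ℂ)) (n : Fin d → ℤ) :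
    ‖fcoef L w n‖ = ‖𝓕 (pullS L s w) (intVec n)‖ := by
  rw [fourier_pullS, norm_mul, norm_character, mul_one]

/-- For functions `W` which vanish to high order at the origin and at infinity, the expansion of
`W` is summable in the Schwartz seminorms: the size of the seminorms of `φ_j` is compensated by the
decay of `W`, and the summation over `j` converges because the covering has bounded overlap. -/
theorem exists_summable_sNorm_expansion (hw : IsPolyWeight A b Q μ) (hA : ∀ j, IsUnit (A j).det)
    (hsym : ∀ j, (A j).IsHermitian) (hQ0 : ∀ j, ∀ z ∈ affMap (A j) (b j) '' Q, z ≠ 0)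
    (ha : 0 < a) (h2a : 0 < 2 * a) (hQK : Q ⊆ cube o a) (hφ : IsRootPartition A b Q φ) (m : ℕ) :
    ∃ M : ℕ, 1 ≤ M ∧ ∀ W : 𝓢(E d, ℂ), VanishesToOrder M W →
      Summable fun i : J × (Fin d → ℤ) =>
        sNorm m (fcoef (scaledEquiv (A i.1) (hA i.1) (2 * a) h2a) (mulS (ofRealS (φ i.1)) W) i.2 •
          modS (dualVec (scaledEquiv (A i.1) (hA i.1) (2 * a) h2a) i.2) (ofRealS (φ i.1))) := by
  obtain ⟨C, c, hC, hb⟩ := hw.exists_bound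
  obtain ⟨p, hp⟩ := hw.summable
  obtain ⟨m', C', hC', hF⟩ := ContinuousLinearMap.exists_sNorm_bound
    (FourierTransform.fourierCLM ℂ 𝓢(E d, ℂ)) (m + 2 * d)
  obtain ⟨B₁, c₁, hB₁, hb₁⟩ := exists_sNorm_partition_le hw hA hφ m
  obtain ⟨B₂, c₂, hB₂, hb₂⟩ := exists_iteratedFDeriv_mul_partition_le hw hA hφ m'
  set q := c₂ + c * m' + c * m + c₁ + p with hq
  refine ⟨c * q + m' + 1, by omega, fun W hW => ?_⟩
  obtain ⟨K, hK, hWK⟩ := hW.exists_le_inv_ecc_pow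
  have hpos : 0 < 2 * a := h2a
  have hpi := Real.pi_pos
  set N₁ : ℝ := 1 + 2 * a * C
  set N₂ : ℝ := 1 + Real.pi / a * C
  set Z : ℝ := 2 ^ (m + 2 * d) * C' * ((1 + d : ℝ) ^ m' * (B₂ * (K * C ^ q)) * N₁ ^ m') *
    (2 ^ m * N₂ ^ m * B₁)
  refine Summable.of_nonneg_of_le (fun i => sNorm_nonneg _ _) (fun ⟨j, n⟩ => ?_)
    ((hp.mul_of_nonneg summable_one_add_norm_intVec (fun j => ?_) fun n => by
      positivity).mul_left Z)
  swap
  · have := hw.one_le j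
    simp only [Pi.zero_apply]
    positivity
  dsimp only
  have hμ := hw.one_le j
  have hμc : 1 ≤ μ j ^ c := one_le_pow₀ hμ
  set L := scaledEquiv (A j) (hA j) (2 * a) h2a
  set s := affMap (A j) (b j) o
  set u := mulS (ofRealS (φ j)) W
  have hus : tsupport u ⊆ affMap (A j) (b j) '' Q :=
    ((tsupport_mulS_subset _ _).trans (tsupport_ofRealS_subset _)).trans (hφ.support j)
  have hucell : tsupport u ⊆ latticeCell L s := by
    rw [← affMap_image_cube (hA j) (b j) o h2a]
    exact hus.trans (Set.image_mono hQK)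
  -- the derivatives of `φ_j W`
  have hu : ∀ l ≤ m', ∀ ξ, ‖iteratedFDeriv ℝ l u ξ‖ ≤
      B₂ * μ j ^ c₂ * (K * C ^ q * (μ j ^ q)⁻¹) := by
    intro l hl ξ
    by_cases hξ : ξ ∈ affMap (A j) (b j) '' Q
    · refine hb₂ l hl j W ξ _ fun i hi => ?_
      have hξ0 := hQ0 j ξ hξ
      have he := one_le_ecc (norm_pos_iff.2 hξ0)
      refine (hWK i (by omega) ξ hξ0).trans ?_
      rw [mul_assoc]
      gcongr
      rw [← div_eq_mul_inv, le_div_iff₀ (by positivity), inv_mul_le_iff₀ (by positivity)]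
      calc μ j ^ q ≤ (C * ecc ‖ξ‖ ^ c) ^ q := by
            gcongr
            exact ((hb j).2.2 ξ hξ).2
        _ = ecc ‖ξ‖ ^ (c * q) * C ^ q := by rw [mul_pow, ← pow_mul, mul_comm]
        _ ≤ _ := by
          gcongr
          omega
    · rw [Function.notMem_support.1 fun h => hξ (hus (support_iteratedFDeriv_subset l h)),
        norm_zero]
      positivity
  have hL : ‖(L : E d →L[ℝ] E d)‖ ≤ N₁ * μ j ^ c := by
    refine ContinuousLinearMap.opNorm_le_bound _ (by positivity) fun x => ?_
    change ‖L x‖ ≤ _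
    rw [scaledEquiv_apply, norm_smul, Real.norm_of_nonneg h2a.le]
    have h1 := mul_le_mul_of_nonneg_left ((hb j).1 x) h2a.le
    refine h1.trans ?_
    have : 0 ≤ μ j ^ c * ‖x‖ := by positivity
    simp only [N₁]
    linarith
  have hN₁ : 1 ≤ N₁ * μ j ^ c := one_le_mul_of_one_le_of_one_le
    (by have : 0 < 2 * a * C := by positivity
        simp only [N₁]; linarith) hμc
  have hpull := sNorm_pullS_le hucell (by positivity) hN₁ hL hu
  have hcoef : ‖fcoef L u n‖ ≤ 2 ^ (m + 2 * d) * (C' * ((1 + d : ℝ) ^ m' *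
      (B₂ * μ j ^ c₂ * (K * C ^ q * (μ j ^ q)⁻¹)) * (N₁ * μ j ^ c) ^ m')) *
      ((1 + ‖(intVec n : E d)‖) ^ (m + 2 * d))⁻¹ := by
    rw [norm_fcoef_eq L s]
    refine (norm_le_sNorm (m + 2 * d) (FourierTransform.fourierCLM ℂ 𝓢(E d, ℂ) (pullS L s u))
      (intVec n)).trans ?_
    gcongr
    refine (hF _).trans ?_
    gcongr
  have hdual : 1 + ‖dualVec L n‖ ≤ N₂ * μ j ^ c * (1 + ‖(intVec n : E d)‖) := by
    rw [dualVec_scaledEquiv (hA j) (hsym j) ha, norm_smul, Real.norm_of_nonneg (by positivity)]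
    have h1 := mul_le_mul_of_nonneg_left ((hb j).2.1 (intVec n))
      (show 0 ≤ Real.pi / a by positivity)
    have h2 : 0 ≤ Real.pi / a * (C * μ j ^ c) := by positivity
    simp only [N₂]
    nlinarith [norm_nonneg (intVec n : E d), mul_nonneg (zero_le_one.trans hμc)
      (norm_nonneg (intVec n : E d))]
  have hmod : sNorm m (modS (dualVec L n) (ofRealS (φ j))) ≤
      2 ^ m * (N₂ * μ j ^ c * (1 + ‖(intVec n : E d)‖)) ^ m * (B₁ * μ j ^ c₁) := by
    refine (sNorm_modS_le m _ _).trans ?_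
    have := sNorm_nonneg m (ofRealS (φ j))
    gcongr
    exact hb₁ j
  have hsm : sNorm m (fcoef L u n • modS (dualVec L n) (ofRealS (φ j))) =
      ‖fcoef L u n‖ * sNorm m (modS (dualVec L n) (ofRealS (φ j))) := map_smul_eq_mul _ _ _
  rw [hsm]
  refine (mul_le_mul hcoef hmod (sNorm_nonneg _ _) (by positivity)).trans (le_of_eq ?_)
  have hn : (0 : ℝ) < 1 + ‖(intVec n : E d)‖ := by positivity
  have hμ0 : 0 < μ j := by linarith
  simp only [Z]
  rw [hq, pow_add _ m (2 * d), mul_pow N₁, mul_pow (N₂ * μ j ^ c), mul_pow N₂, ← pow_mul,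
    ← pow_mul, pow_add (μ j), pow_add (μ j), pow_add (μ j), pow_add (μ j)]
  field_simp
  ring

theorem abs_lt_of_mem_isOpen (hQ : IsOpen Q) (hQK : Q ⊆ cube o a) {q : E d} (hq : q ∈ Q)
    (i : Fin d) : |q i - o i| < a := by
  have hsurj : Function.Surjective (EuclideanSpace.proj i : E d →L[ℝ] ℝ) := fun x =>
    ⟨EuclideanSpace.single i x, by simp⟩
  have h1 := (EuclideanSpace.proj i : E d →L[ℝ] ℝ).isOpenMap hsurj Q hQ
  have h2 : (EuclideanSpace.proj i : E d →L[ℝ] ℝ) '' Q ⊆ Set.Icc (o i - a) (o i + a) := by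
    rintro _ ⟨ζ, hζ, rfl⟩
    have := abs_le.1 (hQK hζ i)
    exact ⟨by simp; linarith, by simp; linarith⟩
  have h3 := h1.subset_interior_iff.2 h2 ⟨q, hq, rfl⟩
  rw [interior_Icc] at h3
  have h4 : o i - a < q i := h3.1
  have h5 : q i < o i + a := h3.2
  rw [abs_lt]
  constructor <;> linarith

/-- The periodization of a function supported in the interior of the cell, times a function with
the same support. -/
theorem mul_fracVec_eq {A : Matrix (Fin d) (Fin d) ℝ} (hA : IsUnit A.det) {b : E d}
    (h2a : 0 < 2 * a) (hQ : IsOpen Q) (hQK : Q ⊆ cube o a) {φ u : 𝓢(E d, ℂ)}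
    (hφ : tsupport φ ⊆ affMap A b '' Q) (t : E d) :
    φ (scaledEquiv A hA (2 * a) h2a t + affMap A b o) *
      u (scaledEquiv A hA (2 * a) h2a (fracVec t) + affMap A b o) =
      mulS φ u (scaledEquiv A hA (2 * a) h2a t + affMap A b o) := by
  rw [mulS_apply]
  by_cases hmem : scaledEquiv A hA (2 * a) h2a t + affMap A b o ∈ affMap A b '' Q
  · obtain ⟨q, hq, he⟩ := hmem
    have h1 : scaledEquiv A hA (2 * a) h2a t + affMap A b o = affMap A b (o + (2 * a) • t) := by
      rw [scaledEquiv_apply, affMap, affMap, map_add, map_smul]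
      abel
    have h2 : q = o + (2 * a) • t := by
      rw [← affInv_affMap hA b q, he, h1, affInv_affMap hA]
    rw [fracVec_eq_self_of_lt fun i => ?_]
    have h3 := abs_lt_of_mem_isOpen hQ hQK hq i
    rw [h2, PiLp.add_apply, add_sub_cancel_left, PiLp.smul_apply, smul_eq_mul, abs_mul,
      abs_of_pos h2a] at h3
    nlinarith
  · rw [image_eq_zero_of_notMem_tsupport fun h => hmem (hφ h), zero_mul, zero_mul]

theorem apply_eq_zero_of_half_lt {A : Matrix (Fin d) (Fin d) ℝ} (hA : IsUnit A.det) {b : E d}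
    (h2a : 0 < 2 * a) (hQK : Q ⊆ cube o a) {u : 𝓢(E d, ℂ)} (hu : tsupport u ⊆ affMap A b '' Q)
    (t : E d) (ht : ∃ i, 1 / 2 < |t i|) :
    u (scaledEquiv A hA (2 * a) h2a t + affMap A b o) = 0 := by
  refine image_eq_zero_of_notMem_tsupport fun hmem => ?_
  have h1 := (hu.trans (Set.image_mono hQK)) hmem
  rw [affMap_image_cube hA b o h2a] at h1
  obtain ⟨t', ht', he⟩ := h1
  have : t' = t := (scaledEquiv A hA (2 * a) h2a).injective (by simpa using he)
  subst this
  obtain ⟨i, hi⟩ := ht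
  exact absurd (ht' i) (not_le.2 hi)

/-- The expansion of a single piece `φ_j² W`. -/
theorem hasSum_expansion_piece {A : Matrix (Fin d) (Fin d) ℝ} (hA : IsUnit A.det) {b : E d}
    (h2a : 0 < 2 * a) (hQ : IsOpen Q) (hQK : Q ⊆ cube o a) {φ : 𝓢(E d, ℂ)}
    (hφ : tsupport φ ⊆ affMap A b '' Q) (W : 𝓢(E d, ℂ)) (Λ : 𝓢'(E d, ℂ)) :
    HasSum (fun n => fcoef (scaledEquiv A hA (2 * a) h2a) (mulS φ W) n *
      Λ (modS (dualVec (scaledEquiv A hA (2 * a) h2a) n) φ)) (Λ (mulS φ (mulS φ W))) :=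
  hasSum_fcoef_apply (s := affMap A b o)
    (apply_eq_zero_of_half_lt hA h2a hQK ((tsupport_mulS_subset _ _).trans hφ))
    (mul_fracVec_eq hA h2a hQ hQK hφ) Λ

theorem hasSum_expansion_piece_apply {A : Matrix (Fin d) (Fin d) ℝ} (hA : IsUnit A.det) {b : E d}
    (h2a : 0 < 2 * a) (hQ : IsOpen Q) (hQK : Q ⊆ cube o a) {φ : 𝓢(E d, ℂ)}
    (hφ : tsupport φ ⊆ affMap A b '' Q) (W : 𝓢(E d, ℂ)) (ξ : E d) :
    HasSum (fun n => (fcoef (scaledEquiv A hA (2 * a) h2a) (mulS φ W) n •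
      modS (dualVec (scaledEquiv A hA (2 * a) h2a) n) φ) ξ) (mulS φ (mulS φ W) ξ) := by
  set L := scaledEquiv A hA (2 * a) h2a
  set s := affMap A b o
  have h1 : L (L.symm (ξ - s)) + s = ξ := by simp
  have h2 := (hasSum_fcoef (L := L) (s := s) (w := mulS φ W)
    (apply_eq_zero_of_half_lt hA h2a hQK ((tsupport_mulS_subset _ _).trans hφ))
    (L.symm (ξ - s))).mul_left (φ ξ)
  have h3 := mul_fracVec_eq hA h2a hQ hQK (u := mulS φ W) hφ (L.symm (ξ - s))
  rw [h1] at h2 h3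
  rw [h3] at h2
  refine h2.congr_fun fun n => ?_
  change fcoef L (mulS φ W) n * modS (dualVec L n) φ ξ = _
  rw [modS_apply]
  ring

theorem VanishesToOrder.apply_zero [Nontrivial (E d)] {M : ℕ} (hM : 1 ≤ M) {W : E d → ℂ}
    (hW : VanishesToOrder M W) (hc : Continuous W) : W 0 = 0 := by
  obtain ⟨K, hK, h⟩ := hW.exists_le_inv_ecc_pow
  have : (𝓝[≠] (0 : E d)).NeBot := Module.punctured_nhds_neBot ℝ (E d) 0
  have h1 : Tendsto W (𝓝[≠] 0) (𝓝 (W 0)) := (hc.tendsto 0).mono_left nhdsWithin_le_nhds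
  have h2 : Tendsto W (𝓝[≠] 0) (𝓝 0) := by
    refine squeeze_zero_norm' (a := fun ξ => K * ‖ξ‖) ?_ ?_
    · filter_upwards [self_mem_nhdsWithin] with ξ hξ
      have h0 : 0 < ‖ξ‖ := norm_pos_iff.2 hξ
      have h3 := h 0 (Nat.zero_le _) ξ hξ
      rw [norm_iteratedFDeriv_zero] at h3
      refine h3.trans ?_
      gcongr
      rw [inv_le_comm₀ (by have := one_le_ecc h0; positivity) h0]
      exact (inv_le_ecc h0).trans (le_self_pow₀ (one_le_ecc h0) (by omega))
    · have h3 : Tendsto (fun ξ : E d => K * ‖ξ‖) (𝓝 0) (𝓝 (K * ‖(0 : E d)‖)) :=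
        (by fun_prop : Continuous fun ξ : E d => K * ‖ξ‖).tendsto 0
      rw [norm_zero, mul_zero] at h3
      exact h3.mono_left nhdsWithin_le_nhds
  exact tendsto_nhds_unique h1 h2

/-- The expansion of test functions vanishing to high order: the double series over the pieces and
the lattice converges unconditionally after pairing with a tempered distribution. -/
theorem exists_hasSum_expansion [Countable J] [Nontrivial (E d)] (hw : IsPolyWeight A b Q μ)
    (hA : ∀ j, IsUnit (A j).det) (hsym : ∀ j, (A j).IsHermitian)
    (hQ0 : ∀ j, ∀ z ∈ affMap (A j) (b j) '' Q, z ≠ 0) (ha : 0 < a) (h2a : 0 < 2 * a)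
    (hQ : IsOpen Q) (hQK : Q ⊆ cube o a) (hφ : IsRootPartition A b Q φ) (Λ : 𝓢'(E d, ℂ)) :
    ∃ M : ℕ, ∀ W : 𝓢(E d, ℂ), VanishesToOrder M W →
      HasSum (fun i : J × (Fin d → ℤ) =>
        fcoef (scaledEquiv (A i.1) (hA i.1) (2 * a) h2a) (mulS (ofRealS (φ i.1)) W) i.2 *
          Λ (modS (dualVec (scaledEquiv (A i.1) (hA i.1) (2 * a) h2a) i.2) (ofRealS (φ i.1))))
        (Λ W) := by
  obtain ⟨m, C, hC, hΛ⟩ := TemperedDistribution.exists_sNorm_bound Λ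
  obtain ⟨M, hM, hsum⟩ := exists_summable_sNorm_expansion hw hA hsym hQ0 ha h2a hQK hφ m
  refine ⟨M, fun W hW => ?_⟩
  have hs := hsum W hW
  have hsupp : ∀ j, tsupport (ofRealS (φ j)) ⊆ affMap (A j) (b j) '' Q := fun j =>
    (tsupport_ofRealS_subset _).trans (hφ.support j)
  have hpt : ∀ ξ, HasSum (fun i : J × (Fin d → ℤ) =>
      (fcoef (scaledEquiv (A i.1) (hA i.1) (2 * a) h2a) (mulS (ofRealS (φ i.1)) W) i.2 •
        modS (dualVec (scaledEquiv (A i.1) (hA i.1) (2 * a) h2a) i.2) (ofRealS (φ i.1))) ξ)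
      (W ξ) := by
    intro ξ
    have h1 := (Summable.of_norm_bounded hs fun i => by
      have := le_sNorm (Nat.zero_le m) (Nat.zero_le m) (fcoef (scaledEquiv (A i.1) (hA i.1) (2 * a)
        h2a) (mulS (ofRealS (φ i.1)) W) i.2 • modS (dualVec (scaledEquiv (A i.1) (hA i.1) (2 * a)
        h2a) i.2) (ofRealS (φ i.1))) ξ
      rwa [pow_zero, one_mul, norm_iteratedFDeriv_zero] at this).hasSum
    have h2 := h1.prod_fiberwise fun j =>
      hasSum_expansion_piece_apply (hA j) h2a hQ hQK (hsupp j) W ξ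
    have h3 : HasSum (fun j => mulS (ofRealS (φ j)) (mulS (ofRealS (φ j)) W) ξ) (W ξ) := by
      rcases eq_or_ne ξ 0 with rfl | hξ
      · have hz : ∀ j, mulS (ofRealS (φ j)) (mulS (ofRealS (φ j)) W) 0 = 0 := fun j => by
          rw [mulS_apply, image_eq_zero_of_notMem_tsupport fun h => hQ0 j 0 (hsupp j h) rfl,
            zero_mul]
        simp only [hz]
        rw [hW.apply_zero hM W.continuous]
        exact hasSum_zero
      · have h4 := ((hφ.sum_sq ξ hξ).map Complex.ofRealHom Complex.continuous_ofReal).mul_right (W ξ)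
        simp only [map_one, one_mul] at h4
        refine h4.congr_fun fun j => ?_
        rw [mulS_apply, mulS_apply, ofRealS_apply]
        simp
        ring
    rwa [h2.unique h3] at h1
  refine (hasSum_apply_of_summable_sNorm Λ hΛ hs hpt).congr_fun fun i => ?_
  rw [map_smul, smul_eq_mul]

end Expansion

/-! ### The frame expansion -/

section Frame

variable {d : ℕ}

theorem hasSum_of_forall_hasSum_apply {ι : Type*} {F : ι → 𝓢'(E d, ℂ)} {u : 𝓢'(E d, ℂ)}
    (h : ∀ θ, HasSum (fun i => F i θ) (u θ)) : HasSum F u := by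
  rw [HasSum, PointwiseConvergenceCLM.tendsto_iff_forall_tendsto]
  intro θ
  refine (h θ).congr fun t => ?_
  simp

theorem toT_fourierInvS_apply (w θ : 𝓢(E d, ℂ)) :
    toT (fourierInvS d w) θ = ∫ ξ, w ξ * fourierInvS d θ ξ := by
  rw [toT_apply, ← integral_fourierInvS_mul]
  congr 1
  ext x
  ring

theorem bracket_fourierInvS (f : 𝓢'(E d, ℂ)) (w : 𝓢(E d, ℂ)) :
    bracket f (fourierInvS d w) = fourierT f (conjS w) := by
  rw [bracket, conjS_fourierInvS, fourierT_apply]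

theorem expFun_eq {A : Matrix (Fin d) (Fin d) ℝ} (hA : IsUnit A.det) (hsym : A.IsHermitian)
    (b : E d) {a : ℝ} (ha : 0 < a) (h2a : 0 < 2 * a) (n : Fin d → ℤ) (ξ : E d) :
    expFun A b a n ξ = (((2 * a) ^ (-(d : ℝ) / 2) * |A.det| ^ (-(1 : ℝ) / 2) : ℝ) : ℂ) *
      (character (dualVec (scaledEquiv A hA (2 * a) h2a) n) (-b) *
        character (dualVec (scaledEquiv A hA (2 * a) h2a) n) ξ) := by
  have h := Matrix.isSymmetric_toEuclideanLin_iff.2 hsym.inv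
  rw [character_comm, character_comm _ ξ, ← character_add, character_comm, expFun, character,
    dualVec_scaledEquiv hA hsym ha, inner_smul_left, h]
  congr 5
  rw [affInv, neg_add_eq_sub]

theorem frameHat_apply_eq (A : Matrix (Fin d) (Fin d) ℝ) (b : E d) (a : ℝ) (φ : 𝓢(E d, ℝ))
    (n : Fin d → ℤ) (ξ : E d) : frameHat A b a φ n ξ = expFun A b a n ξ * ofRealS φ ξ := by
  rw [frameHat, smulLeftCLM_apply_apply (expFun_hasTemperateGrowth A b a n)]
  rfl

/-- The coefficient of the frame expansion as a Fourier coefficient; the normalization and the phase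
factors cancel. -/
theorem bracket_mul_toT_frameElem {A : Matrix (Fin d) (Fin d) ℝ} (hA : IsUnit A.det)
    (hsym : A.IsHermitian) (b : E d) {a : ℝ} (ha : 0 < a) (h2a : 0 < 2 * a) (φ : 𝓢(E d, ℝ))
    (f : 𝓢'(E d, ℂ)) (θ : 𝓢(E d, ℂ)) (n : Fin d → ℤ) :
    (bracket f (frameElem A b a φ n) • toT (frameElem A b a φ n)) θ =
      fcoef (scaledEquiv A hA (2 * a) h2a) (mulS (ofRealS φ) (fourierInvS d θ)) (-n) *
        fourierT f (modS (dualVec (scaledEquiv A hA (2 * a) h2a) (-n)) (ofRealS φ)) := by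
  change bracket f (frameElem A b a φ n) * toT (frameElem A b a φ n) θ = _
  rw [frameElem, toT_fourierInvS_apply, bracket_fourierInvS]
  set L := scaledEquiv A hA (2 * a) h2a
  set k : ℂ := (((2 * a) ^ (-(d : ℝ) / 2) * |A.det| ^ (-(1 : ℝ) / 2) : ℝ) : ℂ) with hk
  have hdet : 0 < |A.det| := abs_pos.2 hA.ne_zero
  have hkk : k * k = ((|(L : E d →L[ℝ] E d).det|⁻¹ : ℝ) : ℂ) := by
    rw [hk, ← Complex.ofReal_mul, det_scaledEquiv, abs_mul, abs_of_pos (pow_pos h2a d)]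
    congr 1
    calc _ = ((2 * a) ^ (-(d : ℝ) / 2) * (2 * a) ^ (-(d : ℝ) / 2)) *
          (|A.det| ^ (-(1 : ℝ) / 2) * |A.det| ^ (-(1 : ℝ) / 2)) := by ring
      _ = (2 * a) ^ (-(d : ℝ)) * |A.det| ^ (-(1 : ℝ)) := by
        rw [← Real.rpow_add h2a, ← Real.rpow_add hdet]
        congr 2 <;> ring
      _ = _ := by
        rw [Real.rpow_neg h2a.le, Real.rpow_natCast, Real.rpow_neg_one, mul_inv]
  have h1 : ∀ ξ, frameHat A b a φ n ξ =
      k * character (dualVec L n) (-b) * (character (dualVec L n) ξ * ofRealS φ ξ) := by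
    intro ξ
    rw [frameHat_apply_eq, expFun_eq hA hsym b ha h2a]
    ring
  have h2 : conjS (frameHat A b a φ n) =
      (k * character (dualVec L n) b) • modS (-dualVec L n) (ofRealS φ) := by
    ext ξ
    have hconj : ∀ y z : E d, starRingEnd ℂ (character y z) = character (-y) z := by
      intro y z
      rw [character, character, ← Complex.exp_conj]
      simp
    have hneg : character (-dualVec L n) (-b) = character (dualVec L n) b := by
      simp [character]
    change conjS (frameHat A b a φ n) ξ =
      k * character (dualVec L n) b * modS (-dualVec L n) (ofRealS φ) ξ
    rw [conjS_apply, h1, modS_apply, map_mul, map_mul, map_mul, hconj, hconj, hneg,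
      ofRealS_apply, Complex.conj_ofReal, hk, Complex.conj_ofReal]
  have h3 : ∫ ξ, frameHat A b a φ n ξ * fourierInvS d θ ξ = k * character (dualVec L n) (-b) *
      ∫ ξ, character (dualVec L n) ξ * mulS (ofRealS φ) (fourierInvS d θ) ξ := by
    rw [← integral_const_mul]
    congr 1
    ext ξ
    rw [h1, mulS_apply]
    ring
  have h4 : character (dualVec L n) b * character (dualVec L n) (-b) = 1 := by
    rw [character_comm, character_comm _ (-b), mul_comm, character_neg_mul]
  rw [h2, h3, map_smul, smul_eq_mul, fcoef, dualVec_neg, neg_neg, ← hkk]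
  linear_combination (k * k * fourierT f (modS (-dualVec L n) (ofRealS φ)) *
    ∫ ξ, character (dualVec L n) ξ * mulS (ofRealS φ) (fourierInvS d θ) ξ) * h4

theorem vanishesToOrder_of_isSZero {θ : 𝓢(E d, ℂ)} (hθ : IsSZero θ) (M : ℕ) :
    VanishesToOrder M (fourierInvS d θ) := by
  obtain ⟨C, hC⟩ := hθ M
  refine ⟨C, fun k hk ξ hξ => ?_⟩
  have h1 : (fourierInvS d θ : E d → ℂ) =
      fun x => fourierS d θ ((-ContinuousLinearMap.id ℝ (E d)) x + 0) := by
    ext x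
    rw [fourierInvS_eq_fourierS_neg, add_zero]
    rfl
  have hsm : ContDiff ℝ ∞ (fourierS d θ : E d → ℂ) := (fourierS d θ).smooth'
  have h2 := norm_iteratedFDeriv_comp_affine_le hsm (-ContinuousLinearMap.id ℝ (E d)) 0 ξ k
  rw [← h1] at h2
  have h3 := hC k hk (-ξ) (neg_ne_zero.2 hξ)
  rw [norm_neg] at h3
  refine le_trans ?_ h3
  gcongr
  refine h2.trans ?_
  have h4 : (-ContinuousLinearMap.id ℝ (E d)) ξ + 0 = -ξ := by simp
  rw [h4]
  refine mul_le_of_le_one_right (norm_nonneg _) (pow_le_one₀ (norm_nonneg _) ?_)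
  rw [norm_neg]
  exact ContinuousLinearMap.norm_id_le

theorem box_mono {N N' : ℕ} (h : N ≤ N') : box d N ⊆ box d N' :=
  Fintype.piFinset_subset _ _ fun _ => Finset.Icc_subset_Icc (by omega) (by omega)

theorem exists_mem_box (n : Fin d → ℤ) : ∃ N : ℕ, n ∈ box d N := by
  refine ⟨∑ i, (n i).natAbs, Fintype.mem_piFinset.2 fun i => Finset.mem_Icc.2 ?_⟩
  have := Finset.single_le_sum (f := fun i => (n i).natAbs) (fun _ _ => Nat.zero_le _)
    (Finset.mem_univ i)
  omega

theorem tendsto_Icc_product_box :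
    Tendsto (fun k : ℕ × ℕ × ℕ => Finset.Icc (-(k.1 : ℤ)) k.2.1 ×ˢ box d k.2.2) atTop atTop := by
  refine tendsto_atTop_finset_of_monotone (fun k k' h => ?_) fun ⟨j, n⟩ => ?_
  · have h1 : k.1 ≤ k'.1 := h.1
    have h2 : k.2.1 ≤ k'.2.1 := h.2.1
    exact Finset.product_subset_product (Finset.Icc_subset_Icc (by omega) (by omega))
      (box_mono h.2.2)
  · obtain ⟨N, hN⟩ := exists_mem_box n
    refine ⟨(j.natAbs, j.natAbs, N), Finset.mem_product.2 ⟨Finset.mem_Icc.2 ?_, hN⟩⟩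
    dsimp only
    omega

theorem tendsto_Icc_neg :
    Tendsto (fun k : ℕ × ℕ => Finset.Icc (-(k.1 : ℤ)) k.2) atTop atTop := by
  refine tendsto_atTop_finset_of_monotone (fun k k' h => ?_) fun j => ?_
  · have h1 : k.1 ≤ k'.1 := h.1
    have h2 : k.2 ≤ k'.2 := h.2
    exact Finset.Icc_subset_Icc (by omega) (by omega)
  · refine ⟨(j.natAbs, j.natAbs), Finset.mem_Icc.2 ?_⟩
    dsimp only
    omega

variable {A : ℤ → Matrix (Fin d) (Fin d) ℝ} {b : ℤ → E d} {Q : Set (E d)}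
  {φ : ℤ → 𝓢(E d, ℝ)} {μ : ℤ → ℝ} {o : E d} {a : ℝ}

/-- Convergence of the frame expansion on test functions vanishing to infinite order. -/
theorem tendsto_frame_expansion [Nontrivial (E d)] (hw : IsPolyWeight A b Q μ)
    (hA : ∀ j, IsUnit (A j).det) (hsym : ∀ j, (A j).IsHermitian)
    (hQ0 : ∀ j, ∀ z ∈ affMap (A j) (b j) '' Q, z ≠ 0) (ha : 0 < a)
    (hQ : IsOpen Q) (hQK : Q ⊆ cube o a) (hφ : IsRootPartition A b Q φ) (f : 𝓢'(E d, ℂ))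
    {θ : 𝓢(E d, ℂ)} (hθ : IsSZero θ) :
    Tendsto (fun k : ℕ × ℕ × ℕ => (∑ j ∈ Finset.Icc (-(k.1 : ℤ)) k.2.1, ∑ n ∈ box d k.2.2,
      bracket f (frameElem (A j) (b j) a (φ j) n) • toT (frameElem (A j) (b j) a (φ j) n)) θ)
      atTop (𝓝 (f θ)) := by
  have h2a : 0 < 2 * a := by positivity
  obtain ⟨M, hM⟩ := exists_hasSum_expansion hw hA hsym hQ0 ha h2a hQ hQK hφ (fourierT f)
  have h1 := hM _ (vanishesToOrder_of_isSZero hθ M)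
  rw [← apply_eq_fourierT,
    ← ((Equiv.refl ℤ).prodCongr (Equiv.neg (Fin d → ℤ))).hasSum_iff] at h1
  refine (h1.comp tendsto_Icc_product_box).congr fun k => ?_
  rw [Function.comp_apply, Finset.sum_product]
  have h2 : ∀ j n, (bracket f (frameElem (A j) (b j) a (φ j) n) •
      toT (frameElem (A j) (b j) a (φ j) n)) θ = _ := fun j n =>
    bracket_mul_toT_frameElem (hA j) (hsym j) (b j) ha h2a (φ j) f θ n
  simp [h2]

/-- The part of `f` with spectrum localized by `φ²`. -/
noncomputable def localize (φ : 𝓢(E d, ℝ)) (f : 𝓢'(E d, ℂ)) : 𝓢'(E d, ℂ) :=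
  PointwiseConvergenceCLM.precomp ℂ
    (smulLeftCLM ℂ (ofRealS φ) ∘L smulLeftCLM ℂ (ofRealS φ) ∘L fourierInvS d) (fourierT f)

theorem localize_apply (φ : 𝓢(E d, ℝ)) (f : 𝓢'(E d, ℂ)) (θ : 𝓢(E d, ℂ)) :
    localize φ f θ =
      fourierT f (mulS (ofRealS φ) (mulS (ofRealS φ) (fourierInvS d θ))) := rfl

/-- The frame expansion of a single piece. -/
theorem hasSum_frame_piece {A : Matrix (Fin d) (Fin d) ℝ} (hA : IsUnit A.det)
    (hsym : A.IsHermitian) (b : E d) (ha : 0 < a) (hQ : IsOpen Q) (hQK : Q ⊆ cube o a)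
    {φ : 𝓢(E d, ℝ)} (hφ : tsupport φ ⊆ affMap A b '' Q) (f : 𝓢'(E d, ℂ)) :
    HasSum (fun n => bracket f (frameElem A b a φ n) • toT (frameElem A b a φ n))
      (localize φ f) := by
  have h2a : 0 < 2 * a := by positivity
  refine hasSum_of_forall_hasSum_apply fun θ => ?_
  simp only [bracket_mul_toT_frameElem hA hsym b ha h2a, localize_apply]
  exact (Equiv.neg (Fin d → ℤ)).hasSum_iff.2 (hasSum_expansion_piece hA h2a hQ hQK
    ((tsupport_ofRealS_subset φ).trans hφ) (fourierInvS d θ) (fourierT f))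

end Frame

/-! ### Taylor polynomials at the origin on the Fourier side -/

section Taylor

variable {d : ℕ}

/-- The `ℝ`-linear form `v ↦ ∑ k, v_k c_k`. -/
noncomputable def coordForm (c : Fin d → ℂ) : E d →L[ℝ] ℂ :=
  ∑ k, ContinuousLinearMap.smulRightL ℝ (E d) ℂ (EuclideanSpace.proj k) (c k)

theorem coordForm_apply (c : Fin d → ℂ) (v : E d) :
    coordForm c v = ∑ k, ((v k : ℝ) : ℂ) * c k := by
  rw [coordForm, _root_.sum_apply]
  refine Finset.sum_congr rfl fun k _ => ?_
  change (v k : ℝ) • c k = _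
  rw [Complex.real_smul]

theorem norm_coordForm_le (c : Fin d → ℂ) : ‖coordForm c‖ ≤ ∑ k, ‖c k‖ := by
  refine ContinuousLinearMap.opNorm_le_bound _ (Finset.sum_nonneg fun _ _ => norm_nonneg _)
    fun v => ?_
  rw [coordForm_apply, Finset.sum_mul]
  refine (norm_sum_le _ _).trans (Finset.sum_le_sum fun k _ => ?_)
  rw [norm_mul, mul_comm, Complex.norm_real]
  exact mul_le_mul_of_nonneg_left (PiLp.norm_apply_le v k) (norm_nonneg _)

theorem coordS_comm (k l : Fin d) (w : 𝓢(E d, ℂ)) :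
    coordS k (coordS l w) = coordS l (coordS k w) := by
  ext ξ
  simp only [coordS_apply]
  ring

/-- The homogeneous Taylor polynomial of degree `m` at the origin of `ξ ↦ Λ (e^{i ξ·x} w)`. -/
noncomputable def taylorTerm (Λ : 𝓢'(E d, ℂ)) : ℕ → 𝓢(E d, ℂ) → E d → ℂ
  | 0, w, _ => Λ w
  | m + 1, w, ξ => ((m : ℂ) + 1)⁻¹ * ∑ k, ((ξ k : ℝ) : ℂ) * taylorTerm Λ m (coordS k w) ξ

theorem taylorTerm_succ_zero (Λ : 𝓢'(E d, ℂ)) (m : ℕ) (w : 𝓢(E d, ℂ)) :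
    taylorTerm Λ (m + 1) w 0 = 0 := by
  simp [taylorTerm]

theorem hasFDerivAt_taylorTerm (Λ : 𝓢'(E d, ℂ)) (m : ℕ) (w : 𝓢(E d, ℂ)) (ξ : E d) :
    HasFDerivAt (taylorTerm Λ (m + 1) w)
      (coordForm fun k => taylorTerm Λ m (coordS k w) ξ) ξ := by
  have hcoord : ∀ k, HasFDerivAt (fun ξ : E d => ((ξ k : ℝ) : ℂ))
      (Complex.ofRealCLM ∘L (EuclideanSpace.proj k : E d →L[ℝ] ℝ)) ξ := fun k =>
    (Complex.ofRealCLM ∘L (EuclideanSpace.proj k : E d →L[ℝ] ℝ)).hasFDerivAt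
  induction m generalizing w with
  | zero =>
    have h : taylorTerm Λ (0 + 1) w = fun ξ => coordForm (fun k => Λ (coordS k w)) ξ := by
      ext ξ
      simp [taylorTerm, coordForm_apply]
    rw [h]
    exact (coordForm fun k => Λ (coordS k w)).hasFDerivAt
  | succ m ih =>
    have h : HasFDerivAt (taylorTerm Λ (m + 1 + 1) w) (((m + 1 : ℕ) + 1 : ℂ)⁻¹ • ∑ k,
        (((ξ k : ℝ) : ℂ) • coordForm (fun l => taylorTerm Λ m (coordS l (coordS k w)) ξ) +
          taylorTerm Λ (m + 1) (coordS k w) ξ •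
            (Complex.ofRealCLM ∘L (EuclideanSpace.proj k : E d →L[ℝ] ℝ)))) ξ := by
      have h1 := HasFDerivAt.fun_sum (u := Finset.univ) fun k _ => (hcoord k).mul (ih (coordS k w))
      exact h1.const_mul _
    refine h.congr_fderiv ?_
    ext v
    have h2 : ∀ l, taylorTerm Λ (m + 1) (coordS l w) ξ = ((m : ℂ) + 1)⁻¹ *
        ∑ k, ((ξ k : ℝ) : ℂ) * taylorTerm Λ m (coordS l (coordS k w)) ξ := by
      intro l
      rw [taylorTerm]
      simp only [coordS_comm l]
    have hm : ((m : ℂ) + 1) ≠ 0 := by exact_mod_cast Nat.succ_ne_zero m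
    have hm' : ((m : ℂ) + 1 + 1) ≠ 0 := by exact_mod_cast Nat.succ_ne_zero (m + 1)
    have h3 : ∑ k, ((ξ k : ℝ) : ℂ) * ∑ l, ((v l : ℝ) : ℂ) *
        taylorTerm Λ m (coordS l (coordS k w)) ξ =
        ((m : ℂ) + 1) * ∑ l, ((v l : ℝ) : ℂ) * taylorTerm Λ (m + 1) (coordS l w) ξ := by
      simp only [h2, Finset.mul_sum]
      rw [Finset.sum_comm]
      refine Finset.sum_congr rfl fun l _ => Finset.sum_congr rfl fun k _ => ?_
      field_simp
    have h4 : (((m + 1 : ℕ) + 1 : ℂ)⁻¹ • ∑ k,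
        (((ξ k : ℝ) : ℂ) • coordForm (fun l => taylorTerm Λ m (coordS l (coordS k w)) ξ) +
          taylorTerm Λ (m + 1) (coordS k w) ξ •
            (Complex.ofRealCLM ∘L (EuclideanSpace.proj k : E d →L[ℝ] ℝ)))) v =
        ((m : ℂ) + 1 + 1)⁻¹ * (∑ k, ((ξ k : ℝ) : ℂ) * ∑ l, ((v l : ℝ) : ℂ) *
          taylorTerm Λ m (coordS l (coordS k w)) ξ +
          ∑ k, ((v k : ℝ) : ℂ) * taylorTerm Λ (m + 1) (coordS k w) ξ) := by
      rw [← Finset.sum_add_distrib]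
      simp [_root_.sum_apply, coordForm_apply, mul_comm]
    rw [h4, h3, coordForm_apply]
    field_simp

theorem contDiff_taylorTerm (Λ : 𝓢'(E d, ℂ)) (m : ℕ) (w : 𝓢(E d, ℂ)) :
    ContDiff ℝ ∞ (taylorTerm Λ m w) := by
  induction m generalizing w with
  | zero => exact contDiff_const
  | succ m ih =>
    have hcoord : ∀ k, ContDiff ℝ ∞ (fun ξ : E d => ((ξ k : ℝ) : ℂ)) := fun k =>
      (Complex.ofRealCLM ∘L (EuclideanSpace.proj k : E d →L[ℝ] ℝ)).contDiff
    exact contDiff_const.mul (ContDiff.sum fun k _ => (hcoord k).mul (ih _))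

/-- The Taylor remainder of order `N` at the origin of `ξ ↦ Λ (e^{i ξ·x} w)`. -/
noncomputable def taylorRem (Λ : 𝓢'(E d, ℂ)) (N : ℕ) (w : 𝓢(E d, ℂ)) (ξ : E d) : ℂ :=
  Λ (modS ξ w) - ∑ m ∈ Finset.range N, taylorTerm Λ m w ξ

theorem hasFDerivAt_taylorRem (Λ : 𝓢'(E d, ℂ)) (N : ℕ) (w : 𝓢(E d, ℂ)) (ξ : E d) :
    HasFDerivAt (taylorRem Λ (N + 1) w) (coordForm fun k => taylorRem Λ N (coordS k w) ξ) ξ := by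
  have h1 : taylorRem Λ (N + 1) w = fun ξ => Λ (modS ξ w) -
      (∑ m ∈ Finset.range N, taylorTerm Λ (m + 1) w ξ + Λ w) := by
    ext ξ
    rw [taylorRem, Finset.sum_range_succ']
    rfl
  have h2 : HasFDerivAt (fun ξ => Λ (modS ξ w)) (coordForm fun k => Λ (modS ξ (coordS k w))) ξ :=
    hasFDerivAt_apply_modS Λ w ξ
  have h3 := h2.sub ((HasFDerivAt.fun_sum (u := Finset.range N) fun m _ =>
    hasFDerivAt_taylorTerm Λ m w ξ).add_const (Λ w))
  rw [h1]
  refine h3.congr_fderiv ?_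
  ext v
  simp only [coordForm_apply, taylorRem, _root_.sub_apply, _root_.sum_apply]
  rw [Finset.sum_comm, ← Finset.sum_sub_distrib]
  refine Finset.sum_congr rfl fun k _ => ?_
  rw [mul_sub, Finset.mul_sum]

theorem contDiff_taylorRem (Λ : 𝓢'(E d, ℂ)) (N : ℕ) (w : 𝓢(E d, ℂ)) :
    ContDiff ℝ ∞ (taylorRem Λ N w) :=
  (hasTemperateGrowth_apply_modS Λ w).1.sub (ContDiff.sum fun m _ => contDiff_taylorTerm Λ m w)

/-- The remainder vanishes to order `N` at the origin; the derivative of a remainder is a linear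
combination of remainders of lower order. -/
theorem exists_norm_iteratedFDeriv_taylorRem_le (Λ : 𝓢'(E d, ℂ)) (N : ℕ) (w : 𝓢(E d, ℂ)) :
    ∃ C : ℝ, 0 ≤ C ∧ ∀ k ≤ N, ∀ ξ : E d, ‖ξ‖ ≤ 1 →
      ‖iteratedFDeriv ℝ k (taylorRem Λ N w) ξ‖ ≤ C * ‖ξ‖ ^ (N - k) := by
  induction N generalizing w with
  | zero =>
    obtain ⟨C, hC⟩ := (isCompact_closedBall (0 : E d) 1).exists_bound_of_continuousOn
      (contDiff_taylorRem Λ 0 w).continuous.continuousOn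
    refine ⟨max C 0, le_max_right _ _, fun k hk ξ hξ => ?_⟩
    obtain rfl : k = 0 := by omega
    rw [norm_iteratedFDeriv_zero]
    simpa using Or.inl (hC ξ (mem_closedBall_zero_iff.2 hξ))
  | succ N ih =>
    choose C hC hb using fun k => ih (coordS k w)
    have hfd : fderiv ℝ (taylorRem Λ (N + 1) w) = fun ξ =>
        coordForm fun k => taylorRem Λ N (coordS k w) ξ :=
      funext fun ξ => (hasFDerivAt_taylorRem Λ N w ξ).fderiv
    have hC0 : 0 ≤ ∑ k, C k := Finset.sum_nonneg fun k _ => hC k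
    set B : ℝ := ∑ k, ‖ContinuousLinearMap.smulRightL ℝ (E d) ℂ (EuclideanSpace.proj k)‖ * C k
    have hB : 0 ≤ B := Finset.sum_nonneg fun k _ => by have := hC k; positivity
    refine ⟨max (∑ k, C k) B, le_max_of_le_left hC0, fun k hk ξ hξ => ?_⟩
    rcases k with _ | k
    · rw [norm_iteratedFDeriv_zero, Nat.sub_zero]
      have h0 : taylorRem Λ (N + 1) w 0 = 0 := by
        rw [taylorRem, Finset.sum_range_succ', Finset.sum_eq_zero fun m _ =>
          taylorTerm_succ_zero Λ m w, zero_add]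
        have : modS (0 : E d) w = w := by
          ext x
          rw [modS_apply, character_zero, one_mul]
        rw [this]
        exact sub_self _
      have h1 := (convex_closedBall (0 : E d) ‖ξ‖).norm_image_sub_le_of_norm_hasFDerivWithin_le
        (f := taylorRem Λ (N + 1) w) (C := (∑ k, C k) * ‖ξ‖ ^ N)
        (fun x _ => (hasFDerivAt_taylorRem Λ N w x).hasFDerivWithinAt) (fun x hx => ?_)
        (mem_closedBall_zero_iff.2 (norm_zero.trans_le (norm_nonneg ξ)))
        (mem_closedBall_zero_iff.2 le_rfl)
      · rw [h0, sub_zero, sub_zero, mul_assoc, ← pow_succ] at h1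
        refine h1.trans ?_
        gcongr
        exact le_max_left _ _
      · rw [mem_closedBall_zero_iff] at hx
        refine (norm_coordForm_le _).trans ?_
        rw [Finset.sum_mul]
        refine Finset.sum_le_sum fun k _ => ?_
        have h2 := hb k 0 (Nat.zero_le _) x (hx.trans hξ)
        rw [norm_iteratedFDeriv_zero, Nat.sub_zero] at h2
        refine h2.trans ?_
        have := hC k
        gcongr
    · have hcd : ∀ l, ContDiff ℝ k fun x =>
          ContinuousLinearMap.smulRightL ℝ (E d) ℂ (EuclideanSpace.proj l)
            (taylorRem Λ N (coordS l w) x) := fun l =>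
        (ContinuousLinearMap.contDiff _).comp
          ((contDiff_taylorRem Λ N (coordS l w)).of_le (by exact_mod_cast le_top))
      rw [← norm_iteratedFDeriv_fderiv, hfd]
      unfold coordForm
      rw [iteratedFDeriv_sum fun l _ => (hcd l), Finset.sum_apply]
      refine le_trans ?_ (mul_le_mul_of_nonneg_right (le_max_right _ _) (by positivity))
      rw [Finset.sum_mul]
      refine (norm_sum_le _ _).trans (Finset.sum_le_sum fun l _ => ?_)
      refine (ContinuousLinearMap.norm_iteratedFDeriv_comp_left
        (ContinuousLinearMap.smulRightL ℝ (E d) ℂ (EuclideanSpace.proj l))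
        ((contDiff_taylorRem Λ N (coordS l w)).of_le
          (by exact_mod_cast le_top)).contDiffAt le_rfl).trans ?_
      rw [mul_assoc]
      refine mul_le_mul_of_nonneg_left ?_ (norm_nonneg _)
      have h3 := hb l k (by omega) ξ hξ
      rwa [Nat.add_sub_add_right]

/-- The product of the Taylor polynomials with a Schwartz function is a finite sum of fixed Schwartz
functions, with polynomial moments as coefficients. -/
theorem exists_mul_taylorTerm_eq (m : ℕ) (χ : 𝓢(E d, ℂ)) :
    ∃ (ι : Type) (_ : Fintype ι) (v : ι → 𝓢(E d, ℂ)) (p : ι → MvPolynomial (Fin d) ℂ),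
      (∀ i ξ, χ ξ = 0 → v i ξ = 0) ∧
      ∀ w ξ, χ ξ * taylorTerm (polyT 1) m w ξ = ∑ i, polyT (p i) w * v i ξ := by
  induction m generalizing χ with
  | zero =>
    refine ⟨Unit, inferInstance, fun _ => χ, fun _ => 1, fun _ ξ h => h, fun w ξ => ?_⟩
    simp [taylorTerm, mul_comm]
  | succ m ih =>
    choose ι hι v p hv hp using fun k => ih (coordS k χ)
    have hmul : ∀ k (q : MvPolynomial (Fin d) ℂ) (w : 𝓢(E d, ℂ)),
        polyT q (coordS k w) = polyT (q * MvPolynomial.X k * MvPolynomial.C Complex.I) w := by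
      intro k q w
      refine integral_congr_ae (ae_of_all _ fun x => ?_)
      change coordS k w x * polyFun q x =
        w x * polyFun (q * MvPolynomial.X k * MvPolynomial.C Complex.I) x
      rw [coordS_apply, polyFun, polyFun, map_mul, map_mul, MvPolynomial.eval_X,
        MvPolynomial.eval_C]
      ring
    refine ⟨Σ k, ι k, inferInstance, fun i => v i.1 i.2, fun i => p i.1 i.2 *
      MvPolynomial.X i.1 * MvPolynomial.C Complex.I *
        MvPolynomial.C (((m : ℂ) + 1)⁻¹ * Complex.I⁻¹), fun i ξ h => ?_, fun w ξ => ?_⟩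
    · refine hv i.1 i.2 ξ ?_
      rw [coordS_apply, h, mul_zero]
    · have hC : ∀ (q : MvPolynomial (Fin d) ℂ) (z : ℂ),
          polyT (q * MvPolynomial.C z) w = z * polyT q w := by
        intro q z
        refine Eq.trans ?_ (integral_const_mul z _)
        refine integral_congr_ae (ae_of_all _ fun x => ?_)
        change w x * polyFun (q * MvPolynomial.C z) x = z * (w x * polyFun q x)
        rw [polyFun, polyFun, map_mul, MvPolynomial.eval_C]
        ring
      simp only [hC _ (((m : ℂ) + 1)⁻¹ * Complex.I⁻¹), ← hmul]
      rw [Fintype.sum_sigma, taylorTerm, ← mul_assoc, mul_comm (χ ξ), mul_assoc, Finset.mul_sum,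
        Finset.mul_sum]
      refine Finset.sum_congr rfl fun k _ => ?_
      have h1 := hp k (coordS k w) ξ
      rw [coordS_apply] at h1
      simp only [mul_assoc (((m : ℂ) + 1)⁻¹ * Complex.I⁻¹), ← Finset.mul_sum]
      rw [← h1]
      field_simp

theorem integrable_mul_polyFun (p : MvPolynomial (Fin d) ℂ) (w : 𝓢(E d, ℂ)) :
    Integrable fun x => w x * polyFun p x := by
  refine (smulLeftCLM ℂ (polyFun p) w).integrable.congr (ae_of_all _ fun x => ?_)
  rw [smulLeftCLM_apply_apply (polyFun_hasTemperateGrowth p), smul_eq_mul, mul_comm]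

theorem polyT_apply (p : MvPolynomial (Fin d) ℂ) (w : 𝓢(E d, ℂ)) :
    polyT p w = ∫ x, w x * polyFun p x := rfl

theorem polyT_sum_C_mul {ι : Type*} [Fintype ι] (z : ι → ℂ) (p : ι → MvPolynomial (Fin d) ℂ)
    (w : 𝓢(E d, ℂ)) :
    polyT (∑ i, MvPolynomial.C (z i) * p i) w = ∑ i, z i * polyT (p i) w := by
  simp only [polyT_apply, ← integral_const_mul]
  rw [← integral_finsetSum _ fun i _ => (integrable_mul_polyFun (p i) w).const_mul (z i)]
  refine integral_congr_ae (ae_of_all _ fun x => ?_)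
  simp only [polyFun, map_sum, map_mul, MvPolynomial.eval_C, Finset.mul_sum]
  exact Finset.sum_congr rfl fun i _ => by ring

theorem fourierInvS_eq_polyT_one (θ : 𝓢(E d, ℂ)) (ξ : E d) :
    fourierInvS d θ ξ = (((2 * Real.pi) ^ (-(d : ℝ) / 2) : ℝ) : ℂ) * polyT 1 (modS ξ θ) := by
  rw [fourierInvS_eq, polyT_apply]
  simp [modS_apply, polyFun]

/-- Subtraction of cut-off Taylor polynomials makes the inverse Fourier transform of a Schwartz
function vanish to a given order at the origin. The coefficients of the correction are polynomial
moments of the function. -/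
theorem exists_taylor_correction (M : ℕ) {ε : ℝ} (hε : 0 < ε) :
    ∃ (ι : Type) (_ : Fintype ι) (v : ι → 𝓢(E d, ℂ)) (p : ι → MvPolynomial (Fin d) ℂ),
      (∀ i ξ, ε ≤ ‖ξ‖ → v i ξ = 0) ∧
      ∀ θ, VanishesToOrder M (fourierInvS d θ - ∑ i, polyT (p i) θ • v i : 𝓢(E d, ℂ)) := by
  obtain ⟨χ, h1, h0, -⟩ := exists_schwartz_cutoff (isClosed_singleton (x := (0 : E d)))
    (Metric.isOpen_ball (x := (0 : E d)) (ε := ε)) (by simpa using hε) Metric.isBounded_ball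
  rw [nhdsSet_singleton] at h1
  obtain ⟨r₀, hr₀, hr₀'⟩ := Metric.eventually_nhds_iff_ball.1 h1
  set r : ℝ := min r₀ 1
  have hr : 0 < r := lt_min hr₀ one_pos
  choose ι hι v p hv hp using fun m : Fin (2 * M) => exists_mul_taylorTerm_eq (m : ℕ) χ
  set κ : ℂ := (((2 * Real.pi) ^ (-(d : ℝ) / 2) : ℝ) : ℂ)
  refine ⟨Σ m, ι m, inferInstance, fun i => κ • v i.1 i.2, fun i => p i.1 i.2,
    fun i ξ hξ => ?_, fun θ => ?_⟩
  · have h2 : χ ξ = 0 := h0 ξ (by simpa using hξ)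
    change κ * v i.1 i.2 ξ = 0
    rw [hv i.1 i.2 ξ h2, mul_zero]
  set R : 𝓢(E d, ℂ) := fourierInvS d θ - ∑ i : Σ m, ι m, polyT (p i.1 i.2) θ • κ • v i.1 i.2
  have hR : ∀ ξ, R ξ = κ * (polyT 1 (modS ξ θ) -
      χ ξ * ∑ m ∈ Finset.range (2 * M), taylorTerm (polyT 1) m θ ξ) := by
    intro ξ
    have h2 : R ξ = fourierInvS d θ ξ - ∑ i : Σ m, ι m, polyT (p i.1 i.2) θ * (κ * v i.1 i.2 ξ) := by
      simp [R]
    rw [h2, fourierInvS_eq_polyT_one, mul_sub, Finset.sum_range, Finset.mul_sum, Finset.mul_sum,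
      Fintype.sum_sigma]
    congr 1
    refine Finset.sum_congr rfl fun m _ => ?_
    rw [hp, Finset.mul_sum]
    exact Finset.sum_congr rfl fun i _ => by ring
  obtain ⟨C, hC, hb⟩ := exists_norm_iteratedFDeriv_taylorRem_le (polyT 1) (2 * M) θ
  have hS := sNorm_nonneg M R
  refine ⟨max (‖κ‖ * C * 2) (sNorm M R + sNorm M R * (r ^ M)⁻¹), fun k hk ξ hξ => ?_⟩
  have hξ0 : 0 < ‖ξ‖ := norm_pos_iff.2 hξ
  -- near the origin the remainder of order `2 * M` leaves order at least `M` after `M` derivatives;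
  -- elsewhere `‖ξ‖ ^ (-M)` is bounded and the Schwartz norm suffices
  rcases lt_or_ge ‖ξ‖ r with hlt | hge
  · refine le_trans ?_ (le_max_left _ _)
    have hξ1 : ‖ξ‖ ≤ 1 := hlt.le.trans (min_le_right _ _)
    have heq : (R : E d → ℂ) =ᶠ[𝓝 ξ] κ • taylorRem (polyT 1) (2 * M) θ := by
      filter_upwards [Metric.isOpen_ball.mem_nhds (mem_ball_zero_iff.2 hlt)] with y hy
      have h2 : χ y = 1 := hr₀' y (Metric.ball_subset_ball (min_le_left _ _) hy)
      rw [hR, h2, one_mul]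
      rfl
    rw [(Filter.EventuallyEq.iteratedFDeriv ℝ heq k).self_of_nhds, iteratedFDeriv_const_smul_apply
      ((contDiff_taylorRem (polyT 1) (2 * M) θ).of_le (by exact_mod_cast le_top)).contDiffAt,
      norm_smul]
    have h3 := hb k (by omega) ξ hξ1
    have h4 : ‖ξ‖ ^ (2 * M - k) ≤ ‖ξ‖ ^ M := pow_le_pow_of_le_one hξ0.le hξ1 (by omega)
    have h5 : ‖ξ‖ ^ M ≤ (‖ξ‖ ^ M)⁻¹ := by
      have := pow_le_one₀ (n := M) hξ0.le hξ1
      exact this.trans ((one_le_inv₀ (by positivity)).2 this)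
    calc _ ≤ ‖κ‖ * (C * ‖ξ‖ ^ M) * ((‖ξ‖ ^ M)⁻¹ + (‖ξ‖ ^ M)⁻¹) := by
          gcongr
          exact h3.trans (by gcongr)
      _ = _ := by field_simp; ring
  · refine le_trans ?_ (le_max_right _ _)
    rw [mul_add]
    refine add_le_add ?_ ?_
    · rw [mul_comm]
      exact le_sNorm le_rfl hk R ξ
    · have h2 := le_sNorm (Nat.zero_le M) hk R ξ
      rw [pow_zero, one_mul] at h2
      gcongr

end Taylor

/-! ### Convergence of the expansion with polynomial corrections -/

section Corrections

variable {d : ℕ}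

/-- The functional `W ↦ Λ (φ² W)`. -/
noncomputable def sqPair (Λ : 𝓢'(E d, ℂ)) (φ : 𝓢(E d, ℝ)) : 𝓢(E d, ℂ) →ₗ[ℂ] ℂ where
  toFun W := Λ (mulS (ofRealS φ) (mulS (ofRealS φ) W))
  map_add' W W' := by simp [mulS]
  map_smul' z W := by simp [mulS]

theorem sqPair_apply (Λ : 𝓢'(E d, ℂ)) (φ : 𝓢(E d, ℝ)) (W : 𝓢(E d, ℂ)) :
    sqPair Λ φ W = Λ (mulS (ofRealS φ) (mulS (ofRealS φ) W)) := rfl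

theorem sqPair_eq_zero (Λ : 𝓢'(E d, ℂ)) {φ : 𝓢(E d, ℝ)} {v : 𝓢(E d, ℂ)}
    (h : ∀ ξ, φ ξ = 0 ∨ v ξ = 0) : sqPair Λ φ v = 0 := by
  have h1 : mulS (ofRealS φ) (mulS (ofRealS φ) v) = 0 := by
    ext ξ
    rcases h ξ with h | h <;> simp [mulS_apply, ofRealS_apply, h]
  rw [sqPair_apply, h1, map_zero]

variable {A : ℤ → Matrix (Fin d) (Fin d) ℝ} {b : ℤ → E d} {Q : Set (E d)}
  {φ : ℤ → 𝓢(E d, ℝ)} {μ : ℤ → ℝ} {o : E d} {a : ℝ}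

/-- Convergence of the expansion up to polynomials. Only the pieces with negative index see the
cut-off Taylor polynomials, so the correction depends only on the lower summation bound. -/
theorem exists_tendsto_sum_localize_add [Nontrivial (E d)] (hw : IsPolyWeight A b Q μ)
    (hA : ∀ j, IsUnit (A j).det) (hsym : ∀ j, (A j).IsHermitian)
    (hQ0 : ∀ j, ∀ z ∈ affMap (A j) (b j) '' Q, z ≠ 0) (ha : 0 < a)
    (hQ : IsOpen Q) (hQK : Q ⊆ cube o a) (hφ : IsRootPartition A b Q φ)
    {ε : ℝ} (hε : 0 < ε) (hfar : ∀ j : ℤ, 0 ≤ j → ∀ z ∈ affMap (A j) (b j) '' Q, ε ≤ ‖z‖)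
    (f : 𝓢'(E d, ℂ)) :
    ∃ (p : ℕ → MvPolynomial (Fin d) ℂ) (p₀ : MvPolynomial (Fin d) ℂ) (f₀ : 𝓢'(E d, ℂ)),
      Tendsto (fun k : ℕ × ℕ =>
        ∑ j ∈ Finset.Icc (-(k.1 : ℤ)) k.2, localize (φ j) f + polyT (p k.1)) atTop (𝓝 f₀) ∧
      f = f₀ + polyT p₀ := by
  have h2a : 0 < 2 * a := by positivity
  obtain ⟨M, hM⟩ := exists_hasSum_expansion hw hA hsym hQ0 ha h2a hQ hQK hφ (fourierT f)
  obtain ⟨ι, _, v, p, hv, hR⟩ := exists_taylor_correction (d := d) M hε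
  set D : ℤ → 𝓢(E d, ℂ) →ₗ[ℂ] ℂ := fun j => sqPair (fourierT f) (φ j) with hD
  have hDv : ∀ j : ℤ, 0 ≤ j → ∀ i, D j (v i) = 0 := fun j hj i => by
    refine sqPair_eq_zero _ fun ξ => ?_
    by_cases hξ : ξ ∈ tsupport (φ j)
    · exact Or.inr (hv i ξ (hfar j hj ξ (hφ.support j hξ)))
    · exact Or.inl (image_eq_zero_of_notMem_tsupport hξ)
  have hsub : ∀ k : ℕ × ℕ, ∀ i, ∑ j ∈ Finset.Icc (-(k.1 : ℤ)) k.2, D j (v i) =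
      ∑ j ∈ Finset.Icc (-(k.1 : ℤ)) (-1), D j (v i) := by
    intro k i
    refine (Finset.sum_subset (Finset.Icc_subset_Icc_right (by omega)) fun j hj hj' => ?_).symm
    refine hDv j ?_ i
    simp only [Finset.mem_Icc, not_and] at hj hj'
    have := hj' hj.1
    omega
  -- the coefficients compensate the contribution of the cut-off Taylor polynomial to the pieces
  -- with negative index, respectively to `f`
  refine ⟨fun k => ∑ i, MvPolynomial.C (-∑ j ∈ Finset.Icc (-(k : ℤ)) (-1), D j (v i)) * p i,
    ∑ i, MvPolynomial.C (fourierT f (v i)) * p i,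
    f - polyT (∑ i, MvPolynomial.C (fourierT f (v i)) * p i), ?_, by abel⟩
  rw [PointwiseConvergenceCLM.tendsto_iff_forall_tendsto]
  intro θ
  have h1 : HasSum (fun j => D j (fourierInvS d θ - ∑ i, polyT (p i) θ • v i))
      (fourierT f (fourierInvS d θ - ∑ i, polyT (p i) θ • v i)) :=
    (hM _ (hR θ)).prod_fiberwise fun j => hasSum_expansion_piece (hA j) h2a hQ hQK
      ((tsupport_ofRealS_subset _).trans (hφ.support j)) _ _
  have h2 : (f - polyT (∑ i, MvPolynomial.C (fourierT f (v i)) * p i) : 𝓢'(E d, ℂ)) θ =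
      fourierT f (fourierInvS d θ - ∑ i, polyT (p i) θ • v i) := by
    change f θ - polyT _ θ = _
    rw [polyT_sum_C_mul, map_sub, map_sum, apply_eq_fourierT]
    simp only [map_smul, smul_eq_mul, mul_comm]
  rw [h2]
  refine (h1.comp tendsto_Icc_neg).congr fun k => ?_
  have h3 : (∑ j ∈ Finset.Icc (-(k.1 : ℤ)) k.2, localize (φ j) f +
      polyT (∑ i, MvPolynomial.C (-∑ j ∈ Finset.Icc (-(k.1 : ℤ)) (-1), D j (v i)) * p i) :
        𝓢'(E d, ℂ)) θ =
      ∑ j ∈ Finset.Icc (-(k.1 : ℤ)) k.2, D j (fourierInvS d θ) +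
      polyT (∑ i, MvPolynomial.C (-∑ j ∈ Finset.Icc (-(k.1 : ℤ)) (-1), D j (v i)) * p i) θ := by
    simp [hD, sqPair_apply, localize_apply]
  rw [h3, polyT_sum_C_mul, Function.comp_apply]
  simp only [map_sub, map_sum, map_smul, smul_eq_mul, Finset.sum_sub_distrib, ← hsub k]
  rw [Finset.sum_comm, sub_eq_add_neg, ← Finset.sum_neg_distrib]
  congr 1
  refine Finset.sum_congr rfl fun i _ => ?_
  rw [← Finset.mul_sum]
  ring

end Corrections

/-! ### Root partitions subordinate to a structured covering -/

section RootPartition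

variable {d : ℕ}

theorem contDiffOn_inv_sqrt : ContDiffOn ℝ ∞ (fun y : ℝ => (Real.sqrt y)⁻¹) (Set.Ioi 0) :=
  fun _ hy => ((contDiffAt_id.sqrt (ne_of_gt hy)).inv (Real.sqrt_pos.2 hy).ne').contDiffWithinAt

/-- A derivative of `Φ / √H` at a point where `H ≥ 1` is bounded in terms of the derivatives of `Φ`
and `H` there. -/
theorem exists_norm_iteratedFDeriv_div_sqrt_le (n : ℕ) (K : ℝ) :
    ∃ C : ℝ, ∀ (Φ H : E d → ℝ), ContDiff ℝ ∞ Φ → ContDiff ℝ ∞ H → ∀ x, 1 ≤ H x →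
      (∀ i ≤ n, ‖iteratedFDeriv ℝ i Φ x‖ ≤ K) → (∀ i ≤ n, ‖iteratedFDeriv ℝ i H x‖ ≤ K) →
      ‖iteratedFDeriv ℝ n (fun y => Φ y / Real.sqrt (H y)) x‖ ≤ C := by
  have hu : UniqueDiffOn ℝ (Set.Ioi (0 : ℝ)) := isOpen_Ioi.uniqueDiffOn
  have hr : ∀ i : ℕ, ∃ c : ℝ, ∀ y ∈ Set.Icc (1 : ℝ) K,
      ‖iteratedFDerivWithin ℝ i (fun y : ℝ => (Real.sqrt y)⁻¹) (Set.Ioi 0) y‖ ≤ c := fun i =>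
    isCompact_Icc.exists_bound_of_continuousOn
      ((contDiffOn_inv_sqrt.continuousOn_iteratedFDerivWithin (by exact_mod_cast le_top) hu).mono
        fun y hy => lt_of_lt_of_le one_pos hy.1)
  choose c hc using hr
  -- the constant of the chain rule for `(√·)⁻¹ ∘ H`, whose outer derivatives are bounded on `[1, K]`
  set B : ℝ := n.factorial * (∑ i ∈ Finset.range (n + 1), |c i|) * max 1 K ^ n with hB
  refine ⟨∑ i ∈ Finset.range (n + 1), (n.choose i : ℝ) * max 1 K * B,
    fun Φ H hΦ hH x hx hΦK hHK => ?_⟩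
  set s : Set (E d) := H ⁻¹' Set.Ioi 0 with hs
  have hso : IsOpen s := isOpen_Ioi.preimage hH.continuous
  have hxs : x ∈ s := lt_of_lt_of_le one_pos hx
  have hHx : H x ∈ Set.Icc (1 : ℝ) K := by
    refine ⟨hx, ?_⟩
    have := hHK 0 (Nat.zero_le n)
    rw [norm_iteratedFDeriv_zero] at this
    exact (le_abs_self _).trans this
  have hmax : 1 ≤ max 1 K := le_max_left 1 K
  have hcomp : ∀ m ≤ n, ‖iteratedFDerivWithin ℝ m
      ((fun y : ℝ => (Real.sqrt y)⁻¹) ∘ H) s x‖ ≤ B := by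
    intro m hm
    have h1 := norm_iteratedFDerivWithin_comp_le (n := m) (C := ∑ i ∈ Finset.range (n + 1), |c i|)
      (D := max 1 K) contDiffOn_inv_sqrt hH.contDiffOn (by exact_mod_cast le_top) hu
      hso.uniqueDiffOn (fun y hy => hy) hxs (fun i hi => by
        refine (hc i _ hHx).trans ((le_abs_self _).trans ?_)
        exact Finset.single_le_sum (f := fun i => |c i|) (fun _ _ => abs_nonneg _)
          (Finset.mem_range.2 (by omega))) (fun i hi1 him => by
        rw [iteratedFDerivWithin_of_isOpen i hso hxs]
        exact (hHK i (him.trans hm)).trans ((le_max_right 1 K).trans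
          (le_self_pow₀ hmax (by omega))))
    refine h1.trans ?_
    rw [hB]
    have h2 : 0 ≤ ∑ i ∈ Finset.range (n + 1), |c i| := Finset.sum_nonneg fun _ _ => abs_nonneg _
    gcongr
  have h2 : ContDiffOn ℝ ∞ ((fun y : ℝ => (Real.sqrt y)⁻¹) ∘ H) s :=
    contDiffOn_inv_sqrt.comp hH.contDiffOn fun y hy => hy
  have h3 := norm_iteratedFDerivWithin_mul_le hΦ.contDiffOn h2 hso.uniqueDiffOn hxs (n := n)
    (by exact_mod_cast le_top)
  rw [iteratedFDerivWithin_of_isOpen n hso hxs] at h3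
  simp only [div_eq_mul_inv]
  refine h3.trans (Finset.sum_le_sum fun i hi => ?_)
  have hi' : i ≤ n := Nat.lt_succ_iff.1 (Finset.mem_range.1 hi)
  rw [iteratedFDerivWithin_of_isOpen i hso hxs]
  gcongr
  · exact (hΦK i hi').trans (le_max_right 1 K)
  · exact hcomp _ (Nat.sub_le n i)

theorem exists_norm_iteratedFDeriv_le_of_hasCompactSupport {g : E d → ℝ}
    (hg : HasCompactSupport g) (hs : ContDiff ℝ ∞ g) (m : ℕ) :
    ∃ c : ℝ, 0 ≤ c ∧ ∀ i ≤ m, ∀ ζ, ‖iteratedFDeriv ℝ i g ζ‖ ≤ c := by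
  have h : ∀ i : ℕ, ∃ c : ℝ, ∀ ζ, ‖iteratedFDeriv ℝ i g ζ‖ ≤ c := fun i =>
    (hg.iteratedFDeriv i).exists_bound_of_continuous
      (hs.continuous_iteratedFDeriv (by exact_mod_cast le_top))
  choose c hc using h
  refine ⟨∑ i ∈ Finset.range (m + 1), |c i|, Finset.sum_nonneg fun _ _ => abs_nonneg _,
    fun i hi ζ => (hc i ζ).trans ((le_abs_self _).trans ?_)⟩
  exact Finset.single_le_sum (f := fun i => |c i|) (fun _ _ => abs_nonneg _)
    (Finset.mem_range.2 (by omega))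

variable {J : Type*} {A : J → Matrix (Fin d) (Fin d) ℝ} {b : J → E d} {P Q : Set (E d)}
  {Φ : E d → ℝ}

theorem exists_overlap_finset (hcov : IsStructuredCovering A b P Q) :
    ∃ (N : ℕ) (F : J → Finset J), (∀ j, (F j).card ≤ N) ∧ ∀ j k, k ∈ F j ↔
      (affMap (A k) (b k) '' Q ∩ affMap (A j) (b j) '' Q).Nonempty := by
  obtain ⟨N, hN⟩ := hcov.covering_Q.2.2
  have hfin : ∀ j, {k | (affMap (A k) (b k) '' Q ∩ affMap (A j) (b j) '' Q).Nonempty}.Finite :=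
    fun j => Set.finite_of_encard_le_coe (hN j)
  refine ⟨N, fun j => (hfin j).toFinset, fun j => ?_, fun j k => (hfin j).mem_toFinset⟩
  have h := hN j
  rw [(hfin j).encard_eq_coe_toFinset_card] at h
  exact_mod_cast h

theorem apply_affInv_eq_zero (hcov : IsStructuredCovering A b P Q) (hΦ : tsupport Φ ⊆ Q) {j : J}
    {ξ : E d} (hξ : ξ ∉ affMap (A j) (b j) '' Q) : Φ (affInv (A j) (b j) ξ) = 0 := by
  by_contra h
  exact hξ ⟨_, hΦ (subset_tsupport _ h), affMap_affInv (hcov.invertible j) _ _⟩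

theorem hasSum_sq_apply_affInv (hcov : IsStructuredCovering A b P Q) (hΦ : tsupport Φ ⊆ Q)
    {F : J → Finset J} (hF : ∀ j k, k ∈ F j ↔
      (affMap (A k) (b k) '' Q ∩ affMap (A j) (b j) '' Q).Nonempty) {j : J} {ξ : E d}
    (hξ : ξ ∈ affMap (A j) (b j) '' Q) :
    HasSum (fun k => Φ (affInv (A k) (b k) ξ) ^ 2)
      (∑ k ∈ F j, Φ (affInv (A k) (b k) ξ) ^ 2) := by
  refine hasSum_sum_of_ne_finset_zero fun k hk => ?_
  rw [apply_affInv_eq_zero hcov hΦ fun h => hk ((hF j k).2 ⟨ξ, h, hξ⟩)]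
  exact zero_pow two_ne_zero

theorem one_le_sum_sq (hcov : IsStructuredCovering A b P Q) (hΦP : ∀ ξ ∈ P, Φ ξ = 1)
    {ξ : E d} (hξ : ξ ≠ 0) {S : ℝ} (hS : HasSum (fun k => Φ (affInv (A k) (b k) ξ) ^ 2) S) :
    1 ≤ S := by
  have h : ξ ∈ ⋃ j, affMap (A j) (b j) '' P := by
    rw [hcov.covering_P.2.1]
    exact hξ
  obtain ⟨j, ζ, hζ, rfl⟩ := Set.mem_iUnion.1 h
  have h1 := le_hasSum hS j fun _ _ => sq_nonneg _
  rwa [affInv_affMap (hcov.invertible j), hΦP ζ hζ, one_pow] at h1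

theorem affInv_comp_affMap (M M' : Matrix (Fin d) (Fin d) ℝ) (v v' ζ : E d) :
    affInv M' v' (affMap M v ζ) =
      LinearMap.toContinuousLinearMap (Matrix.toEuclideanLin (M'⁻¹ * M)) ζ +
        Matrix.toEuclideanLin M'⁻¹ (v - v') := by
  rw [affInv, affMap, add_sub_assoc, map_add]
  congr 1
  ext i
  simp [Matrix.toLpLin_apply, Matrix.mulVec_mulVec]

/-- The pullback of `φ_j` along `T_j`, where
`φ_j = Φ (T_j⁻¹ ·) / √(∑ k, Φ (T_k⁻¹ ·) ^ 2)`. -/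
noncomputable def rootPullback (A : J → Matrix (Fin d) (Fin d) ℝ) (b : J → E d) (Φ : E d → ℝ)
    (j : J) (ζ : E d) : ℝ :=
  Φ ζ / Real.sqrt (∑' k, Φ (affInv (A k) (b k) (affMap (A j) (b j) ζ)) ^ 2)

theorem tsupport_rootPullback_subset (j : J) : tsupport (rootPullback A b Φ j) ⊆ tsupport Φ :=
  closure_mono fun ζ hζ h => hζ (by rw [rootPullback, h, zero_div])

theorem rootPullback_eventuallyEq (hcov : IsStructuredCovering A b P Q) (hΦ : tsupport Φ ⊆ Q)
    {F : J → Finset J} (hF : ∀ j k, k ∈ F j ↔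
      (affMap (A k) (b k) '' Q ∩ affMap (A j) (b j) '' Q).Nonempty) (j : J) {ζ : E d}
    (hζ : ζ ∈ Q) : rootPullback A b Φ j =ᶠ[𝓝 ζ] fun ζ => Φ ζ /
      Real.sqrt (∑ k ∈ F j, Φ (affInv (A k) (b k) (affMap (A j) (b j) ζ)) ^ 2) := by
  filter_upwards [hcov.isOpen_Q.mem_nhds hζ] with y hy
  rw [rootPullback, (hasSum_sq_apply_affInv hcov hΦ hF (Set.mem_image_of_mem _ hy)).tsum_eq]

theorem one_le_overlap_sum (hcov : IsStructuredCovering A b P Q) (hΦ : tsupport Φ ⊆ Q)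
    (hΦP : ∀ ξ ∈ P, Φ ξ = 1) {F : J → Finset J} (hF : ∀ j k, k ∈ F j ↔
      (affMap (A k) (b k) '' Q ∩ affMap (A j) (b j) '' Q).Nonempty) (j : J) {ζ : E d}
    (hζ : ζ ∈ Q) : 1 ≤ ∑ k ∈ F j, Φ (affInv (A k) (b k) (affMap (A j) (b j) ζ)) ^ 2 :=
  one_le_sum_sq hcov hΦP (ne_zero_of_mem_image hcov (Set.mem_image_of_mem _ hζ))
    (hasSum_sq_apply_affInv hcov hΦ hF (Set.mem_image_of_mem _ hζ))

theorem contDiff_overlap_sum (hs : ContDiff ℝ ∞ Φ) (F : Finset J) (j : J) :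
    ContDiff ℝ ∞ fun ζ => ∑ k ∈ F, Φ (affInv (A k) (b k) (affMap (A j) (b j) ζ)) ^ 2 :=
  ContDiff.sum fun _ _ =>
    (hs.comp ((contDiff_affInv _ _).comp (contDiff_affMap _ _))).pow 2

theorem contDiff_rootPullback (hcov : IsStructuredCovering A b P Q) (hs : ContDiff ℝ ∞ Φ)
    (hΦ : tsupport Φ ⊆ Q) (hΦP : ∀ ξ ∈ P, Φ ξ = 1) (j : J) :
    ContDiff ℝ ∞ (rootPullback A b Φ j) := by
  obtain ⟨N, F, -, hF⟩ := exists_overlap_finset hcov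
  rw [contDiff_iff_contDiffAt]
  intro ζ
  by_cases hζ : ζ ∈ tsupport Φ
  · refine ContDiffAt.congr_of_eventuallyEq ?_ (rootPullback_eventuallyEq hcov hΦ hF j (hΦ hζ))
    have h1 := one_pos.trans_le (one_le_overlap_sum hcov hΦ hΦP hF j (hΦ hζ))
    exact hs.contDiffAt.div ((contDiff_overlap_sum hs (F j) j).contDiffAt.sqrt h1.ne')
      (Real.sqrt_pos.2 h1).ne'
  · exact contDiffAt_const.congr_of_eventuallyEq (notMem_tsupport_iff_eventuallyEq.1
      fun h => hζ (tsupport_rootPullback_subset j h))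

theorem hasCompactSupport_of_tsupport_subset (hcov : IsStructuredCovering A b P Q)
    {g : E d → ℝ} (hg : tsupport g ⊆ Q) : HasCompactSupport g :=
  Metric.isCompact_of_isClosed_isBounded (isClosed_tsupport g) (hcov.bounded_Q.subset hg)

/-- The pullbacks are bounded together with all derivatives, because at most `N` terms of the sum
of squares matter on `Q`, and they arise from `Φ ^ 2` by affine maps with bounded linear part. -/
theorem exists_norm_iteratedFDeriv_rootPullback_le (hcov : IsStructuredCovering A b P Q)
    (hs : ContDiff ℝ ∞ Φ) (hΦ : tsupport Φ ⊆ Q) (hΦP : ∀ ξ ∈ P, Φ ξ = 1) (m : ℕ) :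
    ∃ C : ℝ, ∀ j ζ, ‖iteratedFDeriv ℝ m (rootPullback A b Φ j) ζ‖ ≤ C := by
  obtain ⟨N, F, hFN, hF⟩ := exists_overlap_finset hcov
  obtain ⟨K, hK⟩ := hcov.compat
  have hc := hasCompactSupport_of_tsupport_subset hcov hΦ
  have hs2 : ContDiff ℝ ∞ fun ζ => Φ ζ ^ 2 := hs.pow 2
  have hc2 : HasCompactSupport fun ζ => Φ ζ ^ 2 :=
    hc.comp_left (g := fun t : ℝ => t ^ 2) (by simp)
  set L : ℝ := max 1 (d * (d * K))
  have hL : 1 ≤ L := le_max_left _ _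
  obtain ⟨κ₁, -, hb1⟩ := exists_norm_iteratedFDeriv_le_of_hasCompactSupport hc hs m
  obtain ⟨c₂, hS, hb2⟩ := exists_norm_iteratedFDeriv_le_of_hasCompactSupport hc2 hs2 m
  set κ₂ : ℝ := N * (c₂ * L ^ m)
  have hb3 : ∀ j, ∀ i ≤ m, ∀ ζ, ‖iteratedFDeriv ℝ i
      (fun ζ => ∑ k ∈ F j, Φ (affInv (A k) (b k) (affMap (A j) (b j) ζ)) ^ 2) ζ‖ ≤ κ₂ := by
    intro j i hi ζ
    have h1 : ∀ k ∈ F j, ContDiff ℝ ∞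
        fun ζ => Φ (affInv (A k) (b k) (affMap (A j) (b j) ζ)) ^ 2 := fun k _ =>
      (hs.comp ((contDiff_affInv _ _).comp (contDiff_affMap _ _))).pow 2
    rw [iteratedFDeriv_fun_sum_apply fun k hk =>
      ((h1 k hk).of_le (by exact_mod_cast le_top)).contDiffAt]
    refine (norm_sum_le _ _).trans ?_
    have h2 : ∀ k ∈ F j, ‖iteratedFDeriv ℝ i
        (fun ζ => Φ (affInv (A k) (b k) (affMap (A j) (b j) ζ)) ^ 2) ζ‖ ≤
        c₂ * L ^ m := by
      intro k hk
      simp only [affInv_comp_affMap]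
      refine (norm_iteratedFDeriv_comp_affine_le hs2 _ _ _ _).trans ?_
      have h3 : ‖LinearMap.toContinuousLinearMap
          (Matrix.toEuclideanLin ((A k)⁻¹ * A j))‖ ≤ L := by
        refine opNorm_toEuclideanLin_le (by positivity) fun x => ?_
        refine (norm_toEuclideanLin_le (hK j k ?_) x).trans ?_
        · rw [Set.inter_comm]
          exact (hF j k).1 hk
        · gcongr
          exact le_max_right _ _
      refine mul_le_mul (hb2 i hi _) ?_ (by positivity) hS
      exact (pow_le_pow_left₀ (norm_nonneg _) h3 i).trans (pow_le_pow_right₀ hL hi)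
    refine (Finset.sum_le_card_nsmul _ _ _ h2).trans ?_
    rw [nsmul_eq_mul]
    have h4 : ((F j).card : ℝ) ≤ N := by exact_mod_cast hFN j
    exact mul_le_mul_of_nonneg_right h4 (by positivity)
  obtain ⟨C, hC⟩ := exists_norm_iteratedFDeriv_div_sqrt_le (d := d) m (max κ₁ κ₂)
  refine ⟨max C 0, fun j ζ => ?_⟩
  by_cases hζ : ζ ∈ tsupport Φ
  · rw [(Filter.EventuallyEq.iteratedFDeriv ℝ
      (rootPullback_eventuallyEq hcov hΦ hF j (hΦ hζ)) m).self_of_nhds]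
    exact (hC Φ _ hs (contDiff_overlap_sum hs (F j) j) ζ
      (one_le_overlap_sum hcov hΦ hΦP hF j (hΦ hζ))
      (fun i hi => (hb1 i hi ζ).trans (le_max_left _ _))
      (fun i hi => (hb3 j i hi ζ).trans (le_max_right _ _))).trans (le_max_left _ _)
  · have h0 : rootPullback A b Φ j =ᶠ[𝓝 ζ] fun _ => 0 :=
      notMem_tsupport_iff_eventuallyEq.1
        fun h => hζ (tsupport_rootPullback_subset j h)
    rw [(Filter.EventuallyEq.iteratedFDeriv ℝ h0 m).self_of_nhds, iteratedFDeriv_fun_zero,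
      Pi.zero_apply, norm_zero]
    exact le_max_right _ _

/-- The normalized functions `Φ (T_j⁻¹ ·)` form a root partition. -/
theorem exists_isRootPartition (hcov : IsStructuredCovering A b P Q) (hs : ContDiff ℝ ∞ Φ)
    (hΦ : tsupport Φ ⊆ Q) (hΦP : ∀ ξ ∈ P, Φ ξ = 1) :
    ∃ φ : J → 𝓢(E d, ℝ), (∀ j ξ, φ j ξ = Φ (affInv (A j) (b j) ξ) /
      Real.sqrt (∑' k, Φ (affInv (A k) (b k) ξ) ^ 2)) ∧ IsRootPartition A b Q φ := by
  obtain ⟨N, F, -, hF⟩ := exists_overlap_finset hcov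
  have hsupp : ∀ j, tsupport (fun ξ => rootPullback A b Φ j (affInv (A j) (b j) ξ)) ⊆
      affMap (A j) (b j) '' tsupport Φ := by
    intro j
    have hcl : IsCompact (affMap (A j) (b j) '' tsupport Φ) :=
      (hasCompactSupport_of_tsupport_subset hcov hΦ).image (contDiff_affMap _ _).continuous
    refine closure_minimal (fun ξ hξ => ?_) hcl.isClosed
    exact ⟨_, tsupport_rootPullback_subset j (subset_tsupport _ hξ),
      affMap_affInv (hcov.invertible j) _ _⟩
  have hcomp : ∀ j, HasCompactSupport
      fun ξ => rootPullback A b Φ j (affInv (A j) (b j) ξ) := fun j =>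
    ((hasCompactSupport_of_tsupport_subset hcov hΦ).image
      (contDiff_affMap _ _).continuous).of_isClosed_subset (isClosed_tsupport _) (hsupp j)
  have hsm : ∀ j, ContDiff ℝ ∞ fun ξ => rootPullback A b Φ j (affInv (A j) (b j) ξ) := fun j =>
    (contDiff_rootPullback hcov hs hΦ hΦP j).comp (contDiff_affInv _ _)
  have hval : ∀ j ξ, (hcomp j).toSchwartzMap (hsm j) ξ = Φ (affInv (A j) (b j) ξ) /
      Real.sqrt (∑' k, Φ (affInv (A k) (b k) ξ) ^ 2) := by
    intro j ξ
    change rootPullback A b Φ j (affInv (A j) (b j) ξ) = _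
    rw [rootPullback, affMap_affInv (hcov.invertible j)]
  refine ⟨fun j => (hcomp j).toSchwartzMap (hsm j), hval, fun j => ?_, fun ξ hξ => ?_,
    fun m => ?_⟩
  · exact (hsupp j).trans (Set.image_mono hΦ)
  · have h : ξ ∈ ⋃ j, affMap (A j) (b j) '' Q := by
      rw [hcov.covering_Q.2.1]
      exact hξ
    obtain ⟨j, hj⟩ := Set.mem_iUnion.1 h
    have h1 := hasSum_sq_apply_affInv hcov hΦ hF hj
    have h2 := one_pos.trans_le (one_le_sum_sq hcov hΦP hξ h1)
    have h3 := h1.div_const (∑ k ∈ F j, Φ (affInv (A k) (b k) ξ) ^ 2)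
    rw [div_self h2.ne'] at h3
    refine h3.congr_fun fun k => ?_
    rw [hval, h1.tsum_eq, div_pow, Real.sq_sqrt h2.le]
  · obtain ⟨C, hC⟩ := exists_norm_iteratedFDeriv_rootPullback_le hcov hs hΦ hΦP m
    refine ⟨C, fun j ξ => ?_⟩
    have h1 : (fun ζ => (hcomp j).toSchwartzMap (hsm j) (affMap (A j) (b j) ζ)) =
        rootPullback A b Φ j := by
      ext ζ
      change rootPullback A b Φ j (affInv (A j) (b j) (affMap (A j) (b j) ζ)) = _
      rw [affInv_affMap (hcov.invertible j)]
    rw [h1]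
    exact hC j ξ

end RootPartition

theorem proposition6p1 {d : ℕ} (α : Fin d → ℝ) (hα : IsAnisotropy α)
    (ht : E d → ℝ) (hreg : IsHybridRegulation α ht) (δ : ℝ) (hδ : 0 < δ)
    (A : ℤ → Matrix (Fin d) (Fin d) ℝ) (b : ℤ → E d) (P Q : Set (E d))
    (hcov : IsStructuredCovering A b P Q)
    (ξ₀ : ℤ → E d) (hξ₀ : ∀ j, ξ₀ j ≠ 0)
    (hA : ∀ j, A j = aniDilation α (δ * ht (ξ₀ j)))
    (κ : ℝ) (hκ : 0 < κ)
    (hball : ∀ j, affMap (A j) (b j) '' Q = aniBall α (ξ₀ j) (κ * (δ * ht (ξ₀ j))))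
    (C : ℝ) (hC : 0 < C)
    (hJ : ∀ j : ℤ, 0 ≤ j ↔ Disjoint (aniBall α (ξ₀ j) (δ * ht (ξ₀ j))) (aniBall α 0 C))
    (c : E d) (a : ℝ) (ha : 0 < a) (hQK : Q ⊆ cube c a) :
    (∀ (j : ℤ) (g : 𝓢'(E d, ℂ)) (h : 𝓢(E d, ℂ)),
      Distribution.dsupport (fourierT g) ⊆ affMap (A j) (b j) '' cube c a →
      tsupport (fourierS d h) ⊆ affMap (A j) (b j) '' cube c a →
      ∃ (G : E d → ℂ) (hG : G.HasTemperateGrowth) (hgh : (conv g h).HasTemperateGrowth),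
        g = Function.HasTemperateGrowth.toTemperedDistribution volume hG ∧
        ∀ (v : E d) (y : (Fin d → ℤ) → E d),
          (∀ n, y n = (Real.pi / a) • Matrix.toEuclideanLin (A j)⁻¹ (intVec n) + v) →
          (∀ x, HasSum (fun n =>
            (((2 * Real.pi) ^ d * ((2 * a) ^ d)⁻¹ * |(A j).det|⁻¹ : ℝ) : ℂ) *
              G (-y n) * h (x + y n)) (conv g h x)) ∧
          HasSum (fun n =>
            ((((2 * Real.pi) ^ d * ((2 * a) ^ d)⁻¹ * |(A j).det|⁻¹ : ℝ) : ℂ) *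
              G (-y n)) • toT (compSubConstCLM ℂ (-y n) h))
            (Function.HasTemperateGrowth.toTemperedDistribution volume hgh)) ∧
    (∀ φ : ℤ → 𝓢(E d, ℝ), IsRootPartition A b Q φ → ∀ f : 𝓢'(E d, ℂ),
      (∀ θ : 𝓢(E d, ℂ), IsSZero θ →
        Tendsto (fun k : ℕ × ℕ × ℕ =>
          (∑ j ∈ Finset.Icc (-(k.1 : ℤ)) k.2.1, ∑ n ∈ box d k.2.2,
            bracket f (frameElem (A j) (b j) a (φ j) n) •
              toT (frameElem (A j) (b j) a (φ j) n)) θ)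
          atTop (𝓝 (f θ))) ∧
      ∃ u : ℤ → 𝓢'(E d, ℂ),
        (∀ j, HasSum (fun n => bracket f (frameElem (A j) (b j) a (φ j) n) •
          toT (frameElem (A j) (b j) a (φ j) n)) (u j)) ∧
        ∃ (p : ℕ → MvPolynomial (Fin d) ℂ) (p₀ : MvPolynomial (Fin d) ℂ) (f₀ : 𝓢'(E d, ℂ)),
          Tendsto (fun k : ℕ × ℕ =>
            ∑ j ∈ Finset.Icc (-(k.1 : ℤ)) k.2, u j + polyT (p k.1)) atTop (𝓝 f₀) ∧
          f = f₀ + polyT p₀) ∧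
    (∀ Φ : E d → ℝ, ContDiff ℝ ∞ Φ → (∀ ξ, 0 ≤ Φ ξ) → (∀ ξ ∈ P, Φ ξ = 1) →
      tsupport Φ ⊆ Q →
      ∃ φ : ℤ → 𝓢(E d, ℝ),
        (∀ j ξ, φ j ξ = Φ (affInv (A j) (b j) ξ) /
          Real.sqrt (∑' k, Φ (affInv (A k) (b k) ξ) ^ 2)) ∧
        IsRootPartition A b Q φ) := by
  have hsym : ∀ j, (A j).IsHermitian := fun j => by
    rw [hA]
    exact Matrix.isHermitian_diagonal _
  refine ⟨fun j g h hg hh => exists_sampling_series (hcov.invertible j) (hsym j) (b j) c ha g h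
    hg hh, fun φ hφ f => ?_, fun Φ hΦ _ hΦP hΦQ => exists_isRootPartition hcov hΦ hΦQ hΦP⟩
  have : Nontrivial (E d) := ⟨_, _, hξ₀ 0⟩
  have hw := isPolyWeight hα hreg hδ hκ hcov hξ₀ hA hball
  have hQ0 : ∀ j, ∀ z ∈ affMap (A j) (b j) '' Q, z ≠ 0 := fun _ _ hz =>
    ne_zero_of_mem_image hcov hz
  refine ⟨fun θ hθ => tendsto_frame_expansion hw hcov.invertible hsym hQ0 ha hcov.isOpen_Q hQK hφ
    f hθ, fun j => localize (φ j) f, fun j => hasSum_frame_piece (hcov.invertible j) (hsym j) (b j)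
      ha hcov.isOpen_Q hQK (hφ.support j) f, ?_⟩
  -- the sets with non-negative index stay away from the origin
  obtain ⟨_, _, _, hrad⟩ := exists_radius_bounds hα hreg hδ hcov hξ₀ hball
  obtain ⟨ε, hε, hfar⟩ := exists_le_norm_of_le_aniNorm hα hreg hδ hcov hξ₀ hA hball hC
  refine exists_tendsto_sum_localize_add hw hcov.invertible hsym hQ0 ha hcov.isOpen_Q hQK hφ hε
    (fun j hj => hfar j (not_lt.1 fun hlt => ?_)) f
  refine Set.disjoint_left.1 ((hJ j).1 hj) (mem_aniBall_self α (ξ₀ j) (hrad j).1) ?_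
  change aniNorm α (ξ₀ j - 0) < C
  rwa [sub_zero]
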